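/- Let $N\ge 1$ and let $q>0$ be real. Put $i'=N+1-i$ and let $\rho=(\tfrac N2-1,\tfrac N2-2,\dots,1-\tfrac N2)$ (with middle entry $0$ for odd $N$ and both middle entries $0$ for even $N$). Let $g_{ij}=g^{ij}=\delta_{i,j'}\,q^{-\rho_i}$, let $$R=q\sum_{i\ne i'}e_{ii}\otimes e_{ii}+\sum_{i=i'}e_{ii}\otimes e_{ii}+\sum_{i\neq j,j'}e_{ii}\otimes e_{jj}+q^{-1}\sum_{i\ne i'}e_{i'i'}\otimes e_{ii}+(q-q^{-1})\sum_{i>j}e_{ij}\otimes e_{ji}-(q-q^{-1})\sum_{i>j}q^{\rho_i-\rho_j}e_{ij}\otimes e_{i'j'}$$ be the R-matrix of $O_q(N)$, with entries $R^{ab}_{kl}$ (the coefficient of $e_{ak}\otimes e_{bl}$), and put $\hat R^{ij}_{kl}=R^{ji}_{kl}$. Let $(P^0)^{ij}_{kl}=g^{ij}g_{kl}/(g_{mn}g^{mn})$ and define $P^\pm$ by $\hat R=qP^+-q^{-1}P^-+q^{1-N}P^0$ and $1=P^++P^-+P^0$. Let $O_q(N)$ be the complex algebra with generators $A^i_j$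 and relations $\hat R^{ik}_{mn}A^m_jA^n_l=A^i_nA^k_m\hat R^{nm}_{jl}$ and $g_{ij}A^i_kA^j_l=g_{kl}$. Let quantum Euclidean space be the algebra with generators $x^i$ and relations $(P^-)^{ij}_{kl}x^kx^l=0$, and let the quantum sphere $S_q^{N-1}$ be the algebra with generators $t^i$ and relations $(P^-)^{ij}_{kl}t^kt^l=0$, $g_{ij}t^it^j=1$. A complex tensor $J^{i_1\dots i_n}$ is called invariant if $A^{i_1}_{j_1}\cdots A^{i_n}_{j_n}J^{j_1\dots j_n}=J^{i_1\dots i_n}$ in $O_q(N)$, and symmetric if $(P^-)^{i_l i_{l+1}}_{j_l j_{l+1}}J^{j_1\dots j_n}=0$ for every $l$ (acting on the $l$-th and $(l+1)$-st index). Then there are tensors $I^{i_1\dots i_n}(q)$, one for each even $n\ge 0$, with $I=1$ for $n=0$, such that: 1. (Existence) $I^{i_1\dots i_n}(q)$ is analytic in $q\in(0,\infty)$, and it is nonzero, invariant and symmetric for every $q>0$. 2. (Uniqueness up to normalization) If $U\subseteq(0,\infty)$ is an open interval containing $1$, and $J^{i_1\dots i_n}(q)$, $n$ even, is analytic on $U$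 and is invariant and symmetric for every $q\in U$, then $J(q)=f(q)I(q)$ on $U$ for a function $f$ analytic on $U$. 3. (Normalization) $g_{i_li_{l+1}}I^{i_1\dots i_n}=I^{i_1\dots i_{l-1}i_{l+2}\dots i_n}$ for every even $n\ge2$ and every $l$. 4. $I^{ij}$ is a nonzero multiple of $g^{ij}$ for every $q>0$. 5. (Explicit form) Consider either of the two calculi $\partial^ix^j=g^{ij}+q(\hat R^{-1})^{ij}_{kl}x^k\partial^l$ and $\partial^ix^j=g^{ij}+q^{-1}\hat R^{ij}_{kl}x^k\partial^l$, where $\partial^i1=0$ and $(P^-)^{ij}_{kl}\partial^k\partial^l=0$. For every $q>0$ there is exactly one such system of linear operators $\partial^i$ on quantum Euclidean space. With $\Delta=g_{ij}\partial^i\partial^j$ one has, for every even $n$, $I^{i_1\dots i_n}=\lambda_n\,\Delta^{n/2}(x^{i_1}\cdots x^{i_n})$, where $\lambda_n=\lambda_n(q)$ is analytic on $(0,\infty)$ (and depends on the calculus). 6. (Classical limit) At $q=1$, $I$ is the classical symmetric invariant tensor: for $n=2m$, $$I^{i_1\dots i_{2m}}(1)=\frac{1}{2^m\,m!\,N(N+2)\cdots(N+2m-2)}\sum_{\sigma\in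 S_{2m}}\prod_{k=1}^m g^{i_{\sigma(2k-1)}i_{\sigma(2k)}}\Big|_{q=1}.$$ 7. (Integral) There are linear functionals $\langle\,\cdot\,\rangle_t$ on $S_q^{N-1}$, $q>0$, with $\langle1\rangle_t=1$, $\langle t^{i_1}\cdots t^{i_n}\rangle_t=I^{i_1\dots i_n}$ for even $n$ and $=0$ for odd $n$; for every $n$ the moments $\langle t^{i_1}\cdots t^{i_n}\rangle_t$ form an invariant tensor, analytic in $q\in(0,\infty)$. If $\Psi_q$, $q\in U$, are linear functionals on $S_q^{N-1}$, with $U\subseteq(0,\infty)$ an open interval containing $1$, whose moments $\Psi_q(t^{i_1}\cdots t^{i_n})$ are for every $n$ analytic on $U$ and invariant for every $q\in U$, then $\Psi_q=\Psi_q(1)\,\langle\,\cdot\,\rangle_t$ for every $q\in U$. -/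

import Mathlib

noncomputable section

namespace QSphere

/-- The real power `q ^ a` (for `q > 0`), as a complex number. -/
def qpow (q a : ℝ) : ℂ := ((q ^ a : ℝ) : ℂ)

/-- The exponents `ρ = (N/2-1, N/2-2, …, 1-N/2)`, where for odd `N` the middle entry is `0` and for
even `N` both middle entries are `0`. Indices run from `0` to `N-1`, and the conjugate
index `i' = N-1-i` is `Fin.rev i`. -/
def rho (N : ℕ) (i : Fin N) : ℝ :=
  if i < i.rev then (N : ℝ) / 2 - 1 - (i : ℕ)
  else if i = i.rev then 0
  else -((N : ℝ) / 2 - 1 - (i.rev : ℕ))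

/-- The metric `g_{ij} = δ_{i,j'} q^{-ρ_i}`. -/
def metric (N : ℕ) (q : ℝ) : Matrix (Fin N) (Fin N) ℂ :=
  Matrix.of fun i j => if j = i.rev then qpow q (-rho N i) else 0

lemma rho_rev (N : ℕ) (i : Fin N) : rho N i.rev = -rho N i := by
  unfold rho
  rw [Fin.rev_rev]
  rcases lt_trichotomy i i.rev with h | h | h
  · rw [if_neg (not_lt.mpr h.le), if_neg h.ne', if_pos h]
  · rw [if_neg (by rw [← h]; exact lt_irrefl _), if_pos h.symm,
      if_neg (by rw [← h]; exact lt_irrefl _), if_pos h, neg_zero]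
  · rw [if_pos h, if_neg (not_lt.mpr h.le), if_neg h.ne', neg_neg]

/-- The metric is its own inverse, `g_{ik} g_{kj} = δ_{ij}`: the tensor `g^{ij}` with upper indices,
determined by `g_{ik} g^{kj} = δ_i^j`, has the same components as `g_{ij}`. -/
lemma metric_mul_self (N : ℕ) {q : ℝ} (hq : 0 < q) : metric N q * metric N q = 1 := by
  ext i j
  rw [Matrix.mul_apply, Finset.sum_eq_single i.rev]
  · by_cases h : j = i
    · subst h
      have h1 : qpow q (-rho N j) * qpow q (rho N j) = 1 := by
        unfold qpow
        rw [← Complex.ofReal_mul, ← Real.rpow_add hq, neg_add_cancel, Real.rpow_zero,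
          Complex.ofReal_one]
      simpa [metric, rho_rev] using h1
    · have h' : i ≠ j := fun e => h e.symm
      simp [metric, h, h']
  · intro b _ hb
    simp [metric, hb]
  · simp

/-- The entries `R^{ab}_{kl}` (the coefficient of `e_{ak} ⊗ e_{bl}`) of the R-matrix of `O_q(N)`
(Faddeev, Reshetikhin, Takhtajan):
`R = q ∑_{i≠i'} e_ii ⊗ e_ii + ∑_{i=i'} e_ii ⊗ e_ii + ∑_{i≠j,j'} e_ii ⊗ e_jj
  + q⁻¹ ∑_{i≠i'} e_{i'i'} ⊗ e_ii + (q-q⁻¹) ∑_{i>j} e_ij ⊗ e_ji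
  - (q-q⁻¹) ∑_{i>j} q^{ρ_i-ρ_j} e_ij ⊗ e_{i'j'}`. -/
def rMatrix (N : ℕ) (q : ℝ) (a b k l : Fin N) : ℂ :=
  (if a = k ∧ b = l then
    (if a = b then (if a = a.rev then 1 else (q : ℂ)) else if b = a.rev then (q : ℂ)⁻¹ else 1)
   else 0)
  + (if k < a ∧ b = k ∧ l = a then (q : ℂ) - (q : ℂ)⁻¹ else 0)
  - (if k < a ∧ b = a.rev ∧ l = k.rev then ((q : ℂ) - (q : ℂ)⁻¹) * qpow q (rho N a - rho N k)
     else 0)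

/-- The braid matrix `R̂^{ij}_{kl} = R^{ji}_{kl}`; rows are `(i, j)`, columns are `(k, l)`. -/
def braid (N : ℕ) (q : ℝ) : Matrix (Fin N × Fin N) (Fin N × Fin N) ℂ :=
  Matrix.of fun ij kl => rMatrix N q ij.2 ij.1 kl.1 kl.2

/-- The projector `(P⁰)^{ij}_{kl} = g^{ij} g_{kl} / (g_{mn} g^{mn})`. For `q ≠ 1`
one has `g_{mn} g^{mn} = (q^N - 1)(q^{2-N} + 1) / (q² - 1)`, and `g_{mn} g^{mn} = N` for `q = 1`. -/
def projZero (N : ℕ) (q : ℝ) : Matrix (Fin N × Fin N) (Fin N × Fin N) ℂ :=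
  Matrix.of fun ij kl => metric N q ij.1 ij.2 * metric N q kl.1 kl.2 /
    (∑ m, ∑ n, metric N q m n * metric N q m n)

/-- The `q`-antisymmetrizer `P⁻`, obtained by solving
`R̂ = q P⁺ - q⁻¹ P⁻ + q^{1-N} P⁰`, `1 = P⁺ + P⁻ + P⁰` for `P⁻`. -/
def projMinus (N : ℕ) (q : ℝ) : Matrix (Fin N × Fin N) (Fin N × Fin N) ℂ :=
  ((q : ℂ) + (q : ℂ)⁻¹)⁻¹ •
    ((q : ℂ) • (1 : Matrix (Fin N × Fin N) (Fin N × Fin N) ℂ) - braid N q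
      + (qpow q (1 - N) - (q : ℂ)) • projZero N q)

/-- The defining relations of `O_q(N)`:
`R̂^{ik}_{mn} A^m_j A^n_l = A^i_n A^k_m R̂^{nm}_{jl}` and `g_{ij} A^i_k A^j_l = g_{kl}`.
The free generator `(i, j)` is `A^i_j`. -/
inductive OqRel (N : ℕ) (q : ℝ) :
    FreeAlgebra ℂ (Fin N × Fin N) → FreeAlgebra ℂ (Fin N × Fin N) → Prop
  | rtt (i k j l : Fin N) : OqRel N q
      (∑ m, ∑ n, braid N q (i, k) (m, n) • (FreeAlgebra.ι ℂ (m, j) * FreeAlgebra.ι ℂ (n, l)))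
      (∑ n, ∑ m, braid N q (n, m) (j, l) • (FreeAlgebra.ι ℂ (i, n) * FreeAlgebra.ι ℂ (k, m)))
  | metric (k l : Fin N) : OqRel N q
      (∑ i, ∑ j, metric N q i j • (FreeAlgebra.ι ℂ (i, k) * FreeAlgebra.ι ℂ (j, l)))
      (algebraMap ℂ _ (metric N q k l))

/-- The function algebra on the quantum orthogonal group `O_q(N)`. -/
abbrev Oq (N : ℕ) (q : ℝ) : Type := RingQuot (OqRel N q)

/-- The generators `A^i_j` of `O_q(N)`. -/
def Oq.A (N : ℕ) (q : ℝ) (i j : Fin N) : Oq N q :=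
  RingQuot.mkAlgHom ℂ (OqRel N q) (FreeAlgebra.ι ℂ (i, j))

/-- The relations `(P⁻)^{ij}_{kl} x^k x^l = 0` of quantum Euclidean space. -/
inductive EuclRel (N : ℕ) (q : ℝ) : FreeAlgebra ℂ (Fin N) → FreeAlgebra ℂ (Fin N) → Prop
  | comm (i j : Fin N) : EuclRel N q
      (∑ k, ∑ l, projMinus N q (i, j) (k, l) • (FreeAlgebra.ι ℂ k * FreeAlgebra.ι ℂ l)) 0

/-- The function algebra on quantum Euclidean space. -/
abbrev Eucl (N : ℕ) (q : ℝ) : Type := RingQuot (EuclRel N q)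

/-- The coordinates `x^i`. -/
def Eucl.x (N : ℕ) (q : ℝ) (i : Fin N) : Eucl N q :=
  RingQuot.mkAlgHom ℂ (EuclRel N q) (FreeAlgebra.ι ℂ i)

/-- The relations `(P⁻)^{ij}_{kl} t^k t^l = 0` and `g_{ij} t^i t^j = 1` of the quantum sphere. -/
inductive SphereRel (N : ℕ) (q : ℝ) : FreeAlgebra ℂ (Fin N) → FreeAlgebra ℂ (Fin N) → Prop
  | comm (i j : Fin N) : SphereRel N q
      (∑ k, ∑ l, projMinus N q (i, j) (k, l) • (FreeAlgebra.ι ℂ k * FreeAlgebra.ι ℂ l)) 0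
  | radius : SphereRel N q
      (∑ i, ∑ j, metric N q i j • (FreeAlgebra.ι ℂ i * FreeAlgebra.ι ℂ j)) 1

/-- The function algebra on the quantum sphere `S_q^{N-1}`. -/
abbrev Sphere (N : ℕ) (q : ℝ) : Type := RingQuot (SphereRel N q)

/-- The generators `t^i` of the quantum sphere. -/
def Sphere.t (N : ℕ) (q : ℝ) (i : Fin N) : Sphere N q :=
  RingQuot.mkAlgHom ℂ (SphereRel N q) (FreeAlgebra.ι ℂ i)

/-- Tensors `J^{i_1 … i_n}` of rank `n` in dimension `N`. -/
abbrev QTensor (N n : ℕ) : Type := (Fin n → Fin N) → ℂ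

/-- Invariance under the coaction of `O_q(N)`:
`A^{i_1}_{j_1} ⋯ A^{i_n}_{j_n} J^{j_1 … j_n} = J^{i_1 … i_n}` in the algebra `O_q(N)`. -/
def IsInvariant {N n : ℕ} (q : ℝ) (J : QTensor N n) : Prop :=
  ∀ i : Fin n → Fin N,
    ∑ j : Fin n → Fin N, J j • (List.ofFn fun k => Oq.A N q (i k) (j k)).prod
      = algebraMap ℂ (Oq N q) (J i)

/-- `q`-symmetry: `(P⁻)^{i_l i_{l+1}}_{a b} J^{i_1 … a b … i_n} = 0` for every pair of
neighbouring positions `l, l+1`. -/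
def IsSymmetric {N n : ℕ} (q : ℝ) (J : QTensor N n) : Prop :=
  ∀ (l : ℕ) (hl : l + 1 < n) (i : Fin n → Fin N),
    ∑ a, ∑ b, projMinus N q (i ⟨l, by omega⟩, i ⟨l + 1, hl⟩) (a, b) *
      J (Function.update (Function.update i ⟨l, by omega⟩ a) ⟨l + 1, hl⟩ b) = 0

/-- Contraction of the neighbouring positions `l, l+1` with the metric:
`g_{ab} J^{i_1 … i_l a b i_{l+1} … i_n}` (`a` in position `l`, `b` in position `l+1`, counted
from `0`). -/
def contract {N n : ℕ} (q : ℝ) (l : Fin (n + 1)) (J : QTensor N (n + 2)) : QTensor N n :=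
  fun i => ∑ a, ∑ b, metric N q a b *
    J (Fin.insertNth (α := fun _ => Fin N) l.castSucc a
      (Fin.insertNth (α := fun _ => Fin N) l b i))

/-- A system of derivatives `∂^i` acting on quantum Euclidean space, with coefficient matrix `B`:
`∂^i 1 = 0`, `∂^i x^j = g^{ij} + B^{ij}_{kl} x^k ∂^l` and `(P⁻)^{ij}_{kl} ∂^k ∂^l = 0`. -/
structure IsCalculus (N : ℕ) (q : ℝ) (B : Matrix (Fin N × Fin N) (Fin N × Fin N) ℂ)
    (d : Fin N → (Eucl N q →ₗ[ℂ] Eucl N q)) : Prop where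
  map_one : ∀ i, d i 1 = 0
  leibniz : ∀ i j f, d i (Eucl.x N q j * f) =
    metric N q i j • f + ∑ k, ∑ l, B (i, j) (k, l) • (Eucl.x N q k * d l f)
  comm : ∀ i j f, ∑ k, ∑ l, projMinus N q (i, j) (k, l) • d k (d l f) = 0

/-- The calculus `∂^i x^j = g^{ij} + q (R̂⁻¹)^{ij}_{kl} x^k ∂^l`. -/
def calcFirst (N : ℕ) (q : ℝ) : Matrix (Fin N × Fin N) (Fin N × Fin N) ℂ :=
  (q : ℂ) • (braid N q)⁻¹

/-- The calculus `∂^i x^j = g^{ij} + q⁻¹ R̂^{ij}_{kl} x^k ∂^l`. -/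
def calcSecond (N : ℕ) (q : ℝ) : Matrix (Fin N × Fin N) (Fin N × Fin N) ℂ :=
  (q : ℂ)⁻¹ • braid N q

/-- The Laplacian `Δ = g_{ij} ∂^i ∂^j`. -/
def laplacian {N : ℕ} {q : ℝ} (d : Fin N → (Eucl N q →ₗ[ℂ] Eucl N q)) :
    Eucl N q →ₗ[ℂ] Eucl N q :=
  ∑ i, ∑ j, metric N q i j • (d i ∘ₗ d j)

/-- The classical totally symmetric invariant tensor of rank `2m`: the sum of
`∏ g^{i_a i_b}` over all permutations of the indices (taken in consecutive pairs), divided by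
`2^m m! N (N+2) ⋯ (N+2m-2)`, where `g` is the classical metric (`q = 1`). -/
def classicalTensor (N m : ℕ) : QTensor N (2 * m) := fun i =>
  (∑ s : Equiv.Perm (Fin (2 * m)), ∏ k : Fin m,
      metric N 1 (i (s ⟨2 * k, by omega⟩)) (i (s ⟨2 * k + 1, by omega⟩))) /
    (2 ^ m * (m.factorial : ℂ) * ∏ k ∈ Finset.range m, ((N : ℂ) + 2 * k))

/-- The moments `⟨t^{i_1} ⋯ t^{i_n}⟩` of a linear functional on the quantum sphere. -/
def moments {N : ℕ} {q : ℝ} (φ : Sphere N q →ₗ[ℂ] ℂ) (n : ℕ) : QTensor N n :=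
  fun i => φ (List.ofFn fun k => Sphere.t N q (i k)).prod

/-- A family of invariant integrals over the quantum spheres `S_q^{N-1}`, `q ∈ U`: linear
functionals that are invariant under `O_q(N)` and whose moments are analytic in `q` on `U`. -/
def IsInvariantIntegral (N : ℕ) (U : Set ℝ) (Φ : (q : ℝ) → (Sphere N q →ₗ[ℂ] ℂ)) : Prop :=
  ∀ n, AnalyticOnNhd ℝ (fun q => moments (Φ q) n) U ∧ ∀ q ∈ U, IsInvariant q (moments (Φ q) n)

end QSphere

end

/-! Existence. The tensor is `lapTensor`, a normalization of the scalar Δ^m(x^{i_1}⋯x^{i_{2m}}). It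
is symmetric because the x^i satisfy P⁻xx = 0, and invariant because Δ commutes with the coaction of
O_q(N) (`coaction_laplacian`). Contracting two neighbours inserts r² = g_{ij}x^i x^j, which is
central (`Eucl.radius_comm`), and Δ^{m+1}(r² f) is a multiple of Δ^m f for f of degree 2m
(`laplacian_pow_radius`). The factor is a sum of nonnegative terms with a positive one, so it can be
normalized away; since repeated contraction ends at 1, the tensor is nonzero. All of this rests on
properties of R̂: the quadratic relation (`braid_mul_self`), the crossing relation with the metric
(`braid_cup_crossing`) and the Yang–Baxter equation (`braid_yangBaxter`). They are collected in
`BraidData`, which is stable under inverting R̂ and q, so that one argument serves both calculi.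

Uniqueness. For q ≠ 1 a symmetric invariant tensor J of rank n ≥ 2 with vanishing contraction is
zero (`eq_zero_of_contract_eq_zero`). Such a J is an eigenvector of R̂ with eigenvalue q at every
pair of neighbours. Both R̂ and R̂⁻¹ give vector representations of O_q(N), and by invariance a
strand moved through J by either of them leaves J unchanged. Closing that strand with a twisted
trace produces the factor q^{N-1}q^{n-1} in one representation and its inverse in the other, so J =
0. By induction on the rank J = f·I, where f is the full contraction of J. At q = 1 the two factors
coincide and nothing follows; there the identity is obtained by continuity.

Integral. A functional on the sphere is determined by its moments. These are symmetric and contract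
to one another, so uniqueness applies to even ranks, while the character A ↦ -1 of O_q(N) kills
invariant tensors of odd rank. Conversely, a function on words with the symmetry and contractions of
monomials defines a functional (`Sphere.exists_functional`).

Classical limit. At q = 1 the braid matrix is the flip, the ∂^i are derivations, and Δ^m of a
monomial is a sum over all permutations. -/

set_option linter.unusedSectionVars false

noncomputable section

namespace QSphere

/-! ### Entries of the braid matrix and geometric sums of powers of q. -/

section Entries

variable {N : ℕ} {q : ℝ}

lemma qpow_add (hq : 0 < q) (a b : ℝ) : qpow q (a + b) = qpow q a * qpow q b := by
  unfold qpow
  rw [Real.rpow_add hq, Complex.ofReal_mul]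

lemma qpow_zero (q : ℝ) : qpow q 0 = 1 := by simp [qpow]

lemma qpow_one (q : ℝ) : qpow q 1 = q := by simp [qpow]

lemma qpow_ne_zero (hq : 0 < q) (a : ℝ) : qpow q a ≠ 0 := by
  unfold qpow
  exact_mod_cast (Real.rpow_pos_of_pos hq a).ne'

lemma qpow_neg (hq : 0 < q) (a : ℝ) : qpow q (-a) = (qpow q a)⁻¹ := by
  exact eq_inv_of_mul_eq_one_left (by rw [← qpow_add hq, neg_add_cancel, qpow_zero])

lemma qpow_sub (hq : 0 < q) (a b : ℝ) : qpow q (a - b) = qpow q a * (qpow q b)⁻¹ := by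
  rw [sub_eq_add_neg, qpow_add hq, qpow_neg hq]

lemma ofReal_ne_zero_of_pos (hq : 0 < q) : (q : ℂ) ≠ 0 := by exact_mod_cast hq.ne'

/-- The power `q ^ ρ_i`. -/
def rhoPow (N : ℕ) (q : ℝ) (i : Fin N) : ℂ := qpow q (rho N i)

lemma rhoPow_ne_zero (hq : 0 < q) (i : Fin N) : rhoPow N q i ≠ 0 := qpow_ne_zero hq _

lemma rhoPow_rev (hq : 0 < q) (i : Fin N) : rhoPow N q i.rev = (rhoPow N q i)⁻¹ := by
  rw [rhoPow, rho_rev, qpow_neg hq, rhoPow]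

lemma rhoPow_of_rev_eq {i : Fin N} (h : i = i.rev) : rhoPow N q i = 1 := by
  rw [rhoPow, rho, if_neg (by rw [← h]; exact lt_irrefl _), if_pos h, qpow_zero]

lemma metric_apply (hq : 0 < q) (i j : Fin N) :
    metric N q i j = if j = i.rev then (rhoPow N q i)⁻¹ else 0 := by
  rw [metric, Matrix.of_apply, qpow_neg hq, rhoPow]

/-- The coefficient of `e_l ⊗ e_k` in the diagonal part of `R̂ (e_k ⊗ e_l)`. -/
def swapWeight (N : ℕ) (q : ℝ) (k l : Fin N) : ℂ :=
  if k = l then (if k = k.rev then 1 else (q : ℂ)) else if l = k.rev then (q : ℂ)⁻¹ else 1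

/-- The deformation parameter `q - q⁻¹`. -/
def qgap (q : ℝ) : ℂ := (q : ℂ) - (q : ℂ)⁻¹

lemma braid_apply (hq : 0 < q) (a b k l : Fin N) :
    braid N q (a, b) (k, l) = (if b = k ∧ a = l then swapWeight N q k l else 0)
      + (if k < l ∧ a = k ∧ b = l then qgap q else 0)
      - (if k < b ∧ a = b.rev ∧ l = k.rev then
          qgap q * (rhoPow N q b * (rhoPow N q k)⁻¹) else 0) := by
  simp only [braid, Matrix.of_apply, rMatrix, qpow_sub hq, rhoPow, qgap]
  congr 1
  congr 1
  · by_cases h : b = k ∧ a = l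
    · rw [if_pos h, if_pos h, h.1, h.2, swapWeight]
    · rw [if_neg h, if_neg h]
  · refine if_congr ?_ rfl rfl
    constructor
    · rintro ⟨h1, h2, h3⟩; subst h2 h3; exact ⟨h1, rfl, rfl⟩
    · rintro ⟨h1, h2, h3⟩; subst h2 h3; exact ⟨h1, rfl, rfl⟩

lemma swapWeight_comm (k l : Fin N) : swapWeight N q k l = swapWeight N q l k := by
  unfold swapWeight
  by_cases h : k = l
  · subst h; rfl
  · rw [if_neg h, if_neg (Ne.symm h)]
    exact if_congr ⟨fun h => by rw [h, Fin.rev_rev], fun h => by rw [h, Fin.rev_rev]⟩ rfl rfl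

lemma swapWeight_rev (k l : Fin N) : swapWeight N q k.rev l.rev = swapWeight N q k l := by
  unfold swapWeight
  simp only [Fin.rev_rev, Fin.rev_eq_iff]

/-- Transposition preserves each of the three kinds of entries; for the last kind the weights agree
because ρ is odd under conjugation of indices. This lets rows be read as columns and every matrix
identity be transposed. -/
lemma braid_symm (hq : 0 < q) (a b k l : Fin N) :
    braid N q (a, b) (k, l) = braid N q (k, l) (a, b) := by
  rw [braid_apply hq, braid_apply hq]
  congr 1
  congr 1
  · by_cases h : b = k ∧ a = l
    · obtain ⟨rfl, rfl⟩ := h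
      simp [swapWeight_comm]
    · rw [if_neg h, if_neg]
      rintro ⟨h1, h2⟩
      exact h ⟨h2.symm, h1.symm⟩
  · by_cases h : a = k ∧ b = l
    · obtain ⟨rfl, rfl⟩ := h; rfl
    · rw [if_neg (fun h' => h h'.2), if_neg (fun h' => h ⟨h'.2.1.symm, h'.2.2.symm⟩)]
  · by_cases h : a = b.rev ∧ l = k.rev
    · obtain ⟨rfl, rfl⟩ := h
      refine if_congr ?_ ?_ rfl
      · simp [Fin.rev_lt_rev]
      · rw [rhoPow_rev hq, rhoPow_rev hq, inv_inv]; ring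
    · rw [if_neg (fun h' => h h'.2), if_neg]
      rintro ⟨-, h1, h2⟩
      exact h ⟨by rw [h2, Fin.rev_rev], by rw [h1, Fin.rev_rev]⟩

/-- Symmetry under reversing the order of the factors and conjugating all indices; it saves half of
the cases of the Yang–Baxter equation. -/
lemma braid_rev (hq : 0 < q) (a b k l : Fin N) :
    braid N q (b.rev, a.rev) (l.rev, k.rev) = braid N q (a, b) (k, l) := by
  rw [braid_apply hq, braid_apply hq]
  simp only [Fin.rev_inj, Fin.rev_lt_rev, Fin.rev_rev, swapWeight_rev]
  congr 1
  congr 1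
  · by_cases h : b = k ∧ a = l
    · obtain ⟨rfl, rfl⟩ := h
      simp [swapWeight_comm]
    · rw [if_neg h, if_neg (fun h' => h h'.symm)]
  · refine if_congr ⟨?_, ?_⟩ rfl rfl <;> rintro ⟨h1, h2, h3⟩ <;> exact ⟨h1, h3, h2⟩
  · by_cases h : a = b.rev ∧ l = k.rev
    · obtain ⟨rfl, rfl⟩ := h
      simp only [Fin.rev_rev, and_true, Fin.lt_rev_iff, mul_comm (rhoPow N q b)]
    · rw [if_neg (fun h' => h ⟨h'.2.1.symm, h'.2.2.symm⟩), if_neg (fun h' => h h'.2)]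

/-- The crossing relation between the braid matrix and the metric. -/
lemma braid_crossing (hq : 0 < q) (a b c x : Fin N) :
    (rhoPow N q a)⁻¹ * (braid N q (b, c) (a.rev, x)
        - if b = a.rev ∧ c = x then qgap q else 0)
      = rhoPow N q c * (braid N q (a, b) (x, c.rev)
        - if a = x ∧ b = c.rev then qgap q else 0) := by
  have ha := rhoPow_ne_zero (N := N) hq a
  have hc := rhoPow_ne_zero (N := N) hq c
  rw [braid_apply hq, braid_apply hq]
  -- Both sides are supported on three families of indices: one met by the weighted swap, and two
  -- met only by the `qgap q` terms. In the first, subtracting `qgap q` turns a weight q on one side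
  -- into the weight q⁻¹ of the other.
  by_cases h1 : c = a.rev ∧ b = x
  · obtain ⟨rfl, rfl⟩ := h1
    simp only [rhoPow_rev hq, Fin.rev_rev, lt_irrefl, false_and, if_false, and_self, if_true]
    congr 1
    unfold swapWeight
    by_cases h2 : a = b
    · subst h2
      by_cases h3 : a = a.rev
      · simp [← h3]
      · simp [Ne.symm h3, h3, qgap]
    · by_cases h3 : b = a.rev
      · subst h3
        simp [h2, Ne.symm h2, qgap]
      · have h4 : a ≠ b.rev := fun h => h3 (by rw [h, Fin.rev_rev])
        simp [h2, Ne.symm h2, h3, Ne.symm h3, h4, Fin.rev_rev]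
  · have e1 : ¬ (c = a.rev ∧ b = x) := h1
    have e2 : ¬ (b = x ∧ a = c.rev) := fun h => h1 ⟨by rw [h.2, Fin.rev_rev], h.1⟩
    rw [if_neg e1, if_neg e2]
    by_cases h2 : b = a.rev ∧ x = c
    · obtain ⟨rfl, rfl⟩ := h2
      have h3 : x ≠ a.rev := fun h => h1 ⟨h, h.symm⟩
      by_cases h4 : x = a
      · subst h4
        rcases lt_or_gt_of_ne h3 with h5 | h5
        · simp [rhoPow_rev hq, h5, not_lt.mpr h5.le]
          try field_simp
        · simp [rhoPow_rev hq, h5, not_lt.mpr h5.le]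
          try field_simp
      · have h6 : a ≠ x := Ne.symm h4
        rcases lt_or_gt_of_ne h3 with h5 | h5
        · simp [rhoPow_rev hq, h5, not_lt.mpr h5.le, h4, h6]
          try field_simp
        · simp [h5, not_lt.mpr h5.le, h4, h6]
    · by_cases h3 : x = a ∧ b = c.rev
      · obtain ⟨rfl, rfl⟩ := h3
        have h3 : c ≠ x := fun h => h2 ⟨by rw [h], h.symm⟩
        have h4 : c.rev ≠ x := fun h => h1 ⟨by rw [← h, Fin.rev_rev], h⟩
        rcases lt_or_gt_of_ne h4 with h5 | h5
        · have h6 : x.rev < c := by rwa [Fin.rev_lt_iff] at h5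
          simp [rhoPow_rev hq, not_lt.mpr h5.le, h3, Ne.symm h3, h6]
          try field_simp
        · have h6 : ¬ x.rev < c := by rw [Fin.rev_lt_iff]; exact not_lt.mpr h5.le
          simp [h5, h3, Ne.symm h3, h6]
      · have e3 : ¬ (b = a.rev ∧ c = x) := fun h => h2 ⟨h.1, h.2.symm⟩
        have e4 : ¬ (a = x ∧ b = c.rev) := fun h => h3 ⟨h.1.symm, h.2⟩
        have e5 : ¬ (a.rev < c ∧ b = c.rev ∧ x = a.rev.rev) := by
          rw [Fin.rev_rev]; exact fun h => h3 ⟨h.2.2, h.2.1⟩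
        have e6 : ¬ (x < b ∧ a = b.rev ∧ c.rev = x.rev) := fun h =>
          h2 ⟨by rw [h.2.1, Fin.rev_rev], (Fin.rev_inj.1 h.2.2).symm⟩
        rw [if_neg (fun h => e3 h.2), if_neg e5, if_neg e3, if_neg (fun h => e4 h.2), if_neg e6,
          if_neg e4]
        simp

lemma rho_of_lt {i : Fin N} (h : i < i.rev) : rho N i = (N : ℝ) / 2 - 1 - (i : ℕ) := if_pos h

lemma rho_of_gt {i : Fin N} (h : i.rev < i) : rho N i = (N : ℝ) / 2 - (i : ℕ) := by
  rw [rho, if_neg (not_lt.mpr h.le), if_neg h.ne', Fin.val_rev, Nat.cast_sub (by omega)]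
  push_cast
  ring

lemma swapWeight_self_rev (i : Fin N) :
    swapWeight N q i i.rev = if i = i.rev then 1 else (q : ℂ)⁻¹ := by
  unfold swapWeight
  by_cases h : i = i.rev
  · rw [if_pos h, if_pos h, if_pos h]
  · rw [if_neg h, if_pos rfl, if_neg h]

/-- One step of the telescoping sum `sum_Ioi_rhoPow_sq`. The exponent ρ drops by 1 from one index to
the next, except in the middle, where it drops twice by 1/2 (N odd) or once by 0 (N even); these are
the separate cases. -/
lemma rhoPow_succ_identity (hq : 0 < q) {i j : Fin N} (hij : j.val = i.val + 1) :
    rhoPow N q i ^ 2 * swapWeight N q i i.rev + (if i < i.rev then qgap q else 0)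
      = rhoPow N q j ^ 2 * swapWeight N q j j.rev + (if j < j.rev then qgap q else 0)
        + qgap q * rhoPow N q j ^ 2 := by
  have hs : (q : ℂ) ≠ 0 := ofReal_ne_zero_of_pos hq
  have hval : (j.val : ℝ) = i.val + 1 := by rw [hij]; push_cast; ring
  have hsq : ∀ k : Fin N, rhoPow N q k ^ 2 = qpow q (2 * rho N k) := fun k => by
    rw [rhoPow, two_mul, qpow_add hq, sq]
  rw [swapWeight_self_rev, swapWeight_self_rev]
  rcases lt_trichotomy j j.rev with h | h | h
  · have h1 : i < i.rev := by rw [Fin.lt_def, Fin.val_rev] at h ⊢; omega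
    have h2 : rhoPow N q i = rhoPow N q j * q := by
      rw [rhoPow, rhoPow, ← qpow_one q, ← qpow_add hq, rho_of_lt h, rho_of_lt h1, hval]
      congr 1; ring
    rw [if_neg h1.ne, if_pos h1, if_neg h.ne, if_pos h, h2, qgap]
    field_simp; ring
  · have h1 : i < i.rev := by rw [Fin.lt_def]; rw [Fin.ext_iff] at h; rw [Fin.val_rev] at h ⊢; omega
    have hN : (N : ℝ) = 2 * i.val + 3 := by
      rw [Fin.ext_iff, Fin.val_rev] at h
      have : N = 2 * i.val + 3 := by omega
      exact_mod_cast this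
    rw [if_neg h1.ne, if_pos h1, if_pos h, if_neg h.not_lt, rhoPow_of_rev_eq h, hsq, rho_of_lt h1,
      hN, show (2 : ℝ) * ((2 * i.val + 3) / 2 - 1 - i.val) = 1 by ring, qpow_one]
    field_simp; ring
  · rcases lt_trichotomy i i.rev with h1 | h1 | h1
    · have hN : (N : ℝ) = 2 * i.val + 2 := by
        rw [Fin.lt_def, Fin.val_rev] at h h1
        have : N = 2 * i.val + 2 := by omega
        exact_mod_cast this
      rw [if_neg h1.ne, if_pos h1, if_neg h.ne', if_neg (not_lt.mpr h.le), hsq, hsq, rho_of_lt h1,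
        rho_of_gt h, hval, hN, show (2 : ℝ) * ((2 * i.val + 2) / 2 - 1 - i.val) = 0 by ring,
        show (2 : ℝ) * ((2 * i.val + 2) / 2 - (i.val + 1)) = 0 by ring, qpow_zero]
      ring
    · have hN : (N : ℝ) = 2 * i.val + 1 := by
        rw [Fin.ext_iff, Fin.val_rev] at h1
        have : N = 2 * i.val + 1 := by omega
        exact_mod_cast this
      rw [if_pos h1, if_neg h1.not_lt, if_neg h.ne', if_neg (not_lt.mpr h.le), hsq j, rho_of_gt h,
        rhoPow_of_rev_eq h1, hval, hN,
        show (2 : ℝ) * ((2 * i.val + 1) / 2 - (i.val + 1)) = -1 by ring, qpow_neg hq, qpow_one, qgap]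
      field_simp; ring
    · have h2 : rhoPow N q i = rhoPow N q j * q := by
        rw [rhoPow, rhoPow, ← qpow_one q, ← qpow_add hq, rho_of_gt h, rho_of_gt h1, hval]
        congr 1; ring
      rw [if_neg h1.ne', if_neg (not_lt.mpr h1.le), if_neg h.ne', if_neg (not_lt.mpr h.le), h2, qgap]
      field_simp; ring

lemma sum_Ioi_rhoPow_sq (hq : 0 < q) (j : Fin N) :
    qgap q * ∑ b ∈ Finset.Ioi j, rhoPow N q b ^ 2
      = rhoPow N q j ^ 2 * swapWeight N q j j.rev + (if j < j.rev then qgap q else 0)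
        - qpow q (1 - N) := by
  have hs : (q : ℂ) ≠ 0 := ofReal_ne_zero_of_pos hq
  -- Induction downwards from the last index; n counts the indices above j.
  suffices H : ∀ (n : ℕ) (j : Fin N), j.val + n + 1 = N →
      qgap q * ∑ b ∈ Finset.Ioi j, rhoPow N q b ^ 2
      = rhoPow N q j ^ 2 * swapWeight N q j j.rev + (if j < j.rev then qgap q else 0)
        - qpow q (1 - N) from H (N - 1 - j.val) j (by omega)
  intro n
  induction n with
  | zero =>
    intro j hj
    have h0 : Finset.Ioi j = ∅ := by
      ext b
      simp only [Finset.mem_Ioi, Fin.lt_def, Finset.notMem_empty, iff_false]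
      omega
    have hr : (j.rev : ℕ) = 0 := by rw [Fin.val_rev]; omega
    rw [h0, Finset.sum_empty, mul_zero, if_neg (by rw [Fin.lt_def]; omega), swapWeight_self_rev]
    by_cases h1 : j = j.rev
    · have hN : (N : ℝ) = 1 := by
        rw [Fin.ext_iff] at h1
        have : N = 1 := by omega
        exact_mod_cast this
      rw [if_pos h1, rhoPow_of_rev_eq h1, hN, sub_self, qpow_zero]; ring
    · have hN : (j.val : ℝ) = N - 1 := by
        rw [eq_sub_iff_add_eq]; exact_mod_cast hj
      have h2 : j.rev < j := by
        rw [Fin.lt_def]; rw [Fin.ext_iff] at h1; omega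
      rw [if_neg h1, rhoPow, rho_of_gt h2, hN, sq, ← qpow_add hq, ← qpow_one q, ← qpow_neg hq,
        ← qpow_add hq,
        show (N : ℝ) / 2 - (N - 1) + (N / 2 - (N - 1)) + -1 = 1 - N by ring]
      ring
  | succ n ih =>
    intro j hj
    let j1 : Fin N := ⟨j.val + 1, by omega⟩
    have h0 : Finset.Ioi j = insert j1 (Finset.Ioi j1) := by
      ext b
      simp only [Finset.mem_Ioi, Fin.lt_def, Finset.mem_insert, Fin.ext_iff, j1]
      omega
    rw [h0, Finset.sum_insert (by simp), mul_add, ih j1 (by simp only [j1]; omega),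
      rhoPow_succ_identity hq (show j1.val = j.val + 1 from rfl)]
    ring

/-- The square norm `g_{mn} g^{mn}` of the metric. -/
def metricSq (N : ℕ) (q : ℝ) : ℂ := ∑ m, ∑ n, metric N q m n * metric N q m n

lemma metricSq_eq_sum (hq : 0 < q) : metricSq N q = ∑ b, rhoPow N q b ^ 2 := by
  rw [metricSq, ← Equiv.sum_comp Fin.revPerm]
  refine Finset.sum_congr rfl fun b _ => ?_
  simp [metric_apply hq, rhoPow_rev hq, sq]

/-- The geometric sum started at the first index. It ties the norm of the metric to the eigenvalue
q^{1-N}, in a form without division that remains meaningful at q = 1. -/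
lemma metricSq_identity (hN : 1 ≤ N) (hq : 0 < q) :
    (metricSq N q - 1) * qgap q = (qpow q (1 - N))⁻¹ - qpow q (1 - N) := by
  have hs : (q : ℂ) ≠ 0 := ofReal_ne_zero_of_pos hq
  let j : Fin N := ⟨0, hN⟩
  have h0 : (Finset.univ : Finset (Fin N)) = insert j (Finset.Ioi j) := by
    ext b
    simp only [Finset.mem_Ioi, Fin.lt_def, Finset.mem_insert, Fin.ext_iff, j, Finset.mem_univ,
      true_iff]
    omega
  have hr : (j.rev : ℕ) = N - 1 := by rw [Fin.val_rev]
  rw [metricSq_eq_sum hq, h0, Finset.sum_insert (by simp), sub_mul, add_mul,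
    mul_comm (∑ b ∈ _, _), sum_Ioi_rhoPow_sq hq, swapWeight_self_rev]
  by_cases h1 : j = j.rev
  · have hN' : (N : ℝ) = 1 := by
      rw [Fin.ext_iff, hr] at h1
      have : N = 1 := by simp only [j] at h1; omega
      exact_mod_cast this
    rw [if_pos h1, if_neg h1.not_lt, rhoPow_of_rev_eq h1, hN', sub_self, qpow_zero]
    ring
  · have h2 : j < j.rev := by
      rw [Fin.lt_def]; rw [Fin.ext_iff] at h1; simp only [j] at h1 ⊢; omega
    rw [if_neg h1, if_pos h2, ← qpow_neg hq]
    have h3 : rhoPow N q j ^ 2 = qpow q (-(1 - N)) * (q : ℂ)⁻¹ := by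
      rw [rhoPow, rho_of_lt h2, sq, ← qpow_add hq, ← qpow_one q, ← qpow_neg hq,
        ← qpow_add hq]
      congr 1
      simp only [j]; push_cast; ring
    rw [h3, qgap]
    field_simp
    ring

end Entries

end QSphere

namespace QSphere

/-! ### Action of the braid matrix on tensors and its quadratic relation. -/

section Braid

variable {N : ℕ} {q : ℝ}

/-- Besides a swap and an identity term, a row has a tail only if the pair is conjugate, and the
tail runs over conjugate pairs further out. Values in a module allow the formula to be used for rows
of matrices as well as for scalars. -/
lemma sum_braid_smul {M : Type*} [AddCommGroup M] [Module ℂ M] (hq : 0 < q) (k l : Fin N)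
    (y : Fin N → Fin N → M) :
    ∑ a, ∑ b, braid N q (k, l) (a, b) • y a b
      = swapWeight N q k l • y l k + (if k < l then qgap q • y k l else 0)
        - (if l = k.rev then
            qgap q • ∑ b ∈ Finset.Ioi k, (rhoPow N q b * (rhoPow N q k)⁻¹) • y b.rev b else 0) := by
  have h : ∀ a b, braid N q (k, l) (a, b) • y a b =
      (if a = l then (if b = k then swapWeight N q k l • y l k else 0) else 0)
      + (if a = k then (if b = l then (if k < l then qgap q • y k l else 0) else 0) else 0)
      - (if a = b.rev then (if b ∈ Finset.Ioi k then (if l = k.rev then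
            qgap q • ((rhoPow N q b * (rhoPow N q k)⁻¹) • y b.rev b) else 0) else 0) else 0) := by
    intro a b
    rw [braid_symm hq, braid_apply hq, sub_smul, add_smul]
    congr 1
    · congr 1
      · by_cases h1 : a = l
        · subst h1
          by_cases h2 : b = k
          · subst h2; simp
          · simp [h2]
        · simp [h1]
      · by_cases h1 : a = k
        · subst h1
          by_cases h2 : b = l
          · subst h2; simp [ite_smul]
          · simp [h2]
        · simp [h1]
    · by_cases h1 : a = b.rev
      · subst h1
        by_cases h2 : k < b <;> by_cases h3 : l = k.rev <;> simp [h2, h3, mul_smul]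
      · simp [h1]
  simp_rw [h, Finset.sum_sub_distrib, Finset.sum_add_distrib]
  congr 1
  · congr 1
    · simp
    · simp
  · rw [Finset.sum_comm]
    simp only [Finset.sum_ite_eq', Finset.mem_univ, if_true, Finset.sum_ite_mem, Finset.univ_inter]
    by_cases h3 : l = k.rev
    · simp only [h3, if_true, Finset.smul_sum]
    · simp [h3]

/-- The action of the braid matrix on tensors whose entries lie in a module. -/
lemma sum_braid_smul_of_ne {M : Type*} [AddCommGroup M] [Module ℂ M] (hq : 0 < q) {k l : Fin N}
    (hkl : l ≠ k.rev) (y : Fin N → Fin N → M) :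
    ∑ a, ∑ b, braid N q (k, l) (a, b) • y a b
      = swapWeight N q k l • y l k + (if k < l then qgap q • y k l else 0) := by
  rw [sum_braid_smul hq, if_neg hkl, sub_zero]

lemma metric_rev (hq : 0 < q) (k : Fin N) : metric N q k.rev k = rhoPow N q k := by
  rw [metric_apply hq, if_pos (Fin.rev_rev k).symm, rhoPow_rev hq, inv_inv]

lemma metric_rev' (hq : 0 < q) (k : Fin N) : metric N q k k.rev = (rhoPow N q k)⁻¹ := by
  rw [metric_apply hq, if_pos rfl]

lemma metric_of_ne (hq : 0 < q) {k l : Fin N} (h : l ≠ k.rev) : metric N q k l = 0 := by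
  rw [metric_apply hq, if_neg h]

/-- The tail is the geometric sum `sum_Ioi_rhoPow_sq`, whose boundary terms cancel the swap and the
identity term and leave the eigenvalue. -/
lemma braid_metric (hq : 0 < q) (k l : Fin N) :
    ∑ a, ∑ b, braid N q (k, l) (a, b) * metric N q a b = qpow q (1 - N) * metric N q k l := by
  have h := sum_braid_smul hq k l (metric N q)
  simp only [smul_eq_mul] at h
  rw [h]
  have hk := rhoPow_ne_zero (N := N) hq k
  by_cases hl : l = k.rev
  · subst hl
    have h1 : qgap q * ∑ b ∈ Finset.Ioi k, rhoPow N q b * (rhoPow N q k)⁻¹ * metric N q b.rev b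
        = (qgap q * ∑ b ∈ Finset.Ioi k, rhoPow N q b ^ 2) * (rhoPow N q k)⁻¹ := by
      rw [mul_assoc, Finset.sum_mul]
      congr 1
      refine Finset.sum_congr rfl fun b _ => ?_
      rw [metric_rev hq]; ring
    rw [if_pos rfl, h1, sum_Ioi_rhoPow_sq hq, metric_rev hq, metric_rev' hq]
    split_ifs <;> field_simp <;> ring
  · have hl' : k ≠ l.rev := fun h => hl (by rw [h, Fin.rev_rev])
    rw [metric_of_ne hq hl, metric_of_ne hq hl']
    simp [hl]

/-- The entries of the braid matrix on the zero weight space. -/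
def zeroBraid (N : ℕ) (q : ℝ) (c d : Fin N) : ℂ :=
  (if d = c.rev then swapWeight N q c c.rev else 0) + (if c.rev < c ∧ d = c then qgap q else 0)
    - (if c.rev < d then qgap q * (rhoPow N q c * rhoPow N q d) else 0)

lemma braid_zeroBraid (hq : 0 < q) (c d : Fin N) :
    braid N q (c.rev, c) (d.rev, d) = zeroBraid N q c d := by
  rw [braid_symm hq, braid_apply hq, zeroBraid]
  simp only [Fin.rev_rev, and_true, Fin.rev_inj, rhoPow_rev hq, inv_inv]
  congr 1
  · congr 1
    · by_cases h : d = c.rev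
      · subst h; rw [if_pos ⟨rfl, Fin.rev_rev c⟩, if_pos rfl, swapWeight_comm]
      · rw [if_neg (fun h' => h h'.1), if_neg h]
    · refine if_congr ?_ rfl rfl
      tauto
  · rw [mul_comm (rhoPow N q c)]
    

lemma braid_zero_of_ne (hq : 0 < q) (c : Fin N) {k l : Fin N} (h : k ≠ l.rev) :
    braid N q (c.rev, c) (k, l) = 0 := by
  rw [braid_apply hq]
  have h1 : l ≠ k.rev := fun h' => h (by rw [h', Fin.rev_rev])
  rw [if_neg, if_neg, if_neg]
  · simp
  · exact fun h' => h1 h'.2.2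
  · rintro ⟨-, h2, h3⟩; exact h (by rw [← h2, ← h3])
  · rintro ⟨h2, h3⟩; exact h1 (by rw [← h2, ← h3])

/-- A truncation of the eigenvector equation `braid_metric`: over all b the sum would be q^{1-N}
q^{ρ_d}, and the cut at c' leaves corrections only for c = d and c < d. -/
lemma sum_Ioi_rhoPow_mul_zeroBraid (hq : 0 < q) (c d : Fin N) :
    ∑ b ∈ Finset.Ioi c.rev, rhoPow N q b * zeroBraid N q b d
      = qpow q (1 - N) * rhoPow N q d - (if d = c then (rhoPow N q c)⁻¹ * swapWeight N q c c.rev else 0)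
        + (if c < d then qgap q * rhoPow N q d * ((if c.rev < d then 1 else 0) - (if c.rev < c then 1 else 0))
            - rhoPow N q d * (rhoPow N q c)⁻¹ ^ 2 * swapWeight N q c c.rev else 0) := by
  have hd := rhoPow_ne_zero (N := N) hq d
  have hc := rhoPow_ne_zero (N := N) hq c
  have h1 : ∀ b, rhoPow N q b * zeroBraid N q b d =
      (if b = d.rev then (rhoPow N q d)⁻¹ * swapWeight N q d d.rev else 0)
      + (if b = d then (if d.rev < d then qgap q * rhoPow N q d else 0) else 0)
      - (if d.rev < b then (qgap q * rhoPow N q b ^ 2) * rhoPow N q d else 0) := by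
    intro b
    rw [zeroBraid, mul_sub, mul_add]
    congr 1
    · congr 1
      · by_cases h : b = d.rev
        · subst h
          rw [if_pos (Fin.rev_rev d).symm, if_pos rfl, rhoPow_rev hq, Fin.rev_rev, swapWeight_comm]
        · rw [if_neg h, if_neg (fun h' => h (by rw [h', Fin.rev_rev])), mul_zero]
      · by_cases h : b = d
        · subst h; simp [mul_comm]
        · simp [h, Ne.symm h]
    · rw [if_congr (Fin.rev_lt_iff (i := b) (j := d)) rfl rfl]
      split_ifs <;> ring
  simp_rw [h1, Finset.sum_sub_distrib, Finset.sum_add_distrib]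
  rw [Finset.sum_ite_eq', Finset.sum_ite_eq', ← Finset.sum_filter, ← Finset.sum_mul,
    ← Finset.mul_sum]
  have h2 : Finset.filter (fun b => d.rev < b) (Finset.Ioi c.rev) = Finset.Ioi (max c.rev d.rev) := by
    ext b; simp
  rw [h2]
  rcases lt_trichotomy c d with h | h | h
  · have h3 : d.rev < c.rev := Fin.rev_lt_rev.2 h
    rw [max_eq_left h3.le, sum_Ioi_rhoPow_sq hq, rhoPow_rev hq, Fin.rev_rev, swapWeight_comm c.rev]
    have h4 : c.rev < d → d.rev < d := fun h' => h3.trans h'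
    simp only [Finset.mem_Ioi, not_lt.mpr h3.le, if_false, h.ne', h, if_true]
    by_cases h5 : c.rev < d
    · simp only [h5, h4 h5, if_true]; split_ifs <;> ring
    · simp only [h5, if_false]; split_ifs <;> ring
  · subst h
    rw [max_self, sum_Ioi_rhoPow_sq hq, rhoPow_rev hq, Fin.rev_rev, swapWeight_comm]
    simp only [Finset.mem_Ioi, lt_irrefl, if_false, if_true]
    split_ifs <;> field_simp <;> ring
  · have h3 : c.rev < d.rev := Fin.rev_lt_rev.2 h
    rw [max_eq_right h3.le, sum_Ioi_rhoPow_sq hq, rhoPow_rev hq, Fin.rev_rev, swapWeight_comm d.rev]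
    have h4 : d.rev < d → c.rev < d := fun h' => h3.trans h'
    simp only [Finset.mem_Ioi, h3, if_true, not_lt.mpr h.le, if_false, h.ne]
    by_cases h5 : d.rev < d
    · simp only [h5, h4 h5, if_true]; field_simp; ring
    · simp only [h5, if_false]
      split_ifs <;> field_simp <;> ring

lemma swapWeight_self_rev_sq (hq : 0 < q) (c : Fin N) :
    swapWeight N q c c.rev ^ 2 = 1 - (if c = c.rev then 0 else qgap q * swapWeight N q c c.rev) := by
  have hs : (q : ℂ) ≠ 0 := ofReal_ne_zero_of_pos hq
  rw [swapWeight_self_rev]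
  split_ifs
  · ring
  · rw [qgap]; field_simp; ring

/-- The quadratic relation on the span of the conjugate pairs, the only block on which the rank one
term appears. -/
lemma sum_zeroBraid_mul (hq : 0 < q) (c d : Fin N) :
    ∑ b, zeroBraid N q c b * zeroBraid N q b d = (if c = d then 1 else 0)
      + qgap q * zeroBraid N q c d
      - qgap q * qpow q (1 - N) * (rhoPow N q c * rhoPow N q d) := by
  have hd := rhoPow_ne_zero (N := N) hq d
  have hc := rhoPow_ne_zero (N := N) hq c
  have h1 : ∀ b, zeroBraid N q c b * zeroBraid N q b d =
      (if b = c.rev then swapWeight N q c c.rev * zeroBraid N q c.rev d else 0)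
      + (if b = c then (if c.rev < c then qgap q * zeroBraid N q c d else 0) else 0)
      - (if b ∈ Finset.Ioi c.rev then qgap q * rhoPow N q c * (rhoPow N q b * zeroBraid N q b d)
          else 0) := by
    intro b
    rw [show zeroBraid N q c b = _ from rfl, zeroBraid, sub_mul, add_mul]
    congr 1
    · congr 1
      · by_cases h : b = c.rev
        · subst h; simp
        · simp [h]
      · by_cases h : b = c
        · subst h; simp
        · simp [h]
    · simp only [Finset.mem_Ioi]
      split_ifs <;> ring
  simp_rw [h1, Finset.sum_sub_distrib, Finset.sum_add_distrib]
  rw [Finset.sum_ite_eq', Finset.sum_ite_eq', Finset.sum_ite_mem, Finset.univ_inter,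
    ← Finset.mul_sum, sum_Ioi_rhoPow_mul_zeroBraid hq]
  simp only [Finset.mem_univ, if_true]
  have hw := swapWeight_self_rev_sq (N := N) hq c
  rcases lt_trichotomy c d with h | h | h
  · have h2 : c.rev < c → c.rev < d := fun h' => h'.trans h
    simp only [zeroBraid, Fin.rev_rev, rhoPow_rev hq, swapWeight_comm c.rev c, h, h.ne, h.ne',
      if_true, if_false, and_false]
    by_cases h3 : d = c.rev
    · have h4 : c < c.rev := h3 ▸ h
      simp only [h3, lt_irrefl, h4, not_lt.mpr h4.le, if_true, if_false, true_and, rhoPow_rev hq]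
      field_simp; ring
    · simp only [h3, if_false, and_false]
      by_cases h4 : c.rev < c
      · simp only [h4, h2 h4, if_true]; field_simp; ring
      · simp only [h4, if_false]
        split_ifs <;> field_simp <;> ring
  · subst h
    simp only [zeroBraid, Fin.rev_rev, rhoPow_rev hq, swapWeight_comm c.rev c, lt_irrefl,
      if_true, if_false, and_true]
    rcases lt_trichotomy c c.rev with h3 | h3 | h3
    · simp only [h3.ne, if_false] at hw
      simp only [h3.ne, h3, not_lt.mpr h3.le, if_false, and_false]
      field_simp; linear_combination hw
    · simp only [← h3, lt_irrefl, if_true, if_false, false_and] at hw ⊢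
      have h4 : rhoPow N q c = 1 := rhoPow_of_rev_eq h3
      rw [h4]
      linear_combination hw
    · simp only [h3.ne', if_false] at hw
      simp only [h3.ne', h3, not_lt.mpr h3.le, if_true, if_false, and_false]
      field_simp; linear_combination hw
  · simp only [zeroBraid, Fin.rev_rev, rhoPow_rev hq, swapWeight_comm c.rev c, h.ne, h.ne',
      if_false, and_false, not_lt.mpr h.le]
    by_cases h3 : d = c.rev
    · have h4 : c.rev < c := h3 ▸ h
      simp only [h3, lt_irrefl, h4, not_lt.mpr h4.le, if_true, if_false, false_and, rhoPow_rev hq]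
      field_simp; ring
    · simp only [h3, if_false, and_false]
      by_cases h4 : c.rev < c
      · simp only [h4, if_true]; split_ifs <;> field_simp <;> ring
      · have h5 : ¬ c.rev < d := fun h' => h4 (h'.trans h)
        simp only [h4, h5, if_false]; ring

/-- The matrix `K^{ij}_{kl} = g^{ij} g_{kl}`. -/
def cupCap (N : ℕ) (q : ℝ) : Matrix (Fin N × Fin N) (Fin N × Fin N) ℂ :=
  Matrix.of fun ij kl => metric N q ij.1 ij.2 * metric N q kl.1 kl.2

/-- The cubic minimal equation of R̂ in skein form. Off the conjugate pairs R̂ has blocks of size at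
most two, which satisfy the Hecke relation; the block of conjugate pairs is `sum_zeroBraid_mul`. -/
lemma braid_mul_self (hq : 0 < q) :
    braid N q * braid N q = 1 + qgap q • braid N q - (qgap q * qpow q (1 - N)) • cupCap N q := by
  ext ⟨k, l⟩ ⟨m, n⟩
  rw [Matrix.mul_apply, Fintype.sum_prod_type]
  simp only [Matrix.sub_apply, Matrix.add_apply, Matrix.smul_apply, smul_eq_mul]
  by_cases hkl : l = k.rev
  · have hk : k = l.rev := by rw [hkl, Fin.rev_rev]
    subst hk
    by_cases hmn : m = n.rev
    · subst hmn
      have h1 : ∀ a b, braid N q (l.rev, l) (a, b) * braid N q (a, b) (n.rev, n) =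
          if a = b.rev then zeroBraid N q l b * zeroBraid N q b n else 0 := by
        intro a b
        by_cases h : a = b.rev
        · subst h; rw [if_pos rfl, braid_zeroBraid hq, braid_zeroBraid hq]
        · rw [if_neg h, braid_zero_of_ne hq _ h, zero_mul]
      simp_rw [h1]
      rw [Finset.sum_comm]
      simp only [Finset.sum_ite_eq', Finset.mem_univ, if_true]
      rw [sum_zeroBraid_mul hq, braid_zeroBraid hq, cupCap, Matrix.of_apply, metric_rev hq,
        metric_rev hq, Matrix.one_apply]
      congr 2
      exact if_congr (by simp) rfl rfl
    · rw [braid_zero_of_ne hq _ hmn, Matrix.one_apply_ne (by rintro ⟨⟩; exact hmn rfl), cupCap,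
        Matrix.of_apply, metric_of_ne hq (k := m) (l := n) (fun h => hmn (by rw [h, Fin.rev_rev]))]
      rw [Finset.sum_eq_zero]
      · simp
      · intro a _
        refine Finset.sum_eq_zero fun b _ => ?_
        by_cases h : a = b.rev
        · subst h; rw [braid_zero_of_ne hq b hmn, mul_zero]
        · rw [braid_zero_of_ne hq _ h, zero_mul]
  · have h := sum_braid_smul_of_ne hq hkl (fun a b => braid N q (a, b) (m, n))
    simp only [smul_eq_mul] at h
    have hlk : k ≠ l.rev := fun h => hkl (by rw [h, Fin.rev_rev])
    rw [h, cupCap, Matrix.of_apply, metric_of_ne hq hkl, zero_mul, mul_zero, sub_zero,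
      braid_symm hq l k, braid_symm hq k l, braid_apply hq, braid_apply hq, Matrix.one_apply]
    simp only [hkl, hlk, and_false, if_false, sub_zero, Prod.mk.injEq]
    have hs : (q : ℂ) ≠ 0 := ofReal_ne_zero_of_pos hq
    have hw : swapWeight N q k l = if k = l then (q : ℂ) else 1 := by
      unfold swapWeight
      by_cases h1 : k = l
      · subst h1; rw [if_pos rfl, if_neg hkl, if_pos rfl]
      · rw [if_neg h1, if_neg hkl, if_neg h1]
    rw [swapWeight_comm l k]
    rcases lt_trichotomy k l with h1 | h1 | h1
    · simp only [hw, h1, not_lt.mpr h1.le, h1.ne, if_false, if_true, false_and, true_and, add_zero,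
        and_comm (a := n = l), and_comm (a := n = k), eq_comm (a := k),
        eq_comm (a := l)]
      split_ifs <;> ring
    · subst h1
      simp only [hw, lt_irrefl, if_true, if_false, false_and, add_zero, and_comm (a := n = k),
        eq_comm (a := k)]
      rw [qgap]
      split_ifs <;> field_simp <;> ring
    · simp only [hw, h1, not_lt.mpr h1.le, h1.ne', if_false, false_and, true_and, add_zero,
        and_comm (a := n = l), and_comm (a := n = k), eq_comm (a := k),
        eq_comm (a := l)]
      split_ifs <;> ring

end Braid

end QSphere

namespace QSphere

/-! ### Operators on three tensor factors, cups and caps. -/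

section Amplification

variable {V : Type*} [Fintype V] [DecidableEq V]

/-- The action of a matrix of scalars on a vector with entries in a module. -/
def tact {ι κ M : Type*} [Fintype κ] [AddCommGroup M] [Module ℂ M] (X : Matrix ι κ ℂ) (y : κ → M) :
    ι → M := fun i => ∑ k, X i k • y k

section Tact

variable {ι κ μ M : Type*} [Fintype κ] [Fintype μ] [AddCommGroup M] [Module ℂ M]

lemma tact_mul (X : Matrix ι κ ℂ) (Y : Matrix κ μ ℂ) (y : μ → M) :
    tact (X * Y) y = tact X (tact Y y) := by
  ext i
  simp only [tact, Matrix.mul_apply, Finset.sum_smul, Finset.smul_sum, mul_smul]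
  exact Finset.sum_comm

lemma tact_one [DecidableEq κ] (y : κ → M) : tact (1 : Matrix κ κ ℂ) y = y := by
  ext i
  simp [tact, Matrix.one_apply, ite_smul]

lemma tact_sub (X Y : Matrix ι κ ℂ) (y : κ → M) : tact (X - Y) y = tact X y - tact Y y := by
  ext i
  simp [tact, sub_smul]

lemma tact_add (X Y : Matrix ι κ ℂ) (y : κ → M) : tact (X + Y) y = tact X y + tact Y y := by
  ext i
  simp [tact, add_smul, Finset.sum_add_distrib]

lemma tact_smul (c : ℂ) (X : Matrix ι κ ℂ) (y : κ → M) : tact (c • X) y = c • tact X y := by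
  ext i
  simp [tact, mul_smul, Finset.smul_sum]

lemma tact_zero (X : Matrix ι κ ℂ) : tact X (0 : κ → M) = 0 := by
  ext i
  simp [tact]

lemma tact_zero_left (y : κ → M) : tact (0 : Matrix ι κ ℂ) y = 0 := by
  ext i
  simp [tact]

lemma tact_vec_add (X : Matrix ι κ ℂ) (y z : κ → M) : tact X (y + z) = tact X y + tact X z := by
  ext i
  simp [tact, Finset.sum_add_distrib]

lemma tact_vec_smul (X : Matrix ι κ ℂ) (c : ℂ) (y : κ → M) : tact X (c • y) = c • tact X y := by
  ext i
  simp [tact, Finset.smul_sum, smul_comm c]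

lemma mul_apply_eq_tact (X : Matrix ι κ ℂ) (Y : Matrix κ μ ℂ) (i : ι) : (X * Y) i = tact X Y i := by
  ext j
  simp [tact, Matrix.mul_apply, Finset.sum_apply]

end Tact

/-- The matrix `X` acting on the first two of three tensor factors. -/
def amp1 (X : Matrix (V × V) (V × V) ℂ) : Matrix (V × V × V) (V × V × V) ℂ :=
  Matrix.of fun t u => if t.2.2 = u.2.2 then X (t.1, t.2.1) (u.1, u.2.1) else 0

/-- The matrix `X` acting on the last two of three tensor factors. -/
def amp2 (X : Matrix (V × V) (V × V) ℂ) : Matrix (V × V × V) (V × V × V) ℂ :=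
  Matrix.of fun t u => if t.1 = u.1 then X t.2 u.2 else 0

/-- The insertion of the tensor `g` in front of a vector. -/
def cup12 (g : Matrix V V ℂ) : Matrix (V × V × V) V ℂ :=
  Matrix.of fun t x => if t.2.2 = x then g t.1 t.2.1 else 0

/-- The insertion of the tensor `g` behind a vector. -/
def cup23 (g : Matrix V V ℂ) : Matrix (V × V × V) V ℂ :=
  Matrix.of fun t x => if t.1 = x then g t.2.1 t.2.2 else 0

/-- The contraction of the first two of three tensor factors with `g`. -/
def cap12 (g : Matrix V V ℂ) : Matrix V (V × V × V) ℂ := (cup12 g).transpose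

/-- The contraction of the last two of three tensor factors with `g`. -/
def cap23 (g : Matrix V V ℂ) : Matrix V (V × V × V) ℂ := (cup23 g).transpose

/-- The rank one matrix `g^{ij} g_{kl}`. -/
def rankOne (g : Matrix V V ℂ) : Matrix (V × V) (V × V) ℂ :=
  Matrix.of fun ij kl => g ij.1 ij.2 * g kl.1 kl.2

section ModuleAction

variable {M : Type*} [AddCommGroup M] [Module ℂ M]

lemma tact_amp1 (X : Matrix (V × V) (V × V) ℂ) (y : V × V × V → M) (i j k : V) :
    tact (amp1 X) y (i, j, k) = ∑ a, ∑ b, X (i, j) (a, b) • y (a, b, k) := by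
  simp [tact, amp1, Fintype.sum_prod_type, ite_smul]

lemma tact_amp2 (X : Matrix (V × V) (V × V) ℂ) (y : V × V × V → M) (i j k : V) :
    tact (amp2 X) y (i, j, k) = ∑ a, ∑ b, X (j, k) (a, b) • y (i, a, b) := by
  simp [tact, amp2, Fintype.sum_prod_type, ite_smul]

lemma tact_cup12 (g : Matrix V V ℂ) (y : V → M) (i j k : V) :
    tact (cup12 g) y (i, j, k) = g i j • y k := by
  simp [tact, cup12, ite_smul]

lemma tact_cup23 (g : Matrix V V ℂ) (y : V → M) (i j k : V) :
    tact (cup23 g) y (i, j, k) = g j k • y i := by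
  simp [tact, cup23, ite_smul]

lemma tact_cap12 (g : Matrix V V ℂ) (y : V × V × V → M) (i : V) :
    tact (cap12 g) y i = ∑ a, ∑ b, g a b • y (a, b, i) := by
  simp [tact, cap12, cup12, Matrix.transpose_apply, Fintype.sum_prod_type, ite_smul]

lemma tact_cap23 (g : Matrix V V ℂ) (y : V × V × V → M) (i : V) :
    tact (cap23 g) y i = ∑ a, ∑ b, g a b • y (i, a, b) := by
  simp [tact, cap23, cup23, Matrix.transpose_apply, Fintype.sum_prod_type, ite_smul]

end ModuleAction

lemma ext_of_tact {ι κ : Type*} [Fintype κ] [DecidableEq κ] {X Y : Matrix ι κ ℂ}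
    (h : ∀ y : κ → ℂ, tact X y = tact Y y) : X = Y := by
  ext i j
  have := congrFun (h (Pi.single j 1)) i
  simpa [tact, Pi.single_apply] using this

lemma amp1_mul (X Y : Matrix (V × V) (V × V) ℂ) : amp1 (X * Y) = amp1 X * amp1 Y := by
  refine ext_of_tact fun y => ?_
  ext ⟨i, j, k⟩
  rw [tact_mul, tact_amp1, tact_amp1]
  simp_rw [tact_amp1]
  have := congrFun (tact_mul X Y fun p => y (p.1, p.2, k)) (i, j)
  simpa only [tact, Fintype.sum_prod_type] using this

lemma amp2_mul (X Y : Matrix (V × V) (V × V) ℂ) : amp2 (X * Y) = amp2 X * amp2 Y := by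
  refine ext_of_tact fun y => ?_
  ext ⟨i, j, k⟩
  rw [tact_mul, tact_amp2, tact_amp2]
  simp_rw [tact_amp2]
  have := congrFun (tact_mul X Y fun p => y (i, p.1, p.2)) (j, k)
  simpa only [tact, Fintype.sum_prod_type] using this

lemma amp1_one : amp1 (1 : Matrix (V × V) (V × V) ℂ) = 1 := by
  ext ⟨i, j, k⟩ ⟨a, b, c⟩
  simp only [amp1, Matrix.of_apply, Matrix.one_apply, Prod.mk.injEq]
  split_ifs <;> tauto

lemma amp2_one : amp2 (1 : Matrix (V × V) (V × V) ℂ) = 1 := by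
  ext ⟨i, j, k⟩ ⟨a, b, c⟩
  simp only [amp2, Matrix.of_apply, Matrix.one_apply, Prod.mk.injEq]
  split_ifs <;> tauto

lemma amp1_add (X Y : Matrix (V × V) (V × V) ℂ) : amp1 (X + Y) = amp1 X + amp1 Y := by
  ext t u
  simp only [amp1, Matrix.of_apply, Matrix.add_apply]
  split_ifs <;> simp

lemma amp2_add (X Y : Matrix (V × V) (V × V) ℂ) : amp2 (X + Y) = amp2 X + amp2 Y := by
  ext t u
  simp only [amp2, Matrix.of_apply, Matrix.add_apply]
  split_ifs <;> simp

lemma amp1_sub (X Y : Matrix (V × V) (V × V) ℂ) : amp1 (X - Y) = amp1 X - amp1 Y := by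
  ext t u
  simp only [amp1, Matrix.of_apply, Matrix.sub_apply]
  split_ifs <;> simp

lemma amp2_sub (X Y : Matrix (V × V) (V × V) ℂ) : amp2 (X - Y) = amp2 X - amp2 Y := by
  ext t u
  simp only [amp2, Matrix.of_apply, Matrix.sub_apply]
  split_ifs <;> simp

lemma amp1_smul (c : ℂ) (X : Matrix (V × V) (V × V) ℂ) : amp1 (c • X) = c • amp1 X := by
  ext t u
  simp only [amp1, Matrix.of_apply, Matrix.smul_apply]
  split_ifs <;> simp

lemma amp2_smul (c : ℂ) (X : Matrix (V × V) (V × V) ℂ) : amp2 (c • X) = c • amp2 X := by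
  ext t u
  simp only [amp2, Matrix.of_apply, Matrix.smul_apply]
  split_ifs <;> simp

lemma amp1_transpose (X : Matrix (V × V) (V × V) ℂ) : (amp1 X).transpose = amp1 X.transpose := by
  ext t u
  simp only [amp1, Matrix.of_apply, Matrix.transpose_apply, eq_comm]

lemma amp2_transpose (X : Matrix (V × V) (V × V) ℂ) : (amp2 X).transpose = amp2 X.transpose := by
  ext t u
  simp only [amp2, Matrix.of_apply, Matrix.transpose_apply, eq_comm]

lemma amp1_rankOne (g : Matrix V V ℂ) : amp1 (rankOne g) = cup12 g * cap12 g := by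
  ext ⟨i, j, k⟩ ⟨a, b, c⟩
  simp only [amp1, rankOne, cup12, cap12, Matrix.of_apply, Matrix.mul_apply, Matrix.transpose_apply,
    ite_mul, zero_mul, mul_ite, mul_zero, Finset.sum_ite_eq, Finset.mem_univ, if_true]

lemma amp2_rankOne (g : Matrix V V ℂ) : amp2 (rankOne g) = cup23 g * cap23 g := by
  ext ⟨i, j, k⟩ ⟨a, b, c⟩
  simp only [amp2, rankOne, cup23, cap23, Matrix.of_apply, Matrix.mul_apply, Matrix.transpose_apply,
    ite_mul, zero_mul, mul_ite, mul_zero, Finset.sum_ite_eq, Finset.mem_univ, if_true]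

/-- The zigzag identity: a cup followed by a shifted cap is a straight strand, because the metric is
its own inverse. -/
lemma cap12_mul_cup23 {g : Matrix V V ℂ} (hg : g * g = 1) : cap12 g * cup23 g = 1 := by
  refine ext_of_tact fun y => ?_
  ext i
  rw [tact_mul, tact_cap12, tact_one]
  simp_rw [tact_cup23]
  rw [Finset.sum_congr rfl (g := fun a => (g * g) a i * y a), hg]
  · simp [Matrix.one_apply]
  · intro a _
    simp [Matrix.mul_apply, Finset.sum_mul, mul_assoc]

lemma cap23_mul_cup12 {g : Matrix V V ℂ} (hg : g * g = 1) : cap23 g * cup12 g = 1 := by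
  have := congrArg Matrix.transpose (cap12_mul_cup23 hg)
  rwa [Matrix.transpose_mul, cap12, Matrix.transpose_transpose, Matrix.transpose_one] at this

end Amplification

/-- If two elements satisfy the quadratic relation and the mixed relations with the
rank one elements, the defect of the braid relation is invariant under both. -/
lemma mul_braidDefect {A : Type*} [Ring A] [Algebra ℂ A] {R1 R2 K1 K2 : A} {s t : ℂ}
    (h1 : R1 * R1 = 1 + s • R1 - t • K1) (h2 : R2 * R2 = 1 + s • R2 - t • K2)
    (h3 : K1 * R2 * R1 = R2 * R1 * K2) :
    R1 * (R1 * R2 * R1 - R2 * R1 * R2)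
      = s • (R1 * R2 * R1 - R2 * R1 * R2) - (R1 * R2 * R1 - R2 * R1 * R2) * R2 := by
  -- Substituting the quadratic relation in R1² and R2², the rank one terms are K1R2R1 and R2R1K2,
  -- which cancel by the mixed relation.
  have e1 : R1 * (R1 * R2 * R1) = (R1 * R1) * R2 * R1 := by noncomm_ring
  have e2 : (R2 * R1 * R2) * R2 = R2 * R1 * (R2 * R2) := by noncomm_ring
  have e3 : R1 * (R2 * R1 * R2) = R1 * R2 * R1 * R2 := by noncomm_ring
  rw [mul_sub, sub_mul, e1, e2, e3, h1, h2]
  simp only [sub_mul, add_mul, mul_sub, mul_add, one_mul, mul_one, smul_mul_assoc, mul_smul_comm,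
    smul_sub, h3]
  abel

end QSphere

namespace QSphere

/-! ### Crossing relations with the metric and the braid defect. -/

section BraidRelations

variable {N : ℕ} {q : ℝ}

lemma cupCap_eq_rankOne : cupCap N q = rankOne (metric N q) := rfl

lemma braid_transpose (hq : 0 < q) : (braid N q).transpose = braid N q := by
  ext ⟨a, b⟩ ⟨k, l⟩
  exact (braid_symm hq a b k l).symm

/-- The entrywise identity `braid_crossing`, in a form from which a strand can be slid across a cup.
-/
lemma braid_cup_crossing (hq : 0 < q) :
    (amp2 (braid N q) - qgap q • 1) * cup12 (metric N q)
      = (amp1 (braid N q) - qgap q • 1) * cup23 (metric N q) := by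
  ext ⟨a, b, c⟩ x
  have hX : ∀ X : Matrix (Fin N × Fin N × Fin N) (Fin N) ℂ,
      X (a, b, c) x = tact X (Pi.single x (1 : ℂ)) (a, b, c) := fun X => by
    simp [tact, Pi.single_apply]
  have hm : ∀ i, metric N q i c = if i = c.rev then rhoPow N q c else 0 := fun i => by
    by_cases h : i = c.rev
    · rw [if_pos h, h, metric_rev hq]
    · rw [if_neg h, metric_of_ne hq (fun h' => h (by rw [h', Fin.rev_rev]))]
  have hl := braid_crossing hq a b c x
  refine (hX _).trans (Eq.trans ?_ (hX _).symm)
  rw [tact_mul, tact_mul, tact_sub, tact_sub, tact_smul, tact_smul, tact_one, tact_one,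
    Pi.sub_apply, Pi.sub_apply, Pi.smul_apply, Pi.smul_apply, tact_amp1, tact_amp2, tact_cup12,
    tact_cup23]
  simp_rw [tact_cup12, tact_cup23, hm]
  simp only [metric_apply hq, Pi.single_apply, smul_eq_mul, mul_ite, mul_zero, mul_one, Finset.sum_ite_eq', Finset.mem_univ, if_true]
  rw [Finset.sum_comm]
  simp only [Finset.sum_ite_eq', Finset.mem_univ, if_true, Finset.sum_ite_eq']
  have e1 : (if c = x then if b = a.rev then qgap q * (rhoPow N q a)⁻¹ else 0 else 0)
      = (rhoPow N q a)⁻¹ * (if b = a.rev ∧ c = x then qgap q else 0) := by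
    by_cases h1 : c = x <;> by_cases h2 : b = a.rev <;> simp [h1, h2, mul_comm]
  have e2 : (if a = x then if b = c.rev then qgap q * rhoPow N q c else 0 else 0)
      = rhoPow N q c * (if a = x ∧ b = c.rev then qgap q else 0) := by
    by_cases h1 : a = x <;> by_cases h2 : b = c.rev <;> simp [h1, h2, mul_comm]
  rw [e1, e2]
  linear_combination hl

/-- The inverse of the braid matrix. -/
def braidInv (N : ℕ) (q : ℝ) : Matrix (Fin N × Fin N) (Fin N × Fin N) ℂ :=
  braid N q - qgap q • 1 + qgap q • rankOne (metric N q)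

lemma braid_mul_cupCap (hq : 0 < q) :
    braid N q * rankOne (metric N q) = qpow q (1 - N) • rankOne (metric N q) := by
  ext ⟨k, l⟩ ⟨m, n⟩
  rw [Matrix.mul_apply, Fintype.sum_prod_type]
  simp only [rankOne, Matrix.of_apply, Matrix.smul_apply, smul_eq_mul, ← mul_assoc, ← Finset.sum_mul]
  rw [braid_metric hq]

lemma rankOne_transpose {V : Type*} [Fintype V] [DecidableEq V] (g : Matrix V V ℂ) :
    (rankOne g).transpose = rankOne g := by
  ext i j
  simp [rankOne, Matrix.transpose_apply, mul_comm]

lemma cupCap_mul_braid (hq : 0 < q) :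
    rankOne (metric N q) * braid N q = qpow q (1 - N) • rankOne (metric N q) := by
  have := congrArg Matrix.transpose (braid_mul_cupCap (N := N) hq)
  rwa [Matrix.transpose_mul, Matrix.transpose_smul, rankOne_transpose, braid_transpose hq] at this

lemma braid_mul_braidInv (hq : 0 < q) : braid N q * braidInv N q = 1 := by
  rw [braidInv, mul_add, mul_sub, mul_smul_comm, mul_smul_comm, braid_mul_self hq,
    braid_mul_cupCap hq, mul_one, cupCap_eq_rankOne, smul_smul]
  abel

lemma braidInv_mul_braid (hq : 0 < q) : braidInv N q * braid N q = 1 :=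
  mul_eq_one_comm.1 (braid_mul_braidInv hq)

lemma braidInv_transpose (hq : 0 < q) : (braidInv N q).transpose = braidInv N q := by
  simp [braidInv, braid_transpose hq, rankOne_transpose]

/-- The inverse differs from R̂ by -(q-q⁻¹) + (q-q⁻¹)K, and the zigzag identity turns K on the
shifted cup into the other cup. Hence `braid_cup_crossing` says that a strand passes through a cup,
an overcrossing becoming an undercrossing. -/
lemma amp2_braid_cup12 (hN : metric N q * metric N q = 1) (hq : 0 < q) :
    amp2 (braid N q) * cup12 (metric N q) = amp1 (braidInv N q) * cup23 (metric N q) := by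
  have h := braid_cup_crossing (N := N) hq
  rw [Matrix.sub_mul, Matrix.sub_mul, sub_eq_iff_eq_add] at h
  rw [h, braidInv, amp1_add, amp1_sub, amp1_smul, amp1_smul, amp1_one, amp1_rankOne,
    Matrix.add_mul, Matrix.sub_mul, Matrix.smul_mul (qgap q) (_ * _), Matrix.mul_assoc,
    cap12_mul_cup23 hN, Matrix.mul_one, Matrix.smul_mul, Matrix.one_mul, Matrix.smul_mul,
    Matrix.one_mul]

lemma amp1_braid_cup23 (hN : metric N q * metric N q = 1) (hq : 0 < q) :
    amp1 (braid N q) * cup23 (metric N q) = amp2 (braidInv N q) * cup12 (metric N q) := by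
  have h := (braid_cup_crossing (N := N) hq).symm
  rw [Matrix.sub_mul, Matrix.sub_mul, sub_eq_iff_eq_add] at h
  rw [h, braidInv, amp2_add, amp2_sub, amp2_smul, amp2_smul, amp2_one, amp2_rankOne,
    Matrix.add_mul, Matrix.sub_mul, Matrix.smul_mul (qgap q) (_ * _), Matrix.mul_assoc,
    cap23_mul_cup12 hN, Matrix.mul_one, Matrix.smul_mul, Matrix.one_mul, Matrix.smul_mul,
    Matrix.one_mul]

lemma cap12_amp2_braid (hN : metric N q * metric N q = 1) (hq : 0 < q) :
    cap12 (metric N q) * amp2 (braid N q) = cap23 (metric N q) * amp1 (braidInv N q) := by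
  have h := congrArg Matrix.transpose (amp2_braid_cup12 hN hq)
  rwa [Matrix.transpose_mul, Matrix.transpose_mul, amp2_transpose, amp1_transpose,
    braid_transpose hq, braidInv_transpose hq] at h

lemma cap23_amp1_braid (hN : metric N q * metric N q = 1) (hq : 0 < q) :
    cap23 (metric N q) * amp1 (braid N q) = cap12 (metric N q) * amp2 (braidInv N q) := by
  have h := congrArg Matrix.transpose (amp1_braid_cup23 hN hq)
  rwa [Matrix.transpose_mul, Matrix.transpose_mul, amp2_transpose, amp1_transpose,
    braid_transpose hq, braidInv_transpose hq] at h

lemma amp1_braidInv_mul (hq : 0 < q) : amp1 (braidInv N q) * amp1 (braid N q) = 1 := by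
  rw [← amp1_mul, braidInv_mul_braid hq, amp1_one]

lemma amp2_braidInv_mul (hq : 0 < q) : amp2 (braidInv N q) * amp2 (braid N q) = 1 := by
  rw [← amp2_mul, braidInv_mul_braid hq, amp2_one]

lemma amp1_mul_braidInv (hq : 0 < q) : amp1 (braid N q) * amp1 (braidInv N q) = 1 := by
  rw [← amp1_mul, braid_mul_braidInv hq, amp1_one]

lemma amp2_mul_braidInv (hq : 0 < q) : amp2 (braid N q) * amp2 (braidInv N q) = 1 := by
  rw [← amp2_mul, braid_mul_braidInv hq, amp2_one]

/-- The failure of the braid relation. -/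
def braidDefect (N : ℕ) (q : ℝ) : Matrix (Fin N × Fin N × Fin N) (Fin N × Fin N × Fin N) ℂ :=
  amp1 (braid N q) * amp2 (braid N q) * amp1 (braid N q)
    - amp2 (braid N q) * amp1 (braid N q) * amp2 (braid N q)

/-- An instance of `mul_braidDefect`; in the mixed relation both K1R2R1 and R2R1K2 are the cup on
the first two factors after the cap on the last two. -/
lemma amp1_mul_braidDefect (hq : 0 < q) :
    amp1 (braid N q) * braidDefect N q
      = qgap q • braidDefect N q - braidDefect N q * amp2 (braid N q) := by
  have hN := metric_mul_self N hq
  refine mul_braidDefect (K1 := amp1 (rankOne (metric N q))) (K2 := amp2 (rankOne (metric N q)))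
    (t := qgap q * qpow q (1 - N)) ?_ ?_ ?_
  · rw [← amp1_mul, braid_mul_self hq, amp1_sub, amp1_add, amp1_smul, amp1_smul, amp1_one,
      cupCap_eq_rankOne]
  · rw [← amp2_mul, braid_mul_self hq, amp2_sub, amp2_add, amp2_smul, amp2_smul, amp2_one,
      cupCap_eq_rankOne]
  · rw [amp1_rankOne, amp2_rankOne, Matrix.mul_assoc (cup12 _), cap12_amp2_braid hN hq,
      Matrix.mul_assoc, Matrix.mul_assoc, amp1_braidInv_mul hq, Matrix.mul_one,
      ← Matrix.mul_assoc (_ * _) (cup23 _), Matrix.mul_assoc _ _ (cup23 _), amp1_braid_cup23 hN hq,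
      ← Matrix.mul_assoc _ _ (cup12 _), amp2_mul_braidInv hq, Matrix.one_mul]

lemma amp2_mul_braidDefect (hq : 0 < q) :
    amp2 (braid N q) * braidDefect N q
      = qgap q • braidDefect N q - braidDefect N q * amp1 (braid N q) := by
  have hN := metric_mul_self N hq
  have h := mul_braidDefect (R1 := amp2 (braid N q)) (R2 := amp1 (braid N q)) (s := qgap q)
    (K1 := amp2 (rankOne (metric N q))) (K2 := amp1 (rankOne (metric N q)))
    (t := qgap q * qpow q (1 - N)) ?_ ?_ ?_
  · rw [show braidDefect N q = -(amp2 (braid N q) * amp1 (braid N q) * amp2 (braid N q)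
        - amp1 (braid N q) * amp2 (braid N q) * amp1 (braid N q)) by rw [braidDefect, neg_sub],
      mul_neg, h, neg_mul, smul_neg]
    abel
  · rw [← amp2_mul, braid_mul_self hq, amp2_sub, amp2_add, amp2_smul, amp2_smul, amp2_one,
      cupCap_eq_rankOne]
  · rw [← amp1_mul, braid_mul_self hq, amp1_sub, amp1_add, amp1_smul, amp1_smul, amp1_one,
      cupCap_eq_rankOne]
  · rw [amp1_rankOne, amp2_rankOne, Matrix.mul_assoc (cup23 _), cap23_amp1_braid hN hq,
      Matrix.mul_assoc, Matrix.mul_assoc, amp2_braidInv_mul hq, Matrix.mul_one,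
      ← Matrix.mul_assoc (_ * _) (cup12 _), Matrix.mul_assoc _ _ (cup12 _), amp2_braid_cup12 hN hq,
      ← Matrix.mul_assoc _ _ (cup23 _), amp1_mul_braidInv hq, Matrix.one_mul]

/-- Reversal of the order of three tensor factors together with conjugation of the indices. -/
def flipRev (N : ℕ) : (Fin N × Fin N × Fin N) ≃ (Fin N × Fin N × Fin N) where
  toFun t := (t.2.2.rev, t.2.1.rev, t.1.rev)
  invFun t := (t.2.2.rev, t.2.1.rev, t.1.rev)
  left_inv t := by simp
  right_inv t := by simp

lemma amp1_braid_flipRev (hq : 0 < q) :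
    (amp1 (braid N q)).submatrix (flipRev N) (flipRev N) = amp2 (braid N q) := by
  ext ⟨i, j, k⟩ ⟨a, b, c⟩
  simp only [Matrix.submatrix_apply, flipRev, Equiv.coe_fn_mk, amp1, amp2, Matrix.of_apply,
    Fin.rev_inj, braid_rev hq]

lemma amp2_braid_flipRev (hq : 0 < q) :
    (amp2 (braid N q)).submatrix (flipRev N) (flipRev N) = amp1 (braid N q) := by
  ext ⟨i, j, k⟩ ⟨a, b, c⟩
  simp only [Matrix.submatrix_apply, flipRev, Equiv.coe_fn_mk, amp1, amp2, Matrix.of_apply,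
    Fin.rev_inj, braid_rev hq]

/-- The symmetry `braid_rev` interchanges R1 and R2, hence the two sides of the braid relation. -/
lemma braidDefect_flipRev (hq : 0 < q) :
    (braidDefect N q).submatrix (flipRev N) (flipRev N) = -braidDefect N q := by
  rw [braidDefect, Matrix.submatrix_sub, Pi.sub_apply, Pi.sub_apply,
    ← Matrix.submatrix_mul_equiv (e₂ := flipRev N), ← Matrix.submatrix_mul_equiv (e₂ := flipRev N),
    ← Matrix.submatrix_mul_equiv (e₂ := flipRev N), ← Matrix.submatrix_mul_equiv (e₂ := flipRev N),
    amp1_braid_flipRev hq, amp2_braid_flipRev hq, neg_sub]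

lemma braidDefect_row_flipRev (hq : 0 < q) {i j k : Fin N} (h : braidDefect N q (i, j, k) = 0) :
    braidDefect N q (k.rev, j.rev, i.rev) = 0 := by
  ext u
  have h1 := congrFun (congrFun (braidDefect_flipRev (N := N) hq) (i, j, k)) ((flipRev N).symm u)
  rw [Matrix.submatrix_apply, Equiv.apply_symm_apply, Matrix.neg_apply, h] at h1
  simpa [flipRev] using h1

end BraidRelations

end QSphere

namespace QSphere

/-! ### The Yang–Baxter equation. -/

section YangBaxter

variable {N : ℕ} {q : ℝ} {M : Type*} [AddCommGroup M] [Module ℂ M]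

/-- The strictly upper part of the contraction with the metric. -/
def upperSum (q : ℝ) (k : Fin N) (y : Fin N → M) : M :=
  qgap q • ∑ b ∈ Finset.Ioi k, (rhoPow N q b * (rhoPow N q k)⁻¹) • y b

lemma upperSum_congr (q : ℝ) (k : Fin N) {y z : Fin N → M} (h : ∀ b, k < b → y b = z b) :
    upperSum q k y = upperSum q k z := by
  unfold upperSum
  rw [Finset.sum_congr rfl fun b hb => by rw [h b (Finset.mem_Ioi.1 hb)]]

lemma upperSum_add (q : ℝ) (k : Fin N) (y z : Fin N → M) :
    upperSum q k (fun b => y b + z b) = upperSum q k y + upperSum q k z := by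
  simp [upperSum, Finset.sum_add_distrib]

lemma upperSum_smul (q : ℝ) (k : Fin N) (c : ℂ) (y : Fin N → M) :
    upperSum q k (fun b => c • y b) = c • upperSum q k y := by
  simp only [upperSum, Finset.smul_sum]
  refine Finset.sum_congr rfl fun b _ => ?_
  simp only [smul_smul]
  congr 1; ring

lemma swapWeight_of_ne {k l : Fin N} (h : k ≠ l) (h' : l ≠ k.rev) : swapWeight N q k l = 1 := by
  rw [swapWeight, if_neg h, if_neg h']

lemma swapWeight_self {k : Fin N} (h : k ≠ k.rev) : swapWeight N q k k = q := by
  rw [swapWeight, if_pos rfl, if_neg h]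

lemma swapWeight_self_mid {k : Fin N} (h : k = k.rev) : swapWeight N q k k = 1 := by
  rw [swapWeight, if_pos rfl, if_pos h]

variable (hq : 0 < q) (Y : Fin N × Fin N × Fin N → M)
include hq

lemma braid1_swap {i j : Fin N} (h : j ≠ i.rev) (hij : j < i) (k : Fin N) :
    tact (amp1 (braid N q)) Y (i, j, k) = Y (j, i, k) := by
  rw [tact_amp1, sum_braid_smul_of_ne hq h (fun a b => Y (a, b, k)), swapWeight_of_ne hij.ne' h,
    if_neg (not_lt.mpr hij.le), one_smul, add_zero]

lemma braid2_swap {i j : Fin N} (h : j ≠ i.rev) (hij : j < i) (k : Fin N) :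
    tact (amp2 (braid N q)) Y (k, i, j) = Y (k, j, i) := by
  rw [tact_amp2, sum_braid_smul_of_ne hq h (fun a b => Y (k, a, b)), swapWeight_of_ne hij.ne' h,
    if_neg (not_lt.mpr hij.le), one_smul, add_zero]

lemma braid1_swap_lt {i j : Fin N} (h : j ≠ i.rev) (hij : i < j) (k : Fin N) :
    tact (amp1 (braid N q)) Y (i, j, k) = Y (j, i, k) + qgap q • Y (i, j, k) := by
  rw [tact_amp1, sum_braid_smul_of_ne hq h (fun a b => Y (a, b, k)), swapWeight_of_ne hij.ne h,
    if_pos hij, one_smul]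

lemma braid2_swap_lt {i j : Fin N} (h : j ≠ i.rev) (hij : i < j) (k : Fin N) :
    tact (amp2 (braid N q)) Y (k, i, j) = Y (k, j, i) + qgap q • Y (k, i, j) := by
  rw [tact_amp2, sum_braid_smul_of_ne hq h (fun a b => Y (k, a, b)), swapWeight_of_ne hij.ne h,
    if_pos hij, one_smul]

lemma braid1_self {i : Fin N} (h : i ≠ i.rev) (k : Fin N) :
    tact (amp1 (braid N q)) Y (i, i, k) = (q : ℂ) • Y (i, i, k) := by
  rw [tact_amp1, sum_braid_smul_of_ne hq h (fun a b => Y (a, b, k)), swapWeight_self h,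
    if_neg (lt_irrefl _), add_zero]

lemma braid2_self {i : Fin N} (h : i ≠ i.rev) (k : Fin N) :
    tact (amp2 (braid N q)) Y (k, i, i) = (q : ℂ) • Y (k, i, i) := by
  rw [tact_amp2, sum_braid_smul_of_ne hq h (fun a b => Y (k, a, b)), swapWeight_self h,
    if_neg (lt_irrefl _), add_zero]

lemma braid1_conj {i : Fin N} (h : i.rev ≤ i) (k : Fin N) :
    tact (amp1 (braid N q)) Y (i, i.rev, k)
      = swapWeight N q i i.rev • Y (i.rev, i, k) - upperSum q i fun b => Y (b.rev, b, k) := by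
  rw [tact_amp1, sum_braid_smul hq _ _ (fun a b => Y (a, b, k)), if_neg (not_lt.mpr h), if_pos rfl,
    add_zero, upperSum]

lemma braid2_conj {i : Fin N} (h : i.rev ≤ i) (k : Fin N) :
    tact (amp2 (braid N q)) Y (k, i, i.rev)
      = swapWeight N q i i.rev • Y (k, i.rev, i) - upperSum q i fun b => Y (k, b.rev, b) := by
  rw [tact_amp2, sum_braid_smul hq _ _ (fun a b => Y (k, a, b)), if_neg (not_lt.mpr h), if_pos rfl,
    add_zero, upperSum]

omit hq in
/-- Triples on which both sides of the braid relation agree. -/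
def BraidHolds (N : ℕ) (q : ℝ) (M : Type*) [AddCommGroup M] [Module ℂ M] (i j k : Fin N) : Prop :=
  ∀ Y : Fin N × Fin N × Fin N → M,
    tact (amp1 (braid N q)) (tact (amp2 (braid N q)) (tact (amp1 (braid N q)) Y)) (i, j, k)
      = tact (amp2 (braid N q)) (tact (amp1 (braid N q)) (tact (amp2 (braid N q)) Y)) (i, j, k)

omit Y

/-- A descending pair followed by its conjugate. -/
lemma braidHolds_outer {b x : Fin N} (hb : b.rev < x) (hx : x < b) : BraidHolds N q M b x b.rev := by
  intro Y
  have hbb : b.rev < b := hb.trans hx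
  have h1 : x.rev < b := by rw [Fin.rev_lt_iff]; exact hb
  have h2 : b.rev < x.rev := Fin.rev_lt_rev.2 hx
  have h5 : x ≠ b.rev := hb.ne'
  rw [braid1_swap hq _ h5 hx, braid2_conj hq _ hbb.le, braid2_swap hq _ h2.ne hb,
    braid1_conj hq _ hbb.le, braid1_swap hq _ h2.ne hb, braid2_swap hq _ h5 hx]
  congr 1
  refine upperSum_congr q b fun c hc => ?_
  have h3 : c.rev < b.rev := Fin.rev_lt_rev.2 hc
  rw [braid1_swap hq _ (h3.trans h2).ne (h3.trans hb),
    braid2_swap hq _ (fun h => (h3.trans hb).ne' h) (hx.trans hc)]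

/-- At the middle index R̂ is the identity minus a tail of conjugate pairs outside it. The middle
index passes through these pairs by swaps, up to a `qgap q` term, and both sides end with the same
terms. -/
lemma braidHolds_mid {m : Fin N} (hm : m = m.rev) : BraidHolds N q M m m m := by
  intro Y
  have e1 : ∀ Y : Fin N × Fin N × Fin N → M, tact (amp1 (braid N q)) Y (m, m, m)
      = Y (m, m, m) - upperSum q m fun b => Y (b.rev, b, m) := fun Y => by
    have := braid1_conj hq Y (i := m) hm.symm.le m
    rw [← hm, swapWeight_self_mid hm, one_smul] at this
    exact this
  have e2 : ∀ Y : Fin N × Fin N × Fin N → M, tact (amp2 (braid N q)) Y (m, m, m)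
      = Y (m, m, m) - upperSum q m fun b => Y (m, b.rev, b) := fun Y => by
    have := braid2_conj hq Y (i := m) hm.symm.le m
    rw [← hm, swapWeight_self_mid hm, one_smul] at this
    exact this
  have hr : ∀ {c : Fin N}, m < c → c.rev < m := fun h => by
    rw [Fin.rev_lt_iff, ← hm]; exact h
  have f1 : upperSum q m (fun b => tact (amp2 (braid N q)) (tact (amp1 (braid N q)) Y) (b.rev, b, m))
      = upperSum q m (fun b => Y (m, b.rev, b)) + upperSum q m (fun b => qgap q • Y (b.rev, m, b)) := by
    rw [← upperSum_add]
    refine upperSum_congr q m fun c hc => ?_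
    rw [braid2_swap hq _ (fun h => (hr hc).ne h.symm) hc,
      braid1_swap_lt hq _ (by rw [Fin.rev_rev]; exact hc.ne) (hr hc)]
  have f2 : upperSum q m (fun b => tact (amp1 (braid N q)) Y (m, b.rev, b))
      = upperSum q m (fun b => Y (b.rev, m, b)) := by
    refine upperSum_congr q m fun c hc => ?_
    rw [braid1_swap hq _ (by rw [← hm]; exact (hr hc).ne) (hr hc)]
  have f3 : upperSum q m (fun b => tact (amp1 (braid N q)) (tact (amp2 (braid N q)) Y) (m, b.rev, b))
      = upperSum q m (fun b => Y (b.rev, b, m)) + upperSum q m (fun b => qgap q • Y (b.rev, m, b)) := by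
    rw [← upperSum_add]
    refine upperSum_congr q m fun c hc => ?_
    rw [braid1_swap hq _ (by rw [← hm]; exact (hr hc).ne) (hr hc),
      braid2_swap_lt hq _ (by rw [← hm]; exact hc.ne') hc]
  have f4 : upperSum q m (fun b => tact (amp2 (braid N q)) Y (b.rev, b, m))
      = upperSum q m (fun b => Y (b.rev, m, b)) := by
    refine upperSum_congr q m fun c hc => ?_
    rw [braid2_swap hq _ (fun h => (hr hc).ne h.symm) hc]
  rw [e1, e2, e1, f1, f2, e2, e1, e2, f3, f4]
  abel

lemma braidHolds_self {b : Fin N} (hb : b.rev < b) : BraidHolds N q M b b b.rev := by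
  intro Y
  have hs : (q : ℂ) ≠ 0 := ofReal_ne_zero_of_pos hq
  have hv : swapWeight N q b b.rev = (q : ℂ)⁻¹ := by rw [swapWeight_self_rev, if_neg hb.ne']
  have hv' : swapWeight N q b.rev b = (q : ℂ)⁻¹ := by rw [swapWeight_comm, hv]
  have f1 : upperSum q b (fun c => tact (amp1 (braid N q)) Y (b, c.rev, c))
      = upperSum q b (fun c => Y (c.rev, b, c)) := by
    refine upperSum_congr q b fun c hc => ?_
    have h3 : c.rev < b.rev := Fin.rev_lt_rev.2 hc
    rw [braid1_swap hq _ h3.ne (h3.trans hb)]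
  have f2 : upperSum q b (fun c => tact (amp2 (braid N q)) Y (c.rev, c, b))
      = upperSum q b (fun c => Y (c.rev, b, c)) := by
    refine upperSum_congr q b fun c hc => ?_
    have h3 : c.rev < b.rev := Fin.rev_lt_rev.2 hc
    rw [braid2_swap hq _ (fun h => (h3.trans hb).ne' h) hc]
  have f3 : upperSum q b (fun c => tact (amp1 (braid N q)) (tact (amp2 (braid N q)) Y) (b, c.rev, c))
      = upperSum q b (fun c => Y (c.rev, c, b)) + upperSum q b (fun c => qgap q • Y (c.rev, b, c)) := by
    rw [← upperSum_add]
    refine upperSum_congr q b fun c hc => ?_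
    have h3 : c.rev < b.rev := Fin.rev_lt_rev.2 hc
    rw [braid1_swap hq _ h3.ne (h3.trans hb),
      braid2_swap_lt hq _ (fun h => (hb.trans hc).ne' h) hc]
  rw [braid1_self hq _ hb.ne', braid2_conj hq _ hb.le, braid1_conj hq _ hb.le, f1,
    braid2_conj hq _ hb.le, f3, braid1_conj hq _ hb.le, f2, braid2_self hq _ hb.ne', hv,
    upperSum_smul]
  -- One tail occurs with weight q on the left and with weight q⁻¹ on the right; the extra `qgap q`
  -- tail on the right is exactly the difference.
  have hg : qgap q = (q : ℂ) - (q : ℂ)⁻¹ := rfl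
  simp only [smul_sub, smul_smul]
  rw [hg, sub_smul, inv_mul_cancel₀ hs, mul_inv_cancel₀ hs, mul_inv_cancel_left₀ hs, one_smul, mul_one]
  abel

/-- A conjugate pair preceded by a larger index. -/
lemma braidHolds_inner {b x : Fin N} (hb : b.rev ≤ b) (hx : b < x) : BraidHolds N q M x b b.rev := by
  intro Y
  have hs : (q : ℂ) ≠ 0 := ofReal_ne_zero_of_pos hq
  have h1 : x.rev < b.rev := Fin.rev_lt_rev.2 hx
  have h2 : x.rev < b := h1.trans_le hb
  have h3 : b.rev < x := hb.trans_lt hx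
  have h4 : x.rev < x := h2.trans hx
  have hvx : swapWeight N q x x.rev = (q : ℂ)⁻¹ := by rw [swapWeight_self_rev, if_neg h4.ne']
  have hux := rhoPow_ne_zero (N := N) hq x
  have hub := rhoPow_ne_zero (N := N) hq b
  rw [braid1_swap hq _ h2.ne' hx, braid2_swap hq _ h1.ne' h3, braid1_conj hq _ hb,
    braid2_conj hq _ hb, braid1_swap hq _ h1.ne' h3, braid2_swap hq _ h2.ne' hx, sub_right_inj]
  have key : ∀ c, b < c → tact (amp1 (braid N q)) (tact (amp2 (braid N q)) Y) (x, c.rev, c)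
      = Y (c.rev, c, x) + ((if x < c then qgap q • Y (c.rev, x, c) else 0)
        - if c = x then upperSum q x (fun d => Y (d.rev, x, d)) else 0) := by
    intro c hc
    have h5 : c.rev < b.rev := Fin.rev_lt_rev.2 hc
    have h6 : c.rev < x := h5.trans h3
    have h7 : c ≠ x.rev := (h2.trans hc).ne'
    rcases lt_trichotomy c x with h | h | h
    · rw [braid1_swap hq _ (fun h' => h.ne (Fin.rev_inj.1 h')) h6, braid2_swap hq _ h7 h,
        if_neg (not_lt.mpr h.le), if_neg h.ne, sub_zero, add_zero]
    · subst h
      rw [braid1_conj hq _ h4.le, braid2_self hq _ h4.ne', hvx, smul_smul, inv_mul_cancel₀ hs,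
        one_smul, if_neg (lt_irrefl _), if_pos rfl, zero_sub, ← sub_eq_add_neg]
      congr 1
      refine upperSum_congr q c fun d hd => ?_
      have h8 : d.rev < c.rev := Fin.rev_lt_rev.2 hd
      rw [braid2_swap hq _ (h8.trans h4).ne' hd]
    · rw [braid1_swap hq _ (fun h' => h.ne' (Fin.rev_inj.1 h')) h6, braid2_swap_lt hq _ h7 h,
        if_pos h, if_neg h.ne', sub_zero]
  -- The term c = x of the tail carries a second tail beginning at x; it cancels the `qgap q` terms
  -- of all c > x.
  rw [upperSum_congr q b key, upperSum_add, left_eq_add]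
  simp only [upperSum, smul_sub, Finset.sum_sub_distrib, smul_ite, smul_zero, Finset.sum_ite_eq',
    Finset.mem_Ioi, hx, if_true]
  rw [← Finset.sum_filter, sub_eq_zero]
  have hf : Finset.filter (fun c => x < c) (Finset.Ioi b) = Finset.Ioi x := by
    ext c
    simp only [Finset.mem_filter, Finset.mem_Ioi]
    exact ⟨fun h => h.2, fun h => ⟨hx.trans h, h⟩⟩
  rw [hf]
  congr 1
  rw [Finset.smul_sum, Finset.smul_sum]
  refine Finset.sum_congr rfl fun c _ => ?_
  simp only [smul_smul]
  congr 1
  field_simp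

/-- On descending pairs that are not conjugate R̂ is a weighted swap, so both sides are the reversed
triple with the same three weights. -/
lemma braidHolds_of_not_conj {x y z : Fin N} (hxy : y ≤ x) (hyz : z ≤ y) (h1 : y ≠ x.rev)
    (h2 : z ≠ x.rev) (h3 : z ≠ y.rev) : BraidHolds N q M x y z := by
  intro Y
  have e1 : ∀ {i j : Fin N}, j ≤ i → j ≠ i.rev → ∀ (Y : Fin N × Fin N × Fin N → M) k,
      tact (amp1 (braid N q)) Y (i, j, k) = swapWeight N q i j • Y (j, i, k) := by
    intro i j hij hij' Y k
    rw [tact_amp1, sum_braid_smul_of_ne hq hij' (fun a b => Y (a, b, k)), if_neg (not_lt.mpr hij),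
      add_zero]
  have e2 : ∀ {i j : Fin N}, j ≤ i → j ≠ i.rev → ∀ (Y : Fin N × Fin N × Fin N → M) k,
      tact (amp2 (braid N q)) Y (k, i, j) = swapWeight N q i j • Y (k, j, i) := by
    intro i j hij hij' Y k
    rw [tact_amp2, sum_braid_smul_of_ne hq hij' (fun a b => Y (k, a, b)), if_neg (not_lt.mpr hij),
      add_zero]
  rw [e1 hxy h1, e2 (hyz.trans hxy) h2, e1 hyz h3, e2 hyz h3, e1 (hyz.trans hxy) h2, e2 hxy h1]
  simp only [smul_smul]
  congr 1; ring

omit hq in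
lemma braidDefect_row_of_braidHolds {i j k : Fin N}
    (h : BraidHolds N q (Fin N × Fin N × Fin N → ℂ) i j k) : braidDefect N q (i, j, k) = 0 := by
  have h1 := h fun t => (1 : Matrix (Fin N × Fin N × Fin N) (Fin N × Fin N × Fin N) ℂ) t
  have h2 : ∀ X : Matrix (Fin N × Fin N × Fin N) (Fin N × Fin N × Fin N) ℂ, ∀ t,
      tact X (fun t => (1 : Matrix (Fin N × Fin N × Fin N) (Fin N × Fin N × Fin N) ℂ) t) t = X t :=
    fun X t => by
      ext u
      simp [tact, Matrix.one_apply, Finset.sum_apply]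
  rw [← tact_mul, ← tact_mul, ← tact_mul, ← tact_mul, h2, h2] at h1
  ext u
  rw [braidDefect, Matrix.sub_apply, h1, sub_self, Pi.zero_apply]

/-- For descending triples the braid relation is computed directly, according to which two of the
indices are conjugate. -/
lemma braidDefect_row_sorted {x y z : Fin N} (hxy : y ≤ x) (hyz : z ≤ y) :
    braidDefect N q (x, y, z) = 0 := by
  by_cases h3 : z = y.rev
  · subst h3
    apply braidDefect_row_of_braidHolds
    rcases hxy.lt_or_eq with h | h
    · exact braidHolds_inner hq hyz h
    · subst h
      rcases hyz.lt_or_eq with h' | h'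
      · exact braidHolds_self hq h'
      · rw [h']; exact braidHolds_mid hq h'.symm
  by_cases h1 : y = x.rev
  · subst h1
    rcases hyz.lt_or_eq with h4 | h4
    -- A conjugate pair followed by a smaller index is the mirror image of a conjugate pair preceded
    -- by a larger one.
    · have h5 := braidDefect_row_of_braidHolds (braidHolds_inner hq (M := Fin N × Fin N × Fin N → ℂ)
        hxy (x := z.rev) (by rwa [Fin.lt_rev_iff]))
      have h6 := braidDefect_row_flipRev hq h5
      rwa [Fin.rev_rev, Fin.rev_rev] at h6
    · subst h4
      have h8 : x.rev < x := lt_of_le_of_ne hxy fun h => h3 (by rw [Fin.rev_rev]; exact h)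
      have h5 := braidDefect_row_of_braidHolds
        (braidHolds_self hq (M := Fin N × Fin N × Fin N → ℂ) h8)
      have h6 := braidDefect_row_flipRev hq h5
      rwa [Fin.rev_rev] at h6
  by_cases h2 : z = x.rev
  · subst h2
    apply braidDefect_row_of_braidHolds
    refine braidHolds_outer hq (lt_of_le_of_ne hyz (Ne.symm h1)) (lt_of_le_of_ne hxy fun h => ?_)
    exact h3 (by rw [h])
  · exact braidDefect_row_of_braidHolds (braidHolds_of_not_conj hq hxy hyz h1 h2 h3)

/-- By `amp1_mul_braidDefect` the row t of R1·D depends only on the row t of the defect D. A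
vanishing row therefore yields a linear relation among the rows that R1 connects with it. -/
lemma tact_braidDefect_amp1 {t : Fin N × Fin N × Fin N} (h : braidDefect N q t = 0) :
    tact (amp1 (braid N q)) (fun u => braidDefect N q u) t = 0 := by
  refine (mul_apply_eq_tact _ _ _).symm.trans ?_
  rw [amp1_mul_braidDefect hq]
  ext u
  simp [Matrix.mul_apply, h]

lemma tact_braidDefect_amp2 {t : Fin N × Fin N × Fin N} (h : braidDefect N q t = 0) :
    tact (amp2 (braid N q)) (fun u => braidDefect N q u) t = 0 := by
  refine (mul_apply_eq_tact _ _ _).symm.trans ?_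
  rw [amp2_mul_braidDefect hq]
  ext u
  simp [Matrix.mul_apply, h]

lemma swapWeight_ne_zero (k l : Fin N) : swapWeight N q k l ≠ 0 := by
  have hs : (q : ℂ) ≠ 0 := ofReal_ne_zero_of_pos hq
  unfold swapWeight
  split_ifs <;> simp [hs]

/-- For a descending pair this relation contains only the swapped row and, if the pair is conjugate,
rows with conjugate pairs further out. Once the latter vanish, so does the swapped row, since its
weight is nonzero. -/
lemma braidDefect_row_swap1 {i j k : Fin N} (hij : j ≤ i) (h : braidDefect N q (i, j, k) = 0)
    (hc : j = i.rev → ∀ c, i < c → braidDefect N q (c.rev, c, k) = 0) :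
    braidDefect N q (j, i, k) = 0 := by
  have h1 := tact_braidDefect_amp1 hq h
  rw [tact_amp1, sum_braid_smul hq i j (fun a b => braidDefect N q (a, b, k)),
    if_neg (not_lt.mpr hij), add_zero] at h1
  have h2 : (if j = i.rev then qgap q • ∑ b ∈ Finset.Ioi i,
      (rhoPow N q b * (rhoPow N q i)⁻¹) • braidDefect N q (b.rev, b, k) else 0) = 0 := by
    split_ifs with h3
    · rw [Finset.sum_eq_zero, smul_zero]
      intro b hb
      rw [hc h3 b (Finset.mem_Ioi.1 hb), smul_zero]
    · rfl
  rw [h2, sub_zero] at h1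
  exact (smul_eq_zero.1 h1).resolve_left (swapWeight_ne_zero hq _ _)

lemma braidDefect_row_swap2 {i j k : Fin N} (hij : j ≤ i) (h : braidDefect N q (k, i, j) = 0)
    (hc : j = i.rev → ∀ c, i < c → braidDefect N q (k, c.rev, c) = 0) :
    braidDefect N q (k, j, i) = 0 := by
  have h1 := tact_braidDefect_amp2 hq h
  rw [tact_amp2, sum_braid_smul hq i j (fun a b => braidDefect N q (k, a, b)),
    if_neg (not_lt.mpr hij), add_zero] at h1
  have h2 : (if j = i.rev then qgap q • ∑ b ∈ Finset.Ioi i,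
      (rhoPow N q b * (rhoPow N q i)⁻¹) • braidDefect N q (k, b.rev, b) else 0) = 0 := by
    split_ifs with h3
    · rw [Finset.sum_eq_zero, smul_zero]
      intro b hb
      rw [hc h3 b (Finset.mem_Ioi.1 hb), smul_zero]
    · rfl
  rw [h2, sub_zero] at h1
  exact (smul_eq_zero.1 h1).resolve_left (swapWeight_ne_zero hq _ _)

/-- All rearrangements of a descending triple can be reached by descending swaps. -/
lemma braidDefect_row_all {x y z : Fin N} (hxy : y ≤ x) (hyz : z ≤ y)
    (hc1 : y = x.rev → ∀ c, x < c →
      braidDefect N q (c.rev, c, z) = 0 ∧ braidDefect N q (z, c.rev, c) = 0)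
    (hc2 : z = x.rev → ∀ c, x < c →
      braidDefect N q (c.rev, c, y) = 0 ∧ braidDefect N q (y, c.rev, c) = 0)
    (hc3 : z = y.rev → ∀ c, y < c →
      braidDefect N q (c.rev, c, x) = 0 ∧ braidDefect N q (x, c.rev, c) = 0) :
    braidDefect N q (y, x, z) = 0 ∧ braidDefect N q (x, z, y) = 0 ∧ braidDefect N q (y, z, x) = 0 ∧
      braidDefect N q (z, x, y) = 0 ∧ braidDefect N q (z, y, x) = 0 := by
  have h0 := braidDefect_row_sorted hq hxy hyz
  have h1 := braidDefect_row_swap1 hq hxy h0 fun h c hc => (hc1 h c hc).1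
  have h2 := braidDefect_row_swap2 hq hyz h0 fun h c hc => (hc3 h c hc).2
  have h3 := braidDefect_row_swap2 hq (hyz.trans hxy) h1 fun h c hc => (hc2 h c hc).2
  have h4 := braidDefect_row_swap1 hq (hyz.trans hxy) h2 fun h c hc => (hc2 h c hc).1
  have h5 := braidDefect_row_swap1 hq hyz h3 fun h c hc => (hc3 h c hc).1
  exact ⟨h1, h2, h3, h4, h5⟩

lemma braidDefect_row_conj (t b : Fin N) (hb : b.rev ≤ b) :
    braidDefect N q (b.rev, b, t) = 0 ∧ braidDefect N q (t, b.rev, b) = 0 := by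
  -- Downward induction on b: the tails involve only pairs (c', c) with c > b, and the range is
  -- empty for n = 0.
  suffices H : ∀ (n : ℕ) (b : Fin N), N ≤ b.val + n → b.rev ≤ b →
      braidDefect N q (b.rev, b, t) = 0 ∧ braidDefect N q (t, b.rev, b) = 0 from
    H N b (by omega) hb
  intro n
  induction n with
  | zero => intro b hb; exact absurd b.isLt (by omega)
  | succ n ih =>
    intro b hbn hb
    have IH : ∀ c, b < c → braidDefect N q (c.rev, c, t) = 0 ∧ braidDefect N q (t, c.rev, c) = 0 :=
      fun c hc => ih c (by rw [Fin.lt_def] at hc; omega)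
        ((Fin.rev_lt_rev.2 hc).le.trans (hb.trans hc.le))
    rcases le_total b t with h1 | h1
    · have h := braidDefect_row_all hq h1 hb
        (fun h c hc => by
          have : t.rev = b := h.symm
          have h' : t = b.rev := by rw [← this, Fin.rev_rev]
          rw [← h']; exact IH c (h1.trans_lt hc))
        (fun h c hc => by
          have h' : t = b := (Fin.rev_inj.1 h).symm
          subst h'; exact IH c hc)
        (fun h c hc => IH c hc)
      exact ⟨h.2.2.2.2, h.2.1⟩
    · rcases le_total b.rev t with h2 | h2
      · have h := braidDefect_row_all hq h1 h2
          (fun h c hc => by rw [← h]; exact IH c hc)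
          (fun _ c hc => IH c hc)
          (fun h c hc => by
            have h' : t = b := (Fin.rev_inj.1 h).symm
            subst h'; exact IH c hc)
        exact ⟨h.2.2.2.1, h.2.2.1⟩
      · have h := braidDefect_row_all hq hb h2
          (fun _ c hc => IH c hc)
          (fun h c hc => by rw [← h]; exact IH c hc)
          (fun h c hc => by
            rw [Fin.rev_rev] at h
            subst h
            exact IH c (h2.trans_lt hc))
        exact ⟨h.1, h.2.2.2.2⟩

lemma braidDefect_eq_zero : braidDefect N q = 0 := by
  have hsort : ∀ {x y z : Fin N}, y ≤ x → z ≤ y →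
      braidDefect N q (y, x, z) = 0 ∧ braidDefect N q (x, z, y) = 0 ∧ braidDefect N q (y, z, x) = 0 ∧
      braidDefect N q (z, x, y) = 0 ∧ braidDefect N q (z, y, x) = 0 := by
    intro x y z hxy hyz
    have aux : ∀ {a b : Fin N} (t : Fin N), b ≤ a → b = a.rev → ∀ c, a < c →
        braidDefect N q (c.rev, c, t) = 0 ∧ braidDefect N q (t, c.rev, c) = 0 := by
      intro a b t hba h c hc
      exact braidDefect_row_conj hq t c ((Fin.rev_lt_rev.2 hc).le.trans ((h ▸ hba).trans hc.le))
    exact braidDefect_row_all hq hxy hyz (aux z hxy) (aux y (hyz.trans hxy)) (aux x hyz)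
  ext ⟨i, j, k⟩ u
  have h : braidDefect N q (i, j, k) = 0 := by
    rcases le_total i j with h1 | h1 <;> rcases le_total j k with h2 | h2
    · exact (hsort h2 h1).2.2.2.2
    · rcases le_total i k with h3 | h3
      · exact (hsort h2 h3).2.2.2.1
      · exact (hsort h1 h3).1
    · rcases le_total i k with h3 | h3
      · exact (hsort h3 h1).2.2.1
      · exact (hsort h3 h2).2.1
    · exact braidDefect_row_sorted hq h1 h2
  rw [h]; rfl

/-- The Yang–Baxter equation for the braid matrix of `O_q(N)`. -/
lemma braid_yangBaxter : amp1 (braid N q) * amp2 (braid N q) * amp1 (braid N q)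
    = amp2 (braid N q) * amp1 (braid N q) * amp2 (braid N q) :=
  sub_eq_zero.1 (braidDefect_eq_zero hq)

end YangBaxter

end QSphere

/-! ### Consequences of the Birman–Murakami–Wenzl relations. -/

namespace QSphere

/-- A braid matrix `R` with inverse `S` and a metric `g`, subject to the relations of the
Birman–Murakami–Wenzl algebra, and the antisymmetrizer `P` belonging to it. -/
structure BraidData {V : Type*} [Fintype V] [DecidableEq V] (g : Matrix V V ℂ)
    (P R S : Matrix (V × V) (V × V) ℂ) (q l E : ℂ) : Prop where
  q_ne : q ≠ 0
  l_ne : l ≠ 0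
  E_ne : E ≠ 0
  two_ne : q + q⁻¹ ≠ 0
  metric_mul : g * g = 1
  mul_inv : R * S = 1
  skein : R - S = (q - q⁻¹) • (1 - rankOne g)
  mul_rankOne : R * rankOne g = l • rankOne g
  rankOne_mul : rankOne g * R = l • rankOne g
  norm : ∑ i, ∑ j, g i j * g i j = E
  norm_eq : (E - 1) * (q - q⁻¹) = l⁻¹ - l
  proj : (q + q⁻¹) • P = q • 1 - R + ((l - q) / E) • rankOne g
  yangBaxter : amp1 R * amp2 R * amp1 R = amp2 R * amp1 R * amp2 R
  amp2_cup12 : amp2 R * cup12 g = amp1 S * cup23 g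
  amp1_cup23 : amp1 R * cup23 g = amp2 S * cup12 g
  cap12_amp2 : cap12 g * amp2 R = cap23 g * amp1 S
  cap23_amp1 : cap23 g * amp1 R = cap12 g * amp2 S

namespace BraidData

variable {V : Type*} [Fintype V] [DecidableEq V] {g : Matrix V V ℂ}
    {P R S : Matrix (V × V) (V × V) ℂ} {q l E : ℂ} (D : BraidData g P R S q l E)
include D

lemma inv_mul : S * R = 1 := mul_eq_one_comm.1 D.mul_inv

lemma amp1_mul_inv : amp1 R * amp1 S = 1 := by rw [← amp1_mul, D.mul_inv, amp1_one]

lemma amp2_mul_inv : amp2 R * amp2 S = 1 := by rw [← amp2_mul, D.mul_inv, amp2_one]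

lemma amp1_inv_mul : amp1 S * amp1 R = 1 := by rw [← amp1_mul, D.inv_mul, amp1_one]

lemma amp2_inv_mul : amp2 S * amp2 R = 1 := by rw [← amp2_mul, D.inv_mul, amp2_one]

lemma inv_mul_rankOne : S * rankOne g = l⁻¹ • rankOne g := by
  have h := congrArg (S * ·) D.mul_rankOne
  simp only [← mul_assoc, D.inv_mul, one_mul, mul_smul_comm] at h
  conv_rhs => rw [h]
  rw [smul_smul, inv_mul_cancel₀ D.l_ne, one_smul]

lemma rankOne_mul_inv : rankOne g * S = l⁻¹ • rankOne g := by
  have h := congrArg (· * S) D.rankOne_mul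
  simp only [mul_assoc, D.mul_inv, mul_one, smul_mul_assoc] at h
  conv_rhs => rw [h]
  rw [smul_smul, inv_mul_cancel₀ D.l_ne, one_smul]

/-- Exchanging the braid matrix and its inverse. -/
lemma symm : BraidData g P S R q⁻¹ l⁻¹ E where
  q_ne := inv_ne_zero D.q_ne
  l_ne := inv_ne_zero D.l_ne
  E_ne := D.E_ne
  two_ne := by rw [inv_inv, add_comm]; exact D.two_ne
  metric_mul := D.metric_mul
  mul_inv := D.inv_mul
  skein := by rw [inv_inv, ← neg_sub, D.skein, ← neg_smul, neg_sub]
  mul_rankOne := D.inv_mul_rankOne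
  rankOne_mul := D.rankOne_mul_inv
  norm := D.norm
  norm_eq := by rw [inv_inv, inv_inv]; linear_combination -D.norm_eq
  proj := by
    have h : S = R - (q - q⁻¹) • (1 - rankOne g) := by rw [← D.skein]; abel
    have hE := D.E_ne
    -- By this identity, equivalent to `norm_eq`, the antisymmetrizer built from the inverse braid
    -- matrix is the same P.
    have h2 : (l⁻¹ - q⁻¹) / E = (l - q) / E + (q - q⁻¹) := by
      rw [eq_comm, div_add' _ _ _ hE]
      congr 1
      linear_combination D.norm_eq
    rw [inv_inv, add_comm, D.proj, h, h2]
    module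
  yangBaxter := by
    have h1 := D.amp1_mul_inv
    have h2 := D.amp2_mul_inv
    have h3 := D.amp1_inv_mul
    have h4 := D.amp2_inv_mul
    have e1 : amp1 S * amp2 S * amp1 S * (amp1 R * amp2 R * amp1 R) = 1 := by
      calc _ = amp1 S * (amp2 S * (amp1 S * amp1 R) * amp2 R) * amp1 R := by noncomm_ring
        _ = 1 := by rw [h3, mul_one, h4, mul_one, h3]
    have e2 : (amp2 R * amp1 R * amp2 R) * (amp2 S * amp1 S * amp2 S) = 1 := by
      calc _ = amp2 R * (amp1 R * (amp2 R * amp2 S) * amp1 S) * amp2 S := by noncomm_ring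
        _ = 1 := by rw [h2, mul_one, h1, mul_one, h2]
    rw [D.yangBaxter] at e1
    exact left_inv_eq_right_inv e1 e2
  amp2_cup12 := D.amp1_cup23.symm
  amp1_cup23 := D.amp2_cup12.symm
  cap12_amp2 := D.cap23_amp1.symm
  cap23_amp1 := D.cap12_amp2.symm

/-- The eigenvalue equation of the rank one matrix, with its cup removed by the zigzag identity. -/
lemma cap12_amp1 : cap12 g * amp1 R = l • cap12 g := by
  have h := congrArg (fun X => cap23 g * amp1 X) D.rankOne_mul
  simp only [amp1_mul, amp1_smul, amp1_rankOne] at h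
  rwa [Matrix.mul_smul, ← Matrix.mul_assoc, ← Matrix.mul_assoc, cap23_mul_cup12 D.metric_mul,
    Matrix.one_mul] at h

lemma cap23_amp2 : cap23 g * amp2 R = l • cap23 g := by
  have h := congrArg (fun X => cap12 g * amp2 X) D.rankOne_mul
  simp only [amp2_mul, amp2_smul, amp2_rankOne] at h
  rwa [Matrix.mul_smul, ← Matrix.mul_assoc, ← Matrix.mul_assoc, cap12_mul_cup23 D.metric_mul,
    Matrix.one_mul] at h

lemma cap12_amp2_amp1 : cap12 g * amp2 R * amp1 R = cap23 g := by
  rw [D.cap12_amp2, Matrix.mul_assoc, D.amp1_inv_mul, Matrix.mul_one]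

lemma cap23_amp1_amp2 : cap23 g * amp1 R * amp2 R = cap12 g := by
  rw [D.cap23_amp1, Matrix.mul_assoc, D.amp2_inv_mul, Matrix.mul_one]

lemma amp1_amp2_cup12 : amp1 R * (amp2 R * cup12 g) = cup23 g := by
  rw [D.amp2_cup12, ← Matrix.mul_assoc, D.amp1_mul_inv, Matrix.one_mul]

lemma amp2_amp1_cup23 : amp2 R * (amp1 R * cup23 g) = cup12 g := by
  rw [D.amp1_cup23, ← Matrix.mul_assoc, D.amp2_mul_inv, Matrix.one_mul]

/-- A kink in a strand: sliding across the cup turns it into an inverse twist on a cap, of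
eigenvalue l⁻¹, and a zigzag. -/
lemma cap12_amp2_cup12 : cap12 g * (amp2 R * cup12 g) = l⁻¹ • 1 := by
  rw [D.amp2_cup12, ← Matrix.mul_assoc, D.symm.cap12_amp1, Matrix.smul_mul,
    cap12_mul_cup23 D.metric_mul]

lemma cap23_amp1_cup23 : cap23 g * (amp1 R * cup23 g) = l⁻¹ • 1 := by
  rw [D.amp1_cup23, ← Matrix.mul_assoc, D.symm.cap23_amp2, Matrix.smul_mul,
    cap23_mul_cup12 D.metric_mul]

lemma proj_coeff : (q - q⁻¹) * l + (l - q) / E * l = -q⁻¹ * ((l - q) / E) := by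
  have h := D.norm_eq
  have hq := D.q_ne
  have hl := D.l_ne
  have hE := D.E_ne
  field_simp at h ⊢
  linear_combination h

lemma mul_self : R * R = 1 + (q - q⁻¹) • R - ((q - q⁻¹) * l) • rankOne g := by
  have h := congrArg (R * ·) D.skein
  simp only [mul_sub, D.mul_inv, mul_smul_comm, mul_one, D.mul_rankOne] at h
  rw [sub_eq_iff_eq_add.1 h]
  module

/-- The quadratic relation puts P in the eigenspace -q⁻¹; `proj_coeff` is the comparison of the rank
one terms. -/
lemma proj_mul : P * R = -q⁻¹ • P := by
  apply smul_right_injective _ D.two_ne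
  show (q + q⁻¹) • (P * R) = (q + q⁻¹) • (-q⁻¹ • P)
  rw [← smul_mul_assoc, smul_comm, D.proj, add_mul, sub_mul, smul_mul_assoc, smul_mul_assoc,
    D.mul_self, D.rankOne_mul, one_mul, smul_add, smul_sub, smul_smul (-q⁻¹) _ (rankOne g),
    ← D.proj_coeff, smul_smul (-q⁻¹), neg_mul, inv_mul_cancel₀ D.q_ne]
  module

lemma proj_mul_inv : P * S = -q • P := by
  have h := D.symm.proj_mul
  rwa [inv_inv] at h

lemma amp1_eq : amp1 R = q • 1 - (q + q⁻¹) • amp1 P + ((l - q) / E) • (cup12 g * cap12 g) := by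
  have h := congrArg amp1 D.proj
  rw [amp1_smul, amp1_add, amp1_sub, amp1_smul, amp1_smul, amp1_one, amp1_rankOne] at h
  rw [h]; abel

lemma amp2_eq : amp2 R = q • 1 - (q + q⁻¹) • amp2 P + ((l - q) / E) • (cup23 g * cap23 g) := by
  have h := congrArg amp2 D.proj
  rw [amp2_smul, amp2_add, amp2_sub, amp2_smul, amp2_smul, amp2_one, amp2_rankOne] at h
  rw [h]; abel

/-- P is a combination of 1, R and the rank one matrix. R passes through R1R2 by the Yang–Baxter
equation, and the rank one matrix because cups and caps slide through it. -/
lemma amp2_proj_amp1_amp2 : amp2 P * (amp1 R * amp2 R) = amp1 R * amp2 R * amp1 P := by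
  have h1 : (cup23 g * cap23 g) * (amp1 R * amp2 R) = amp1 R * amp2 R * (cup12 g * cap12 g) := by
    rw [Matrix.mul_assoc, ← Matrix.mul_assoc (cap23 g), D.cap23_amp1_amp2,
      ← Matrix.mul_assoc (amp1 R * amp2 R), Matrix.mul_assoc (amp1 R), D.amp1_amp2_cup12]
  have h2 : amp2 R * (amp1 R * amp2 R) = amp1 R * amp2 R * amp1 R := by
    rw [D.yangBaxter, mul_assoc]
  have h3 : ∀ X Y : Matrix (V × V × V) (V × V × V) ℂ, (q + q⁻¹) • X = (q + q⁻¹) • Y → X = Y :=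
    fun X Y h => smul_right_injective _ D.two_ne h
  apply h3
  rw [← smul_mul_assoc, ← mul_smul_comm, ← amp1_smul, ← amp2_smul, D.proj, amp1_add, amp1_sub,
    amp2_add, amp2_sub, amp1_smul, amp1_smul, amp2_smul, amp2_smul, amp1_one, amp2_one,
    amp1_rankOne, amp2_rankOne, add_mul, sub_mul, mul_add, mul_sub, smul_mul_assoc, smul_mul_assoc,
    h1, h2, mul_smul_comm, mul_smul_comm, one_mul, mul_one]

lemma amp1_proj_amp2_amp1 : amp1 P * (amp2 R * amp1 R) = amp2 R * amp1 R * amp2 P := by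
  have h1 : (cup12 g * cap12 g) * (amp2 R * amp1 R) = amp2 R * amp1 R * (cup23 g * cap23 g) := by
    rw [Matrix.mul_assoc, ← Matrix.mul_assoc (cap12 g), D.cap12_amp2_amp1,
      ← Matrix.mul_assoc (amp2 R * amp1 R), Matrix.mul_assoc (amp2 R), D.amp2_amp1_cup23]
  have h2 : amp1 R * (amp2 R * amp1 R) = amp2 R * amp1 R * amp2 R := by
    rw [← D.yangBaxter, mul_assoc]
  have h3 : ∀ X Y : Matrix (V × V × V) (V × V × V) ℂ, (q + q⁻¹) • X = (q + q⁻¹) • Y → X = Y :=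
    fun X Y h => smul_right_injective _ D.two_ne h
  apply h3
  rw [← smul_mul_assoc, ← mul_smul_comm, ← amp1_smul, ← amp2_smul, D.proj, amp1_add, amp1_sub,
    amp2_add, amp2_sub, amp1_smul, amp1_smul, amp2_smul, amp2_smul, amp1_one, amp2_one,
    amp1_rankOne, amp2_rankOne, add_mul, sub_mul, mul_add, mul_sub, smul_mul_assoc, smul_mul_assoc,
    h1, h2, mul_smul_comm, mul_smul_comm, one_mul, mul_one]

lemma norm_identity : (l - q) * (q + l⁻¹) = E * (1 - q ^ 2) := by
  have h := D.norm_eq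
  have hq := D.q_ne
  have hl := D.l_ne
  field_simp at h ⊢
  linear_combination h

section Algebra

variable {A : Type*} [Ring A] [Algebra ℂ A] {y : V → A}

/-- The quadratic element `g_{ij} y^i y^j` commutes with the `y^k`, if the `y^k` satisfy the
relations of quantum Euclidean space. -/
lemma quadratic_comm (hE : E - q * l + q ^ 2 ≠ 0)
    (hy : ∀ i j, ∑ k, ∑ m, P (i, j) (k, m) • (y k * y m) = 0) (k : V) :
    (∑ i, ∑ j, g i j • (y i * y j)) * y k = y k * ∑ i, ∑ j, g i j • (y i * y j) := by
  set r : A := ∑ i, ∑ j, g i j • (y i * y j) with hr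
  let Y : V × V × V → A := fun t => y t.1 * (y t.2.1 * y t.2.2)
  have h12 : tact (cap12 g) Y = fun k => r * y k := by
    ext i
    rw [tact_cap12, hr]
    simp only [Y, Finset.sum_mul, smul_mul_assoc, mul_assoc]
  have h23 : tact (cap23 g) Y = fun k => y k * r := by
    ext i
    rw [tact_cap23, hr]
    simp only [Y, Finset.mul_sum, mul_smul_comm]
  have hP1 : tact (amp1 P) Y = 0 := by
    ext ⟨i, j, k⟩
    rw [tact_amp1]
    have := congrArg (· * y k) (hy i j)
    simpa only [Y, Finset.sum_mul, smul_mul_assoc, mul_assoc, zero_mul, Pi.zero_apply] using this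
  have hP2 : tact (amp2 P) Y = 0 := by
    ext ⟨i, j, k⟩
    rw [tact_amp2]
    have := congrArg (y i * ·) (hy j k)
    simpa only [Y, Finset.mul_sum, mul_smul_comm, mul_assoc, mul_zero, Pi.zero_apply] using this
  -- On cubic monomials P vanishes in both positions, so R acts as q plus a multiple of the rank one
  -- matrix.
  have e1 : tact (amp1 R) Y = q • Y + ((l - q) / E) • tact (cup12 g) (fun k => r * y k) := by
    rw [D.amp1_eq, tact_add, tact_sub, tact_smul, tact_smul, tact_smul, tact_one, hP1, smul_zero,
      sub_zero, tact_mul, h12]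
  have e2 : tact (amp2 R) Y = q • Y + ((l - q) / E) • tact (cup23 g) (fun k => y k * r) := by
    rw [D.amp2_eq, tact_add, tact_sub, tact_smul, tact_smul, tact_smul, tact_one, hP2, smul_zero,
      sub_zero, tact_mul, h23]
  -- Write c = (l - q)/E. Evaluating cap23·R1·R2 = cap12 on cubic monomials gives (1 - qc) r y = (q²
  -- + c l⁻¹) y r; the two coefficients are equal by `norm_identity`, and `hE` makes them nonzero.
  have h := congrArg (fun X => tact X Y) D.cap23_amp1_amp2
  simp only [tact_mul, e2, tact_vec_add, tact_vec_smul, e1, h12, h23] at h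
  rw [← tact_mul, ← tact_mul, ← tact_mul, cap23_mul_cup12 D.metric_mul, tact_one, Matrix.mul_assoc,
    D.cap23_amp1_cup23, tact_smul, tact_one] at h
  have h' := congrFun h k
  simp only [Pi.add_apply, Pi.smul_apply] at h'
  have hn := D.norm_identity
  have hEn := D.E_ne
  have hc : 1 - q * ((l - q) / E) = q * q + (l - q) / E * l⁻¹ := by
    field_simp
    have hl := D.l_ne
    field_simp at hn ⊢
    linear_combination hn * (-1)
  have hc0 : 1 - q * ((l - q) / E) ≠ 0 := by
    intro h0
    apply hE
    field_simp at h0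
    linear_combination h0
  apply smul_right_injective A hc0
  show (1 - q * ((l - q) / E)) • (r * y k) = (1 - q * ((l - q) / E)) • (y k * r)
  conv_rhs => rw [hc]
  generalize (l - q) / E = c at *
  rw [sub_smul, one_smul, sub_eq_iff_eq_add]
  refine h'.symm.trans ?_
  module

end Algebra

end BraidData

end QSphere

namespace QSphere

/-! ### The braid data of O_q(N) and quantum Euclidean space. -/

section Instances

variable {N : ℕ} {q : ℝ}

lemma rpow_sq_sum_pos (hN : 1 ≤ N) (hq : 0 < q) : 0 < ∑ b : Fin N, (q ^ rho N b) ^ 2 :=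
  Finset.sum_pos (fun _ _ => pow_pos (Real.rpow_pos_of_pos hq _) 2) ⟨⟨0, hN⟩, Finset.mem_univ _⟩

lemma metricSq_eq_ofReal (hq : 0 < q) :
    metricSq N q = ((∑ b : Fin N, (q ^ rho N b) ^ 2 : ℝ) : ℂ) := by
  rw [metricSq_eq_sum hq]
  simp [rhoPow, qpow]

lemma metricSq_ne_zero (hN : 1 ≤ N) (hq : 0 < q) : metricSq N q ≠ 0 := by
  rw [metricSq_eq_ofReal hq]
  exact_mod_cast (rpow_sq_sum_pos hN hq).ne'

lemma add_inv_ne_zero (hq : 0 < q) : (q : ℂ) + (q : ℂ)⁻¹ ≠ 0 := by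
  have : 0 < q + q⁻¹ := by positivity
  exact_mod_cast this.ne'

lemma projZero_eq : projZero N q = (metricSq N q)⁻¹ • rankOne (metric N q) := by
  ext i j
  simp [projZero, rankOne, metricSq, div_eq_inv_mul]

lemma braidData (hN : 1 ≤ N) (hq : 0 < q) :
    BraidData (metric N q) (projMinus N q) (braid N q) (braidInv N q) q (qpow q (1 - N))
      (metricSq N q) where
  q_ne := ofReal_ne_zero_of_pos hq
  l_ne := qpow_ne_zero hq _
  E_ne := metricSq_ne_zero hN hq
  two_ne := add_inv_ne_zero hq
  metric_mul := metric_mul_self N hq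
  mul_inv := braid_mul_braidInv hq
  skein := by rw [braidInv, qgap, smul_sub]; abel
  mul_rankOne := braid_mul_cupCap hq
  rankOne_mul := cupCap_mul_braid hq
  norm := rfl
  norm_eq := metricSq_identity hN hq
  proj := by
    rw [projMinus, smul_inv_smul₀ (add_inv_ne_zero hq), projZero_eq, smul_smul, div_eq_mul_inv]
  yangBaxter := braid_yangBaxter hq
  amp2_cup12 := amp2_braid_cup12 (metric_mul_self N hq) hq
  amp1_cup23 := amp1_braid_cup23 (metric_mul_self N hq) hq
  cap12_amp2 := cap12_amp2_braid (metric_mul_self N hq) hq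
  cap23_amp1 := cap23_amp1_braid (metric_mul_self N hq) hq

lemma qpow_one_sub_ne (hN : 1 ≤ N) (hq : 0 < q) (h1 : q ≠ 1) : (q : ℂ) ≠ qpow q (1 - N) := by
  intro h
  rw [qpow] at h
  have h2 : q ^ (1 : ℝ) = q ^ (1 - N : ℝ) := by rw [Real.rpow_one]; exact_mod_cast h
  have h3 := (Real.rpow_right_inj hq h1).1 h2
  have : (1 : ℝ) ≤ N := by exact_mod_cast hN
  linarith

/-- With l = q^{1-N}, multiplication by q - q⁻¹ turns the expression into (q - l)(q⁻¹l⁻¹ + q²). The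
second factor is positive, and the first is nonzero for q ≠ 1 because N ≥ 1. At q = 1 the expression
is the norm of the metric. -/
lemma central_ne_zero (hN : 1 ≤ N) (hq : 0 < q) :
    metricSq N q - (q : ℂ) * qpow q (1 - N) + (q : ℂ) ^ 2 ≠ 0 := by
  have hE := metricSq_identity hN hq
  have hs : (q : ℂ) ≠ 0 := ofReal_ne_zero_of_pos hq
  have hl := qpow_ne_zero hq (1 - N : ℝ)
  by_cases h1 : q = 1
  · subst h1
    have h2 : qpow 1 (1 - N : ℝ) = 1 := by simp [qpow]
    rw [h2]
    simpa using metricSq_ne_zero hN hq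
  · intro h0
    have h2 := qpow_one_sub_ne hN hq h1
    have h3 : ((q : ℂ) - qpow q (1 - N)) * ((q : ℂ)⁻¹ * (qpow q (1 - N))⁻¹ + (q : ℂ) ^ 2) = 0 := by
      have h4 : qgap q * (metricSq N q - (q : ℂ) * qpow q (1 - N) + (q : ℂ) ^ 2) = 0 := by
        rw [h0, mul_zero]
      rw [← h4]
      rw [qgap] at hE ⊢
      generalize qpow q (1 - N : ℝ) = l at *
      field_simp at hE ⊢
      linear_combination (-1 : ℂ) * hE
    rcases mul_eq_zero.1 h3 with h4 | h4
    · exact h2 (sub_eq_zero.1 h4)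
    · have h5 : 0 < q⁻¹ * (q ^ (1 - N : ℝ))⁻¹ + q ^ 2 := by positivity
      rw [qpow] at h4
      exact h5.ne' (by exact_mod_cast h4)

lemma braid_inv_eq (hq : 0 < q) : (braid N q)⁻¹ = braidInv N q :=
  Matrix.inv_eq_right_inv (braid_mul_braidInv hq)

/-- Both calculi thus have the form z⁻¹R for some braid data; here z = q⁻¹ and R is the inverse
braid matrix. -/
lemma calcFirst_eq (hq : 0 < q) : calcFirst N q = ((q : ℂ)⁻¹)⁻¹ • braidInv N q := by
  rw [calcFirst, braid_inv_eq hq, inv_inv]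

end Instances

/-- Induction for algebras generated by a family of elements. -/
lemma freeAlgebra_quotient_induction {X A : Type*} [Ring A] [Algebra ℂ A]
    (π : FreeAlgebra ℂ X →ₐ[ℂ] A) (hπ : Function.Surjective π) {p : A → Prop} (h1 : p 1)
    (hx : ∀ j f, p f → p (π (FreeAlgebra.ι ℂ j) * f)) (hadd : ∀ f g, p f → p g → p (f + g))
    (hsmul : ∀ (c : ℂ) f, p f → p (c • f)) (f : A) : p f := by
  have H : ∀ a : FreeAlgebra ℂ X, ∀ f, p f → p (π a * f) := by
    intro a
    refine FreeAlgebra.induction ℂ X (motive := fun a => ∀ f, p f → p (π a * f)) ?_ ?_ ?_ ?_ a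
    · intro c f hf
      rw [AlgHom.commutes, ← Algebra.smul_def]
      exact hsmul c f hf
    · exact fun j f hf => hx j f hf
    · intro a b ha hb f hf
      rw [map_mul, mul_assoc]
      exact ha _ (hb _ hf)
    · intro a b ha hb f hf
      rw [map_add, add_mul]
      exact hadd _ _ (ha _ hf) (hb _ hf)
  obtain ⟨a, rfl⟩ := hπ f
  simpa using H a 1 h1

namespace Eucl

variable {N : ℕ} {q : ℝ}

lemma induction {p : Eucl N q → Prop} (h1 : p 1) (hx : ∀ j f, p f → p (Eucl.x N q j * f))
    (hadd : ∀ f g, p f → p g → p (f + g)) (hsmul : ∀ (c : ℂ) f, p f → p (c • f))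
    (f : Eucl N q) : p f :=
  freeAlgebra_quotient_induction (RingQuot.mkAlgHom ℂ (EuclRel N q))
    (RingQuot.mkAlgHom_surjective ℂ _) h1 hx hadd hsmul f

lemma x_relation (i j : Fin N) :
    ∑ k, ∑ l, projMinus N q (i, j) (k, l) • (Eucl.x N q k * Eucl.x N q l) = 0 := by
  have h := RingQuot.mkAlgHom_rel ℂ (EuclRel.comm (N := N) (q := q) i j)
  simp only [map_sum, map_smul, map_mul, map_zero] at h
  exact h

/-- A family of elements satisfying the relations of quantum Euclidean space defines an algebra
homomorphism. -/
lemma exists_lift {A : Type*} [Semiring A] [Algebra ℂ A] (y : Fin N → A)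
    (hy : ∀ i j, ∑ k, ∑ l, projMinus N q (i, j) (k, l) • (y k * y l) = 0) :
    ∃ φ : Eucl N q →ₐ[ℂ] A, ∀ j, φ (Eucl.x N q j) = y j := by
  have h : ∀ ⦃a b⦄, EuclRel N q a b → FreeAlgebra.lift ℂ y a = FreeAlgebra.lift ℂ y b := by
    rintro _ _ ⟨i, j⟩
    simpa only [map_sum, map_smul, map_mul, map_zero, FreeAlgebra.lift_ι_apply] using hy i j
  refine ⟨RingQuot.liftAlgHom ℂ ⟨FreeAlgebra.lift ℂ y, h⟩, fun j => ?_⟩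
  rw [Eucl.x, RingQuot.liftAlgHom_mkAlgHom_apply, FreeAlgebra.lift_ι_apply]

/-- The invariant square length. -/
def radius (N : ℕ) (q : ℝ) : Eucl N q :=
  ∑ i, ∑ j, metric N q i j • (Eucl.x N q i * Eucl.x N q j)

lemma radius_comm (hN : 1 ≤ N) (hq : 0 < q) (k : Fin N) :
    radius N q * Eucl.x N q k = Eucl.x N q k * radius N q :=
  (braidData hN hq).quadratic_comm (central_ne_zero hN hq) x_relation k

end Eucl

/-! ### Existence and uniqueness of the differential calculi. -/

section Calculus

variable {N : ℕ} {q : ℝ} {R S : Matrix (Fin N × Fin N) (Fin N × Fin N) ℂ} {z l E : ℂ}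
  (D : BraidData (metric N q) (projMinus N q) R S z l E)

section
include D

/-- The inhomogeneous terms produced by a derivative of P⁻xx cancel: the cup slides across R, and P⁻
has eigenvalue -z under the inverse of R. The companion `BraidData.proj_cup23` does the same for
P⁻∂∂ applied to a product with a coordinate. -/
lemma BraidData.proj_cup12 : amp2 (projMinus N q) *
    (cup12 (metric N q) + amp1 (z⁻¹ • R) * cup23 (metric N q)) = 0 := by
  rw [Matrix.mul_add, amp1_smul, Matrix.smul_mul, D.amp1_cup23, Matrix.mul_smul, ← Matrix.mul_assoc,
    ← amp2_mul, D.proj_mul_inv, neg_smul, ← neg_one_smul ℂ, amp2_smul, amp2_smul, Matrix.smul_mul,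
    Matrix.smul_mul, smul_comm z⁻¹, inv_smul_smul₀ D.q_ne, neg_one_smul, add_neg_cancel]

lemma BraidData.proj_cup23 : amp1 (projMinus N q) *
    (cup23 (metric N q) + amp2 (z⁻¹ • R) * cup12 (metric N q)) = 0 := by
  rw [Matrix.mul_add, amp2_smul, Matrix.smul_mul, D.amp2_cup12, Matrix.mul_smul, ← Matrix.mul_assoc,
    ← amp1_mul, D.proj_mul_inv, neg_smul, ← neg_one_smul ℂ, amp1_smul, amp1_smul, Matrix.smul_mul,
    Matrix.smul_mul, smul_comm z⁻¹, inv_smul_smul₀ D.q_ne, neg_one_smul, add_neg_cancel]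

end

/-- Left multiplication by `x^j` together with its effect on the derivatives. -/
def leibnizOp (B : Matrix (Fin N × Fin N) (Fin N × Fin N) ℂ) (j : Fin N) :
    Module.End ℂ (Eucl N q × (Fin N → Eucl N q)) where
  toFun v := (Eucl.x N q j * v.1, fun i => metric N q i j • v.1
    + ∑ k, ∑ l, B (i, j) (k, l) • (Eucl.x N q k * v.2 l))
  map_add' v w := by
    ext i
    · simp [mul_add]
    · simp only [Prod.fst_add, Prod.snd_add, Pi.add_apply, smul_add, mul_add,
        Finset.sum_add_distrib]
      abel
  map_smul' c v := by
    ext i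
    · simp
    · simp only [Prod.smul_fst, Prod.smul_snd, Pi.smul_apply, mul_smul_comm, RingHom.id_apply,
        smul_add, Finset.smul_sum, smul_comm c]

lemma leibnizOp_fst (B : Matrix (Fin N × Fin N) (Fin N × Fin N) ℂ) (j : Fin N)
    (v : Eucl N q × (Fin N → Eucl N q)) : (leibnizOp B j v).1 = Eucl.x N q j * v.1 := rfl

lemma leibnizOp_snd (B : Matrix (Fin N × Fin N) (Fin N × Fin N) ℂ) (j i : Fin N)
    (v : Eucl N q × (Fin N → Eucl N q)) : (leibnizOp B j v).2 i = metric N q i j • v.1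
    + ∑ k, ∑ l, B (i, j) (k, l) • (Eucl.x N q k * v.2 l) := rfl

include D

/-- The Leibniz rule respects the relations of the x^i, so that quantum Euclidean space acts on
pairs consisting of a function and its derivatives. The inhomogeneous terms vanish by
`BraidData.proj_cup12`; in the homogeneous ones P⁻ passes through R1R2 and meets P⁻xx. -/
lemma leibnizOp_relation (i j : Fin N) :
    ∑ a, ∑ b, projMinus N q (i, j) (a, b) •
      (leibnizOp (q := q) (z⁻¹ • R) a * leibnizOp (z⁻¹ • R) b) = 0 := by
  refine LinearMap.ext fun v => Prod.ext ?_ (funext fun k => ?_)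
  · simp only [LinearMap.sum_apply, LinearMap.smul_apply, Module.End.mul_apply, Prod.fst_sum,
      Prod.smul_fst, LinearMap.zero_apply, Prod.fst_zero]
    have h := congrArg (· * v.1) (Eucl.x_relation (N := N) (q := q) i j)
    simp only [Finset.sum_mul, smul_mul_assoc, zero_mul, mul_assoc] at h
    exact h
  · simp only [LinearMap.sum_apply, LinearMap.smul_apply, Module.End.mul_apply, Prod.snd_sum,
      Prod.smul_snd, LinearMap.zero_apply, Prod.snd_zero, Finset.sum_apply, Pi.smul_apply,
      Pi.zero_apply]
    let X : Fin N × Fin N × Fin N → Eucl N q := fun t =>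
      Eucl.x N q t.1 * (Eucl.x N q t.2.1 * v.2 t.2.2)
    let Y : Fin N → Eucl N q := fun b => Eucl.x N q b * v.1
    have hW : ∀ a b, (leibnizOp (q := q) (z⁻¹ • R) a (leibnizOp (z⁻¹ • R) b v)).2 k
        = (tact (cup12 (metric N q) + amp1 (z⁻¹ • R) * cup23 (metric N q)) Y
          + tact (amp1 (z⁻¹ • R)) (tact (amp2 (z⁻¹ • R)) X)) (k, a, b) := by
      intro a b
      rw [tact_add, tact_mul, Pi.add_apply, Pi.add_apply, tact_cup12, tact_amp1, tact_amp1]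
      simp only [tact_cup23, tact_amp2, leibnizOp_fst, leibnizOp_snd, mul_add,
        mul_smul_comm, Finset.mul_sum, smul_add, Finset.sum_add_distrib, X, Y]
      abel
    simp only [hW]
    rw [← tact_amp2, tact_vec_add, ← tact_mul, D.proj_cup12, tact_zero_left, zero_add]
    have hX : tact (amp1 (projMinus N q)) X = 0 := by
      ext ⟨a, b, c⟩
      rw [tact_amp1]
      have h := congrArg (· * v.2 c) (Eucl.x_relation (N := N) (q := q) a b)
      simpa only [X, Finset.sum_mul, smul_mul_assoc, zero_mul, mul_assoc, Pi.zero_apply] using h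
    have hc : amp2 (projMinus N q) * (amp1 (z⁻¹ • R) * amp2 (z⁻¹ • R))
        = amp1 (z⁻¹ • R) * amp2 (z⁻¹ • R) * amp1 (projMinus N q) := by
      simp only [amp1_smul, amp2_smul, smul_mul_assoc, mul_smul_comm, D.amp2_proj_amp1_amp2]
    rw [← tact_mul, ← tact_mul, Matrix.mul_assoc, hc, tact_mul, hX, tact_zero]
    rfl

omit D in
/-- The derivatives of a product of two coordinates with a function. -/
lemma IsCalculus.leibniz_two {B : Matrix (Fin N × Fin N) (Fin N × Fin N) ℂ}
    {d : Fin N → (Eucl N q →ₗ[ℂ] Eucl N q)} (h1 : ∀ i j f, d i (Eucl.x N q j * f) =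
    metric N q i j • f + ∑ k, ∑ l, B (i, j) (k, l) • (Eucl.x N q k * d l f)) (f : Eucl N q) :
    (fun t : Fin N × Fin N × Fin N => d t.1 (Eucl.x N q t.2.1 * (Eucl.x N q t.2.2 * f)))
      = tact (cup12 (metric N q) + amp1 B * cup23 (metric N q)) (fun b => Eucl.x N q b * f)
        + tact (amp1 B * amp2 B)
          (fun t => Eucl.x N q t.1 * (Eucl.x N q t.2.1 * d t.2.2 f)) := by
  ext ⟨i, a, b⟩
  rw [tact_add, tact_mul, tact_mul, Pi.add_apply, Pi.add_apply, tact_cup12, tact_amp1, tact_amp1]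
  simp only [tact_cup23, tact_amp2, h1, mul_add, mul_smul_comm, Finset.mul_sum, smul_add,
    Finset.sum_add_distrib]
  abel

omit D in
/-- Two derivatives of the product of a coordinate with a function. -/
lemma IsCalculus.two_leibniz {B : Matrix (Fin N × Fin N) (Fin N × Fin N) ℂ}
    {d : Fin N → (Eucl N q →ₗ[ℂ] Eucl N q)} (h1 : ∀ i j f, d i (Eucl.x N q j * f) =
    metric N q i j • f + ∑ k, ∑ l, B (i, j) (k, l) • (Eucl.x N q k * d l f)) (f : Eucl N q) :
    (fun t : Fin N × Fin N × Fin N => d t.1 (d t.2.1 (Eucl.x N q t.2.2 * f)))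
      = tact (cup23 (metric N q) + amp2 B * cup12 (metric N q)) (fun b => d b f)
        + tact (amp2 B * amp1 B) (fun t => Eucl.x N q t.1 * d t.2.1 (d t.2.2 f)) := by
  ext ⟨i, a, b⟩
  rw [tact_add, tact_mul, tact_mul, Pi.add_apply, Pi.add_apply, tact_cup23, tact_amp2, tact_amp2]
  simp only [tact_cup12, tact_amp1, h1, map_add, map_sum, map_smul, smul_add,
    Finset.sum_add_distrib]
  abel

/-- Existence of the differential calculus. -/
lemma exists_isCalculus : ∃ d, IsCalculus N q (z⁻¹ • R) d := by
  obtain ⟨φ, hφ⟩ := Eucl.exists_lift (leibnizOp (q := q) (z⁻¹ • R)) (leibnizOp_relation D)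
  have hfst : ∀ f : Eucl N q, (φ f (1, 0)).1 = f := by
    intro f
    induction f using Eucl.induction with
    | h1 => simp
    | hx j f hf =>
      rw [map_mul, hφ, Module.End.mul_apply]
      rw [leibnizOp_fst, hf]
    | hadd f g hf hg => rw [map_add, LinearMap.add_apply, Prod.fst_add, hf, hg]
    | hsmul c f hf => rw [map_smul, LinearMap.smul_apply, Prod.smul_fst, hf]
  -- The pair (1, 0) is the function 1 with its zero derivatives; acting on it by f gives f together
  -- with the derivatives of f.
  obtain ⟨d, hd⟩ : ∃ d : Fin N → (Eucl N q →ₗ[ℂ] Eucl N q), ∀ i f, d i f = (φ f (1, 0)).2 i :=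
    ⟨fun i => LinearMap.proj i ∘ₗ LinearMap.snd ℂ _ _ ∘ₗ (LinearMap.applyₗ (1, 0)) ∘ₗ φ.toLinearMap,
      fun i f => rfl⟩
  have h0 : ∀ i, d i 1 = 0 := fun i => by
    rw [hd, map_one φ]
    simp only [Module.End.one_apply, Pi.zero_apply]
  have h1 : ∀ i j f, d i (Eucl.x N q j * f) =
      metric N q i j • f + ∑ k, ∑ l, (z⁻¹ • R) (i, j) (k, l) • (Eucl.x N q k * d l f) := by
    intro i j f
    simp only [hd]
    rw [map_mul, hφ, Module.End.mul_apply, leibnizOp_snd, hfst]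
  refine ⟨d, h0, h1, fun i j f => ?_⟩
  -- The relation P⁻∂∂ = 0 is not built into the construction; it propagates from 1 to all products
  -- because P⁻ passes through R2R1.
  induction f using Eucl.induction generalizing i j with
  | h1 => simp [h0]
  | hx a f hf =>
    have h := congrFun (congrArg (tact (amp1 (projMinus N q))) (IsCalculus.two_leibniz h1 f)) (i, j, a)
    rw [tact_amp1] at h
    rw [h, tact_vec_add, ← tact_mul, D.proj_cup23, tact_zero_left, zero_add, ← tact_mul]
    have hc : amp1 (projMinus N q) * (amp2 (z⁻¹ • R) * amp1 (z⁻¹ • R))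
        = amp2 (z⁻¹ • R) * amp1 (z⁻¹ • R) * amp2 (projMinus N q) := by
      simp only [amp1_smul, amp2_smul, smul_mul_assoc, mul_smul_comm, D.amp1_proj_amp2_amp1]
    have hX : tact (amp2 (projMinus N q))
        (fun t : Fin N × Fin N × Fin N => Eucl.x N q t.1 * d t.2.1 (d t.2.2 f)) = 0 := by
      ext ⟨a, b, c⟩
      rw [tact_amp2]
      have h := congrArg (Eucl.x N q a * ·) (hf b c)
      simpa only [Finset.mul_sum, mul_smul_comm, mul_zero, Pi.zero_apply] using h
    rw [hc, tact_mul, hX, tact_zero]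
    rfl
  | hadd f g hf hg => simp only [map_add, smul_add, Finset.sum_add_distrib, hf, hg, add_zero]
  | hsmul c f hf =>
    have h := congrArg (c • ·) (hf i j)
    simpa only [map_smul, Finset.smul_sum, smul_comm c, smul_zero] using h

omit D in
lemma IsCalculus.unique {B : Matrix (Fin N × Fin N) (Fin N × Fin N) ℂ}
    {d e : Fin N → (Eucl N q →ₗ[ℂ] Eucl N q)} (hd : IsCalculus N q B d) (he : IsCalculus N q B e) :
    d = e := by
  have h : ∀ f : Eucl N q, ∀ i, d i f = e i f := by
    intro f
    induction f using Eucl.induction with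
    | h1 => intro i; rw [hd.map_one, he.map_one]
    | hx j f hf => intro i; rw [hd.leibniz, he.leibniz]; simp only [hf]
    | hadd f g hf hg => intro i; rw [map_add, map_add, hf, hg]
    | hsmul c f hf => intro i; rw [map_smul, map_smul, hf]
  funext i
  exact LinearMap.ext fun f => h f i

lemma existsUnique_isCalculus : ∃! d, IsCalculus N q (z⁻¹ • R) d := by
  obtain ⟨d, hd⟩ := exists_isCalculus D
  exact ⟨d, hd, fun e he => he.unique hd⟩

end Calculus

end QSphere

namespace QSphere

/-! ### Commutation of the Laplacian with r² and with the Euler operator. -/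

section Laplacian

variable {N : ℕ} {q : ℝ}

/-- The operator `g_{ij} x^i ∂^j`. -/
def euler (d : Fin N → (Eucl N q →ₗ[ℂ] Eucl N q)) : Eucl N q →ₗ[ℂ] Eucl N q :=
  ∑ i, ∑ j, metric N q i j • (LinearMap.mulLeft ℂ (Eucl.x N q i) ∘ₗ d j)

lemma euler_apply (d : Fin N → (Eucl N q →ₗ[ℂ] Eucl N q)) (f : Eucl N q) :
    euler d f = ∑ i, ∑ j, metric N q i j • (Eucl.x N q i * d j f) := by
  simp [euler, LinearMap.sum_apply]

lemma laplacian_apply (d : Fin N → (Eucl N q →ₗ[ℂ] Eucl N q)) (f : Eucl N q) :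
    laplacian d f = ∑ i, ∑ j, metric N q i j • d i (d j f) := by
  simp [laplacian, LinearMap.sum_apply]

lemma Eucl.radius_mul (f : Eucl N q) : Eucl.radius N q * f
    = ∑ i, ∑ j, metric N q i j • (Eucl.x N q i * (Eucl.x N q j * f)) := by
  simp only [Eucl.radius, Finset.sum_mul, smul_mul_assoc, mul_assoc]

/-- The constant in `∂^i r² = μ x^i + …` and `Δ x^i = μ ∂^i + …`. -/
def calcMu (z l : ℂ) : ℂ := 1 + z⁻¹ * l⁻¹

variable {R S : Matrix (Fin N × Fin N) (Fin N × Fin N) ℂ} {z l E : ℂ}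
  (D : BraidData (metric N q) (projMinus N q) R S z l E)
  {d : Fin N → (Eucl N q →ₗ[ℂ] Eucl N q)} (hd : IsCalculus N q (z⁻¹ • R) d)
include D hd

/-- Contraction of the two-fold Leibniz rule: the kink contributes z⁻¹l⁻¹ to the constant, and the
cap slides through two braidings at the cost of z⁻². -/
lemma d_radius (i : Fin N) (f : Eucl N q) : d i (Eucl.radius N q * f)
    = calcMu z l • (Eucl.x N q i * f) + z⁻¹ ^ 2 • (Eucl.radius N q * d i f) := by
  have h1 : d i (Eucl.radius N q * f) = tact (cap23 (metric N q)) (fun t : Fin N × Fin N × Fin N =>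
      d t.1 (Eucl.x N q t.2.1 * (Eucl.x N q t.2.2 * f))) i := by
    rw [tact_cap23, Eucl.radius_mul]
    simp only [map_sum, map_smul]
  have h2 : cap23 (metric N q) * (cup12 (metric N q) + amp1 (z⁻¹ • R) * cup23 (metric N q))
      = calcMu z l • 1 := by
    rw [Matrix.mul_add, cap23_mul_cup12 D.metric_mul, amp1_smul, Matrix.smul_mul, Matrix.mul_smul,
      D.cap23_amp1_cup23, smul_smul, calcMu, add_smul, one_smul]
  have h3 : cap23 (metric N q) * (amp1 (z⁻¹ • R) * amp2 (z⁻¹ • R))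
      = z⁻¹ ^ 2 • cap12 (metric N q) := by
    rw [amp1_smul, amp2_smul, smul_mul_assoc, mul_smul_comm, Matrix.mul_smul, Matrix.mul_smul,
      ← Matrix.mul_assoc, D.cap23_amp1_amp2, smul_smul, sq]
  rw [h1, IsCalculus.leibniz_two hd.leibniz, tact_vec_add, ← tact_mul, h2, ← tact_mul, h3, tact_smul,
    tact_smul, tact_one, Pi.add_apply, Pi.smul_apply, Pi.smul_apply, tact_cap12, Eucl.radius_mul]

lemma laplacian_x (k : Fin N) (f : Eucl N q) : laplacian d (Eucl.x N q k * f)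
    = calcMu z l • d k f + z⁻¹ ^ 2 • (Eucl.x N q k * laplacian d f) := by
  have h1 : laplacian d (Eucl.x N q k * f) = tact (cap12 (metric N q))
      (fun t : Fin N × Fin N × Fin N => d t.1 (d t.2.1 (Eucl.x N q t.2.2 * f))) k := by
    rw [tact_cap12, laplacian_apply]
  have h2 : cap12 (metric N q) * (cup23 (metric N q) + amp2 (z⁻¹ • R) * cup12 (metric N q))
      = calcMu z l • 1 := by
    rw [Matrix.mul_add, cap12_mul_cup23 D.metric_mul, amp2_smul, Matrix.smul_mul, Matrix.mul_smul,
      D.cap12_amp2_cup12, smul_smul, calcMu, add_smul, one_smul]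
  have h3 : cap12 (metric N q) * (amp2 (z⁻¹ • R) * amp1 (z⁻¹ • R))
      = z⁻¹ ^ 2 • cap23 (metric N q) := by
    rw [amp1_smul, amp2_smul, smul_mul_assoc, mul_smul_comm, Matrix.mul_smul, Matrix.mul_smul,
      ← Matrix.mul_assoc, D.cap12_amp2_amp1, smul_smul, sq]
  rw [h1, IsCalculus.two_leibniz hd.leibniz, tact_vec_add, ← tact_mul, h2, ← tact_mul, h3, tact_smul,
    tact_smul, tact_one, Pi.add_apply, Pi.smul_apply, Pi.smul_apply, tact_cap23, laplacian_apply]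
  simp only [Finset.mul_sum, mul_smul_comm]

lemma sum_metric_d_x (hN : 1 ≤ N) (f : Eucl N q) :
    ∑ i, ∑ j, metric N q i j • d i (Eucl.x N q j * f) = E • f + (z⁻¹ * l) • euler d f := by
  -- The identity lives on three factors, the third being a spectator; any index serves there, and N
  -- ≥ 1 provides one.
  have h1 := congrFun (congrArg (fun X => tact X (fun t : Fin N × Fin N × Fin N =>
    Eucl.x N q t.1 * d t.2.1 f)) D.cap12_amp1) ⟨0, hN⟩
  simp only [tact_mul, tact_smul, Pi.smul_apply, tact_cap12, tact_amp1] at h1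
  simp only [hd.leibniz, smul_add, Finset.sum_add_distrib, Matrix.smul_apply, smul_eq_mul, mul_smul]
  refine congrArg₂ (· + ·) ?_ ?_
  · rw [← D.norm]
    simp only [Finset.sum_smul, mul_smul]
  · rw [euler_apply, ← h1]
    simp only [Finset.smul_sum, smul_comm z⁻¹]

lemma laplacian_radius (hN : 1 ≤ N) (f : Eucl N q) : laplacian d (Eucl.radius N q * f)
    = (calcMu z l * E) • f + (calcMu z l * (z⁻¹ * l) + z⁻¹ ^ 2 * calcMu z l) • euler d f
      + z⁻¹ ^ 4 • (Eucl.radius N q * laplacian d f) := by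
  rw [laplacian_apply]
  simp only [d_radius D hd, map_add, map_smul, smul_add, Finset.sum_add_distrib]
  have e1 : ∑ i, ∑ j, metric N q i j • calcMu z l • d i (Eucl.x N q j * f)
      = calcMu z l • (E • f + (z⁻¹ * l) • euler d f) := by
    rw [← sum_metric_d_x D hd hN]
    simp only [Finset.smul_sum, smul_comm (calcMu z l)]
  have e2 : ∑ i, ∑ j, metric N q i j • z⁻¹ ^ 2 • calcMu z l • (Eucl.x N q i * d j f)
      = (z⁻¹ ^ 2 * calcMu z l) • euler d f := by
    rw [euler_apply]
    simp only [Finset.smul_sum, smul_smul]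
    refine Finset.sum_congr rfl fun a _ => Finset.sum_congr rfl fun b _ => ?_
    congr 1; ring
  have e3 : ∑ i, ∑ j, metric N q i j • z⁻¹ ^ 2 • z⁻¹ ^ 2 • (Eucl.radius N q * d i (d j f))
      = z⁻¹ ^ 4 • (Eucl.radius N q * laplacian d f) := by
    rw [laplacian_apply]
    simp only [Finset.smul_sum, Finset.mul_sum, mul_smul_comm, smul_smul]
    refine Finset.sum_congr rfl fun a _ => Finset.sum_congr rfl fun b _ => ?_
    congr 1; ring
  rw [e1, e2, e3]
  module

/-- The ∂^i satisfy the same quadratic relations as the x^i, so the proof that r² is central applies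
to Δ. -/
lemma laplacian_d (hN : 1 ≤ N) (hq : 0 < q) (k : Fin N) (f : Eucl N q) :
    laplacian d (d k f) = d k (laplacian d f) := by
  have h := (braidData hN hq).quadratic_comm (A := Module.End ℂ (Eucl N q)) (y := d)
    (central_ne_zero hN hq) (fun i j => LinearMap.ext fun f => by
      have := hd.comm i j f
      simpa [LinearMap.sum_apply, Module.End.mul_apply] using this) k
  have h' := LinearMap.congr_fun h f
  simpa [laplacian_apply, Module.End.mul_apply, LinearMap.sum_apply] using h'

lemma laplacian_euler (hN : 1 ≤ N) (hq : 0 < q) (f : Eucl N q) : laplacian d (euler d f)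
    = calcMu z l • laplacian d f + z⁻¹ ^ 2 • euler d (laplacian d f) := by
  conv_lhs => rw [euler_apply]
  simp only [map_sum, map_smul, laplacian_x D hd, laplacian_d D hd hN hq, smul_add,
    Finset.sum_add_distrib]
  refine congrArg₂ (· + ·) ?_ ?_
  · rw [laplacian_apply d f]
    simp only [Finset.smul_sum, smul_comm (calcMu z l)]
  · rw [euler_apply]
    simp only [Finset.smul_sum, smul_comm (z⁻¹ ^ 2)]

omit D in
lemma euler_one : euler d 1 = 0 := by
  rw [euler_apply]
  simp [hd.map_one]

omit D in
lemma laplacian_one : laplacian d 1 = 0 := by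
  rw [laplacian_apply]
  simp [hd.map_one]

omit D hd in
/-- The `q`-numbers `∑_{j<k} z^{-2j}`. -/
def qnum (z : ℂ) (k : ℕ) : ℂ := ∑ j ∈ Finset.range k, z⁻¹ ^ (2 * j)

omit D hd in
lemma qnum_succ' (z : ℂ) (k : ℕ) : qnum z (k + 1) = qnum z k + z⁻¹ ^ (2 * k) :=
  Finset.sum_range_succ _ _

omit D hd in
lemma laplacian_pow_succ_apply (m : ℕ) (f : Eucl N q) :
    (laplacian d ^ (m + 1)) f = laplacian d ((laplacian d ^ m) f) := by
  rw [pow_succ', Module.End.mul_apply]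

lemma laplacian_pow_euler (hN : 1 ≤ N) (hq : 0 < q) (m : ℕ) (f : Eucl N q) :
    (laplacian d ^ m) (euler d f)
      = (calcMu z l * qnum z m) • (laplacian d ^ m) f
        + z⁻¹ ^ (2 * m) • euler d ((laplacian d ^ m) f) := by
  induction m with
  | zero => simp [qnum]
  | succ m ih =>
    rw [laplacian_pow_succ_apply, ih, map_add, map_smul, map_smul, laplacian_euler D hd hN hq,
      ← laplacian_pow_succ_apply, qnum_succ' z m]
    module

omit D hd in
/-- The constants in `Δ^m (r² f) = c_m Δ^{m-1} f` for `f` of degree `2m - 2`. -/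
def lapConst (z l E : ℂ) : ℕ → ℂ
  | 0 => 0
  | m + 1 => calcMu z l * E
      + (calcMu z l * (z⁻¹ * l) + z⁻¹ ^ 2 * calcMu z l) * (calcMu z l * qnum z m)
      + z⁻¹ ^ 4 * lapConst z l E m

omit D hd in
lemma laplacian_pow_succ_apply' (m : ℕ) (f : Eucl N q) :
    (laplacian d ^ (m + 1)) f = (laplacian d ^ m) (laplacian d f) := by
  rw [pow_succ, Module.End.mul_apply]

/-- Applying one Δ to r² f gives f, the Euler operator on f, and r² Δf. Under Δ^m with constant
result the Euler term becomes a multiple of Δ^m f, since derivatives kill constants, and the last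
term is covered by induction. -/
lemma laplacian_pow_radius (hN : 1 ≤ N) (hq : 0 < q) (m : ℕ) (f : Eucl N q) (c : ℂ)
    (hf : (laplacian d ^ m) f = c • 1) :
    (laplacian d ^ (m + 1)) (Eucl.radius N q * f) = (lapConst z l E (m + 1) * c) • 1 := by
  induction m generalizing f with
  | zero =>
    have h0 : f = c • 1 := by simpa using hf
    rw [zero_add, pow_one, laplacian_radius D hd hN, h0, map_smul, map_smul, euler_one hd,
      laplacian_one hd, lapConst, lapConst, qnum]
    simp only [smul_zero, mul_zero, add_zero, smul_smul, Finset.range_zero, Finset.sum_empty]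
  | succ m ih =>
    rw [laplacian_pow_succ_apply', laplacian_radius D hd hN, map_add, map_add, map_smul, map_smul,
      map_smul, laplacian_pow_euler D hd hN hq, hf, map_smul, euler_one hd,
      ih (laplacian d f) (by rw [← laplacian_pow_succ_apply', hf]),
      show lapConst z l E (m + 1 + 1) = calcMu z l * E
        + (calcMu z l * (z⁻¹ * l) + z⁻¹ ^ 2 * calcMu z l) * (calcMu z l * qnum z (m + 1))
        + z⁻¹ ^ 4 * lapConst z l E (m + 1) from rfl]
    simp only [smul_zero, add_zero, smul_smul, ← add_smul]
    congr 1
    ring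

end Laplacian

/-- For positive parameters every summand of the recursion is nonnegative and the first is positive.
-/
lemma lapConst_succ_ne_zero {z l E : ℂ} {x y e : ℝ} (hx : 0 < x) (hy : 0 < y) (he : 0 < e)
    (hz : z = x) (hl : l = y) (hE : E = e) (m : ℕ) : lapConst z l E (m + 1) ≠ 0 := by
  subst hz hl hE
  have hq : ∀ m, ∃ a : ℝ, 0 ≤ a ∧ qnum (x : ℂ) m = a := fun m =>
    ⟨∑ j ∈ Finset.range m, x⁻¹ ^ (2 * j), by positivity, by simp [qnum]⟩
  have hmu : calcMu (x : ℂ) y = ((1 + x⁻¹ * y⁻¹ : ℝ) : ℂ) := by simp [calcMu]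
  have H : ∀ m, ∃ a : ℝ, 0 ≤ a ∧ lapConst (x : ℂ) y e m = a ∧ (1 ≤ m → 0 < a) := by
    intro m
    induction m with
    | zero => exact ⟨0, le_rfl, by simp [lapConst], by omega⟩
    | succ m ih =>
      obtain ⟨a, ha, h, -⟩ := ih
      obtain ⟨b, hb, h'⟩ := hq m
      have hp : 0 < (1 + x⁻¹ * y⁻¹) * e
        + ((1 + x⁻¹ * y⁻¹) * (x⁻¹ * y) + x⁻¹ ^ 2 * (1 + x⁻¹ * y⁻¹)) * ((1 + x⁻¹ * y⁻¹) * b)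
        + x⁻¹ ^ 4 * a := by positivity
      refine ⟨_, hp.le, ?_, fun _ => hp⟩
      rw [lapConst, h, h', hmu]
      push_cast
      ring
  obtain ⟨a, -, h, h'⟩ := H (m + 1)
  rw [h]
  exact_mod_cast (h' (by omega)).ne'

end QSphere

namespace QSphere

/-! ### Monomials, tensors as functions on words, and functionals. -/

section Words

variable {ι A : Type*} [Monoid A]

/-- The monomial `y_{i_1} ⋯ y_{i_n}`. -/
def word (y : ι → A) {n : ℕ} (i : Fin n → ι) : A := (List.ofFn fun k => y (i k)).prod

lemma word_eq_prod_map (y : ι → A) {n : ℕ} (i : Fin n → ι) :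
    word y i = ((List.ofFn i).map y).prod := by
  rw [List.map_ofFn]; rfl

lemma word_zero (y : ι → A) (i : Fin 0 → ι) : word y i = 1 := by simp [word]

lemma word_succ (y : ι → A) {n : ℕ} (i : Fin (n + 1) → ι) :
    word y i = y (i 0) * word y (Fin.tail i) := by
  simp [word, List.ofFn_succ, Fin.tail]

lemma ofFn_insertNth {n : ℕ} (l : Fin (n + 1)) (a : ι) (i : Fin n → ι) :
    List.ofFn (Fin.insertNth (α := fun _ => ι) l a i)
      = (List.ofFn i).take l ++ a :: (List.ofFn i).drop l := by
  induction n with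
  | zero =>
    obtain rfl : l = 0 := Fin.fin_one_eq_zero l
    rw [Fin.insertNth_zero', List.ofFn_cons]
    simp
  | succ n ih =>
    refine Fin.cases ?_ (fun l => ?_) l
    · rw [Fin.insertNth_zero', List.ofFn_cons]
      simp
    · rw [← Fin.cons_self_tail i, Fin.insertNth_succ_cons, List.ofFn_cons, ih, List.ofFn_cons]
      simp

lemma ofFn_insertNth_insertNth {n : ℕ} (l : Fin (n + 1)) (a b : ι) (i : Fin n → ι) :
    List.ofFn (Fin.insertNth (α := fun _ => ι) l.castSucc a
      (Fin.insertNth (α := fun _ => ι) l b i))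
      = (List.ofFn i).take l ++ a :: b :: (List.ofFn i).drop l := by
  have hl : ((List.ofFn i).take l).length = l := by
    simp only [List.length_take, List.length_ofFn]; omega
  rw [ofFn_insertNth, ofFn_insertNth, Fin.val_castSucc, List.take_left' hl, List.drop_left' hl]

lemma ofFn_update_update {n : ℕ} (l : ℕ) (hl : l + 1 < n) (a b : ι) (i : Fin n → ι) :
    List.ofFn (Function.update (Function.update i ⟨l, by omega⟩ a) ⟨l + 1, hl⟩ b)
      = (List.ofFn i).take l ++ a :: b :: (List.ofFn i).drop (l + 2) := by
  refine List.ext_getElem ?_ fun k h1 h2 => ?_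
  · simp; omega
  · simp only [List.getElem_ofFn, Function.update_apply, Fin.ext_iff, List.getElem_append,
      List.length_take, List.length_ofFn, List.getElem_take, List.getElem_cons, List.getElem_drop]
    grind

lemma ofFn_eq_take_cons_drop {n : ℕ} (l : ℕ) (hl : l + 1 < n) (i : Fin n → ι) :
    List.ofFn i = (List.ofFn i).take l ++ i ⟨l, by omega⟩ :: i ⟨l + 1, hl⟩
      :: (List.ofFn i).drop (l + 2) := by
  rw [← ofFn_update_update l hl]
  simp

end Words

variable {N : ℕ} {q : ℝ}

/-- As a function on words a tensor has its neighbouring positions displayed in u ++ k :: l :: v,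
which avoids updates of finite index families. -/
lemma isSymmetric_of_list (c : List (Fin N) → ℂ)
    (hc : ∀ u v i j, ∑ k, ∑ l, projMinus N q (i, j) (k, l) * c (u ++ k :: l :: v) = 0) {n : ℕ} :
    IsSymmetric q (fun i : Fin n → Fin N => c (List.ofFn i)) := by
  intro l hl i
  simp only [ofFn_update_update]
  exact hc _ _ _ _

lemma contract_list (c : List (Fin N) → ℂ) {n : ℕ} (l : Fin (n + 1)) (i : Fin n → Fin N) :
    contract q l (fun i => c (List.ofFn i)) i
      = ∑ a, ∑ b, metric N q a b *
        c ((List.ofFn i).take l ++ a :: b :: (List.ofFn i).drop l) := by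
  simp only [contract, ofFn_insertNth_insertNth]

section Relations

variable {A : Type*} [Ring A] [Algebra ℂ A] {y : Fin N → A}
  (hy : ∀ i j, ∑ k, ∑ l, projMinus N q (i, j) (k, l) • (y k * y l) = 0)
include hy

lemma isSymmetric_functional (φ : A →ₗ[ℂ] ℂ) {n : ℕ} :
    IsSymmetric q (fun i : Fin n → Fin N => φ (word y i)) := by
  simp only [word_eq_prod_map]
  refine isSymmetric_of_list (fun L => φ (L.map y).prod) fun u v i j => ?_
  have h := congrArg (fun t => φ ((u.map y).prod * t * (v.map y).prod)) (hy i j)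
  simpa [Finset.mul_sum, Finset.sum_mul, mul_assoc] using h

omit hy in
-- The contraction inserts the quadratic element in the middle of a monomial, and commutation brings
-- it to the front; so all contractions of neighbours agree.
lemma contract_functional (φ : A →ₗ[ℂ] ℂ) {n : ℕ}
    (hr : ∀ k, Commute (∑ a, ∑ b, metric N q a b • (y a * y b)) (y k))
    (l : Fin (n + 1)) (i : Fin n → Fin N) :
    contract q l (fun i => φ (word y i)) i
      = φ ((∑ a, ∑ b, metric N q a b • (y a * y b)) * word y i) := by
  have hc : ∀ L : List (Fin N), Commute (∑ a, ∑ b, metric N q a b • (y a * y b)) (L.map y).prod :=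
    fun L => Commute.list_prod_right _ _ (by
      intro t ht
      obtain ⟨k, -, rfl⟩ := List.mem_map.1 ht
      exact hr k)
  simp only [word_eq_prod_map]
  rw [contract_list (fun L => φ (L.map y).prod)]
  conv_rhs => rw [← List.take_append_drop l (List.ofFn i), List.map_append, List.prod_append,
    ← mul_assoc, (hc _).eq]
  simp [Finset.mul_sum, Finset.sum_mul, mul_assoc]

end Relations

/-! ### Analytic dependence on q and the normalized tensors. -/

section Analytic

lemma analyticOnNhd_ofReal : AnalyticOnNhd ℝ (fun q : ℝ => (q : ℂ)) (Set.Ioi 0) :=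
  fun q _ => Complex.ofRealCLM.analyticAt q

lemma analyticOnNhd_ofReal_inv : AnalyticOnNhd ℝ (fun q : ℝ => (q : ℂ)⁻¹) (Set.Ioi 0) :=
  analyticOnNhd_ofReal.inv fun _ hq => ofReal_ne_zero_of_pos hq

lemma analyticOnNhd_qpow (a : ℝ) : AnalyticOnNhd ℝ (fun q => qpow q a) (Set.Ioi 0) := by
  intro q hq
  have h : AnalyticAt ℝ (fun q : ℝ => ((Real.exp (Real.log q * a) : ℝ) : ℂ)) q :=
    (Complex.ofRealCLM.analyticAt _).comp
      (AnalyticAt.rexp' ((analyticAt_log hq).mul analyticAt_const))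
  refine h.congr ?_
  filter_upwards [Ioi_mem_nhds hq] with t ht
  rw [qpow, Real.rpow_def_of_pos ht]

lemma analyticOnNhd_finset_sum {ι : Type*} (s : Finset ι) {f : ι → ℝ → ℂ} {U : Set ℝ}
    (h : ∀ i ∈ s, AnalyticOnNhd ℝ (f i) U) : AnalyticOnNhd ℝ (fun q => ∑ i ∈ s, f i q) U :=
  fun q hq => Finset.analyticAt_fun_sum s fun i hi => h i hi q hq

lemma analyticOnNhd_metric (i j : Fin N) :
    AnalyticOnNhd ℝ (fun q => metric N q i j) (Set.Ioi 0) := by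
  by_cases h : j = i.rev
  · simpa [metric, h] using analyticOnNhd_qpow (-rho N i)
  · simpa [metric, h] using analyticOnNhd_const

lemma analyticOnNhd_metricSq : AnalyticOnNhd ℝ (fun q => metricSq N q) (Set.Ioi 0) :=
  analyticOnNhd_finset_sum _ fun i _ => analyticOnNhd_finset_sum _ fun j _ =>
    (analyticOnNhd_metric i j).mul (analyticOnNhd_metric i j)

lemma analyticOnNhd_braid (i j : Fin N × Fin N) :
    AnalyticOnNhd ℝ (fun q => braid N q i j) (Set.Ioi 0) := by
  have hs := analyticOnNhd_ofReal.sub analyticOnNhd_ofReal_inv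
  simp only [braid, rMatrix, Matrix.of_apply]
  refine (AnalyticOnNhd.add ?_ ?_).sub ?_
  · split_ifs
    exacts [analyticOnNhd_const, analyticOnNhd_ofReal, analyticOnNhd_ofReal_inv,
      analyticOnNhd_const, analyticOnNhd_const]
  · split_ifs
    exacts [hs, analyticOnNhd_const]
  · split_ifs
    exacts [hs.mul (analyticOnNhd_qpow _), analyticOnNhd_const]

lemma analyticOnNhd_braidInv (i j : Fin N × Fin N) :
    AnalyticOnNhd ℝ (fun q => braidInv N q i j) (Set.Ioi 0) := by
  have hs := analyticOnNhd_ofReal.sub analyticOnNhd_ofReal_inv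
  simp only [braidInv, qgap, Matrix.add_apply, Matrix.sub_apply, Matrix.smul_apply,
    smul_eq_mul]
  exact ((analyticOnNhd_braid i j).sub (hs.mul analyticOnNhd_const)).add
    (hs.mul ((analyticOnNhd_metric _ _).mul (analyticOnNhd_metric _ _)))

end Analytic

/-- A family of differential calculi depending analytically on `q`. -/
structure CalcFamily (N : ℕ) (R S : ℝ → Matrix (Fin N × Fin N) (Fin N × Fin N) ℂ) (z l : ℝ → ℂ)
    (d : (q : ℝ) → Fin N → (Eucl N q →ₗ[ℂ] Eucl N q)) : Prop where
  data : ∀ q, 0 < q → BraidData (metric N q) (projMinus N q) (R q) (S q) (z q) (l q) (metricSq N q)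
  isCalculus : ∀ q, 0 < q → IsCalculus N q ((z q)⁻¹ • R q) (d q)
  pos : ∀ q, 0 < q → ∃ x y : ℝ, 0 < x ∧ 0 < y ∧ z q = x ∧ l q = y
  analytic_matrix : ∀ i j, AnalyticOnNhd ℝ (fun q => R q i j) (Set.Ioi 0)
  analytic_z : AnalyticOnNhd ℝ z (Set.Ioi 0)
  analytic_l : AnalyticOnNhd ℝ l (Set.Ioi 0)

/-- Families of elements of quantum Euclidean space that are homogeneous of a given degree, with
coefficients depending analytically on `q`. -/
inductive HomFamily (N : ℕ) : ℕ → ((q : ℝ) → Eucl N q) → Prop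
  | one : HomFamily N 0 fun _ => 1
  | zero (n : ℕ) : HomFamily N n fun _ => 0
  | x_mul {n : ℕ} {F : (q : ℝ) → Eucl N q} (i : Fin N) :
      HomFamily N n F → HomFamily N (n + 1) fun q => Eucl.x N q i * F q
  | add {n : ℕ} {F G : (q : ℝ) → Eucl N q} :
      HomFamily N n F → HomFamily N n G → HomFamily N n fun q => F q + G q
  | smul {n : ℕ} {F : (q : ℝ) → Eucl N q} {c : ℝ → ℂ} :
      AnalyticOnNhd ℝ c (Set.Ioi 0) → HomFamily N n F → HomFamily N n fun q => c q • F q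
  | congr {n : ℕ} {F G : (q : ℝ) → Eucl N q} :
      HomFamily N n F → (∀ q, 0 < q → F q = G q) → HomFamily N n G

namespace HomFamily

lemma sum {ι : Type*} (s : Finset ι) {n : ℕ} {F : ι → (q : ℝ) → Eucl N q}
    (h : ∀ i ∈ s, HomFamily N n (F i)) : HomFamily N n fun q => ∑ i ∈ s, F i q := by
  classical
  induction s using Finset.induction_on with
  | empty => simpa using zero n
  | insert a s ha ih =>
    simp only [Finset.sum_insert ha]
    exact (h a (Finset.mem_insert_self _ _)).add
      (ih fun i hi => h i (Finset.mem_insert_of_mem hi))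

lemma word {n : ℕ} (i : Fin n → Fin N) : HomFamily N n fun q => word (Eucl.x N q) i := by
  induction n with
  | zero => simpa only [word_zero] using one
  | succ n ih => simpa only [word_succ] using x_mul _ (ih (Fin.tail i))

/-- The algebra itself varies with q, so analyticity has a meaning only for coefficients; in degree
zero a family is a scalar and this coefficient can be extracted. -/
lemma degree_zero {F : (q : ℝ) → Eucl N q} (h : HomFamily N 0 F) :
    ∃ c : ℝ → ℂ, AnalyticOnNhd ℝ c (Set.Ioi 0) ∧ ∀ q, 0 < q → F q = c q • 1 := by
  generalize hn : 0 = n at h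
  induction h with
  | one => exact ⟨fun _ => 1, analyticOnNhd_const, by simp⟩
  | zero n => exact ⟨fun _ => 0, analyticOnNhd_const, by simp⟩
  | x_mul i h ih => omega
  | add _ _ ih1 ih2 =>
    obtain ⟨c, hc, h⟩ := ih1 hn
    obtain ⟨c', hc', h'⟩ := ih2 hn
    exact ⟨fun q => c q + c' q, hc.add hc', fun q hq => by simp only [h q hq, h' q hq, add_smul]⟩
  | smul hc _ ih =>
    obtain ⟨c, hc', h⟩ := ih hn
    exact ⟨_, hc.mul hc', fun q hq => by simp only [h q hq, mul_smul]⟩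
  | congr _ h ih =>
    obtain ⟨c, hc', h'⟩ := ih hn
    exact ⟨c, hc', fun q hq => by rw [← h q hq, h' q hq]⟩

end HomFamily

namespace CalcFamily

variable {R S : ℝ → Matrix (Fin N × Fin N) (Fin N × Fin N) ℂ} {z l : ℝ → ℂ}
  {d : (q : ℝ) → Fin N → (Eucl N q →ₗ[ℂ] Eucl N q)} (C : CalcFamily N R S z l d)
include C

lemma z_ne_zero {q : ℝ} (hq : 0 < q) : z q ≠ 0 := (C.data q hq).q_ne

lemma analytic_z_inv : AnalyticOnNhd ℝ (fun q => (z q)⁻¹) (Set.Ioi 0) :=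
  C.analytic_z.inv fun _ hq => C.z_ne_zero hq

lemma analytic_l_inv : AnalyticOnNhd ℝ (fun q => (l q)⁻¹) (Set.Ioi 0) :=
  C.analytic_l.inv fun q hq => (C.data q hq).l_ne

/-- The two statements are proved together: in the Leibniz rule for x^i f with f of degree zero, the
derivative of f has no degree of its own and must be known to vanish. -/
lemma homFamily_d_aux {n : ℕ} {F : (q : ℝ) → Eucl N q} (h : HomFamily N n F) :
    (n = 0 → ∀ a q, 0 < q → d q a (F q) = 0) ∧
      ∀ m, n = m + 1 → ∀ a, HomFamily N m fun q => d q a (F q) := by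
  induction h with
  | one => exact ⟨fun _ a q hq => (C.isCalculus q hq).map_one a, by omega⟩
  | zero n => exact ⟨by simp, fun m _ a => by simpa using HomFamily.zero m⟩
  | @x_mul n F i h ih =>
    refine ⟨by omega, fun m hm a => ?_⟩
    obtain rfl : n = m := by omega
    have h1 : HomFamily N n fun q => metric N q a i • F q + ∑ k, ∑ b,
        ((z q)⁻¹ * R q (a, i) (k, b)) • (Eucl.x N q k * d q b (F q)) := by
      refine (h.smul (analyticOnNhd_metric a i)).add (HomFamily.sum _ fun k _ =>
        HomFamily.sum _ fun b _ =>
          HomFamily.smul (C.analytic_z_inv.mul (C.analytic_matrix _ _)) ?_)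
      cases n with
      | zero => exact (HomFamily.zero 0).congr fun q hq => by rw [ih.1 rfl b q hq, mul_zero]
      | succ n => exact HomFamily.x_mul k (ih.2 n rfl b)
    exact h1.congr fun q hq => by
      rw [(C.isCalculus q hq).leibniz]; simp only [Matrix.smul_apply, smul_eq_mul]
  | add _ _ ih1 ih2 =>
    exact ⟨fun hn a q hq => by rw [map_add, ih1.1 hn a q hq, ih2.1 hn a q hq, add_zero],
      fun m hm a => by simpa only [map_add] using (ih1.2 m hm a).add (ih2.2 m hm a)⟩
  | smul hc _ ih =>
    exact ⟨fun hn a q hq => by rw [map_smul, ih.1 hn a q hq, smul_zero],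
      fun m hm a => by simpa only [map_smul] using HomFamily.smul hc (ih.2 m hm a)⟩
  | congr _ h ih =>
    exact ⟨fun hn a q hq => by rw [← h q hq, ih.1 hn a q hq],
      fun m hm a => (ih.2 m hm a).congr fun q hq => by rw [h q hq]⟩

lemma homFamily_laplacian {n : ℕ} {F : (q : ℝ) → Eucl N q} (h : HomFamily N (n + 2) F) :
    HomFamily N n fun q => laplacian (d q) (F q) := by
  simp only [laplacian_apply]
  exact HomFamily.sum _ fun a _ => HomFamily.sum _ fun b _ => HomFamily.smul
    (analyticOnNhd_metric a b) ((C.homFamily_d_aux ((C.homFamily_d_aux h).2 _ rfl b)).2 _ rfl a)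

lemma homFamily_laplacian_pow (m : ℕ) {F : (q : ℝ) → Eucl N q} (h : HomFamily N (2 * m) F) :
    HomFamily N 0 fun q => (laplacian (d q) ^ m) (F q) := by
  induction m generalizing F with
  | zero => simpa using h
  | succ m ih =>
    simp only [laplacian_pow_succ_apply']
    exact ih (C.homFamily_laplacian h)

end CalcFamily

/-- The augmentation `x ↦ 0` of quantum Euclidean space. -/
lemma Eucl.exists_augmentation (N : ℕ) (q : ℝ) :
    ∃ φ : Eucl N q →ₐ[ℂ] ℂ, ∀ j, φ (Eucl.x N q j) = 0 :=
  Eucl.exists_lift (fun _ => 0) (by simp)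

/-- The augmentation `x ↦ 0` of quantum Euclidean space. -/
def Eucl.aug (N : ℕ) (q : ℝ) : Eucl N q →ₐ[ℂ] ℂ := (Eucl.exists_augmentation N q).choose

/-- The product of the constants in `Δ^m (r^{2m}) = const`. -/
def lapNorm (z l E : ℂ) (m : ℕ) : ℂ := ∏ k ∈ Finset.range m, lapConst z l E (k + 1)

/-- The tensor `Δ^{n/2} (x^{i_1} ⋯ x^{i_n})`, normalized to have full contraction `1`. -/
def lapTensor {N : ℕ} (z l : ℝ → ℂ) (d : (q : ℝ) → Fin N → (Eucl N q →ₗ[ℂ] Eucl N q)) (n : ℕ)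
    (q : ℝ) : QTensor N n := fun i =>
  (lapNorm (z q) (l q) (metricSq N q) (n / 2))⁻¹ *
    Eucl.aug N q ((laplacian (d q) ^ (n / 2)) (word (Eucl.x N q) i))

namespace CalcFamily

variable {R S : ℝ → Matrix (Fin N × Fin N) (Fin N × Fin N) ℂ} {z l : ℝ → ℂ}
  {d : (q : ℝ) → Fin N → (Eucl N q →ₗ[ℂ] Eucl N q)} (C : CalcFamily N R S z l d)
include C

lemma lapConst_ne_zero (hN : 1 ≤ N) (hq : 0 < q) (m : ℕ) :
    lapConst (z q) (l q) (metricSq N q) (m + 1) ≠ 0 := by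
  obtain ⟨x, y, hx, hy, h1, h2⟩ := C.pos q hq
  exact lapConst_succ_ne_zero hx hy (rpow_sq_sum_pos hN hq) h1 h2 (metricSq_eq_ofReal hq) m

lemma lapNorm_ne_zero (hN : 1 ≤ N) (hq : 0 < q) (m : ℕ) :
    lapNorm (z q) (l q) (metricSq N q) m ≠ 0 :=
  Finset.prod_ne_zero_iff.2 fun k _ => C.lapConst_ne_zero hN hq k

lemma analytic_lapConst (m : ℕ) :
    AnalyticOnNhd ℝ (fun q => lapConst (z q) (l q) (metricSq N q) m) (Set.Ioi 0) := by
  have hmu : AnalyticOnNhd ℝ (fun q => calcMu (z q) (l q)) (Set.Ioi 0) :=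
    analyticOnNhd_const.add (C.analytic_z_inv.mul C.analytic_l_inv)
  induction m with
  | zero => exact analyticOnNhd_const
  | succ m ih =>
    have hnum : AnalyticOnNhd ℝ (fun q => qnum (z q) m) (Set.Ioi 0) :=
      analyticOnNhd_finset_sum _ fun j _ => C.analytic_z_inv.pow _
    exact ((hmu.mul analyticOnNhd_metricSq).add (((hmu.mul (C.analytic_z_inv.mul C.analytic_l)).add
      ((C.analytic_z_inv.pow 2).mul hmu)).mul (hmu.mul hnum))).add ((C.analytic_z_inv.pow 4).mul ih)

lemma analytic_lapNorm_inv (hN : 1 ≤ N) (m : ℕ) :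
    AnalyticOnNhd ℝ (fun q => (lapNorm (z q) (l q) (metricSq N q) m)⁻¹) (Set.Ioi 0) := by
  have h : AnalyticOnNhd ℝ (fun q => lapNorm (z q) (l q) (metricSq N q) m) (Set.Ioi 0) := by
    intro q hq
    exact Finset.analyticAt_fun_prod _ fun k _ => C.analytic_lapConst (k + 1) q hq
  exact h.inv fun q hq => C.lapNorm_ne_zero hN hq m

lemma laplacian_word {n : ℕ} (hn : Even n) (i : Fin n → Fin N) : ∃ c : ℝ → ℂ,
    AnalyticOnNhd ℝ c (Set.Ioi 0) ∧
      ∀ q, 0 < q → (laplacian (d q) ^ (n / 2)) (word (Eucl.x N q) i) = c q • 1 := by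
  obtain ⟨m, hm⟩ := hn
  obtain rfl : n = 2 * m := by omega
  rw [Nat.mul_div_cancel_left m two_pos]
  exact (C.homFamily_laplacian_pow m (HomFamily.word i)).degree_zero

lemma laplacian_word_eq (hN : 1 ≤ N) (hq : 0 < q) {n : ℕ} (hn : Even n) (i : Fin n → Fin N) :
    (laplacian (d q) ^ (n / 2)) (word (Eucl.x N q) i)
      = (lapNorm (z q) (l q) (metricSq N q) (n / 2) * lapTensor z l d n q i) • 1 := by
  obtain ⟨c, -, h⟩ := C.laplacian_word hn i
  rw [lapTensor, mul_inv_cancel_left₀ (C.lapNorm_ne_zero hN hq _), h q hq]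
  simp

lemma analytic_lapTensor (hN : 1 ≤ N) {n : ℕ} (hn : Even n) :
    AnalyticOnNhd ℝ (lapTensor z l d n) (Set.Ioi 0) := by
  refine AnalyticOnNhd.pi fun i => ?_
  obtain ⟨c, hc, h⟩ := C.laplacian_word hn i
  intro q hq
  refine ((C.analytic_lapNorm_inv hN (n / 2)).mul hc q hq).congr ?_
  filter_upwards [Ioi_mem_nhds hq] with t ht
  rw [lapTensor, h t ht]
  simp

omit C in
lemma isSymmetric_lapTensor (n : ℕ) : IsSymmetric q (lapTensor z l d n q) :=
  isSymmetric_functional (Eucl.x_relation (N := N) (q := q)) ((lapNorm (z q) (l q) (metricSq N q) (n / 2))⁻¹ •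
    (Eucl.aug N q).toLinearMap ∘ₗ (laplacian (d q) ^ (n / 2)))

omit C in
lemma lapTensor_zero : lapTensor z l d 0 q = 1 := by
  funext i
  simp [lapTensor, lapNorm, word_zero]

/-- Contraction inserts the central element r², and by `laplacian_pow_radius` this costs the one
factor of `lapNorm` by which the two normalizations differ. -/
lemma contract_lapTensor (hN : 1 ≤ N) (hq : 0 < q) {n : ℕ} (hn : Even n) (a : Fin (n + 1)) :
    contract q a (lapTensor z l d (n + 2) q) = lapTensor z l d n q := by
  funext i
  have h := contract_functional (y := Eucl.x N q) (q := q) ((lapNorm (z q) (l q) (metricSq N q) ((n + 2) / 2))⁻¹ •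
    (Eucl.aug N q).toLinearMap ∘ₗ (laplacian (d q) ^ ((n + 2) / 2)))
    (Eucl.radius_comm hN hq) a i
  refine Eq.trans h ?_
  have h2 : (n + 2) / 2 = n / 2 + 1 := by omega
  have h3 := laplacian_pow_radius (C.data q hq) (C.isCalculus q hq) hN hq (n / 2) _ _
    (C.laplacian_word_eq hN hq hn i)
  rw [h2]
  show (lapNorm (z q) (l q) (metricSq N q) (n / 2 + 1))⁻¹ *
    Eucl.aug N q ((laplacian (d q) ^ (n / 2 + 1)) (Eucl.radius N q * word (Eucl.x N q) i)) = _
  rw [h3, map_smul, map_one, smul_eq_mul, mul_one, lapNorm, Finset.prod_range_succ, ← lapNorm]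
  have h4 := C.lapConst_ne_zero hN hq (n / 2)
  have h5 := C.lapNorm_ne_zero hN hq (n / 2)
  field_simp

end CalcFamily

end QSphere

/-! ### Relations in the algebra O_q(N). -/

namespace QSphere

lemma matrix_mul_eq_one_of_commute {n B : Type*} [Fintype n] [DecidableEq n] [Ring B]
    (h : ∀ a b : B, a * b = b * a) {X Y : Matrix n n B} (hXY : X * Y = 1) : Y * X = 1 := by
  let _ : CommRing B := { ‹Ring B› with mul_comm := h }
  exact mul_eq_one_comm.1 hXY

lemma sum_fun_fin_succ {V M : Type*} [Fintype V] [AddCommMonoid M] {n : ℕ}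
    (f : (Fin (n + 1) → V) → M) :
    ∑ j, f j = ∑ a, ∑ j : Fin n → V, f (Fin.cons a j) := by
  rw [← Fintype.sum_prod_type']
  exact (Fintype.sum_equiv (Fin.consEquiv fun _ => V) _ _ fun _ => rfl).symm

lemma sum_four_comm {V M : Type*} [Fintype V] [AddCommMonoid M] (f : V → V → V → V → M) :
    ∑ a, ∑ b, ∑ c, ∑ d, f a b c d = ∑ c, ∑ d, ∑ a, ∑ b, f a b c d := by
  simp only [← Fintype.sum_prod_type' (f := fun a b => f _ _ a b)]
  simp only [← Fintype.sum_prod_type' (f := fun a b => ∑ p : V × V, f a b p.1 p.2)]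
  rw [Finset.sum_comm]
  simp only [Fintype.sum_prod_type]

variable {N : ℕ} {q : ℝ}

namespace Oq

lemma A_rtt (i k j l : Fin N) :
    ∑ m, ∑ n, braid N q (i, k) (m, n) • (A N q m j * A N q n l)
      = ∑ n, ∑ m, braid N q (n, m) (j, l) • (A N q i n * A N q k m) := by
  have h := RingQuot.mkAlgHom_rel ℂ (OqRel.rtt (N := N) (q := q) i k j l)
  simp only [map_sum, map_smul, map_mul] at h
  exact h

lemma A_metric (k l : Fin N) : ∑ i, ∑ j, metric N q i j • (A N q i k * A N q j l)
    = algebraMap ℂ (Oq N q) (metric N q k l) := by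
  have h := RingQuot.mkAlgHom_rel ℂ (OqRel.metric (N := N) (q := q) k l)
  simp only [map_sum, map_smul, map_mul, AlgHom.commutes] at h
  exact h

lemma exists_lift {B : Type*} [Semiring B] [Algebra ℂ B] (M : Fin N → Fin N → B)
    (h1 : ∀ i k j l, ∑ m, ∑ n, braid N q (i, k) (m, n) • (M m j * M n l)
      = ∑ n, ∑ m, braid N q (n, m) (j, l) • (M i n * M k m))
    (h2 : ∀ k l, ∑ i, ∑ j, metric N q i j • (M i k * M j l) = algebraMap ℂ B (metric N q k l)) :
    ∃ φ : Oq N q →ₐ[ℂ] B, ∀ i j, φ (A N q i j) = M i j := by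
  have h : ∀ ⦃a b⦄, OqRel N q a b → FreeAlgebra.lift ℂ (fun p : Fin N × Fin N => M p.1 p.2) a
      = FreeAlgebra.lift ℂ (fun p : Fin N × Fin N => M p.1 p.2) b := by
    rintro _ _ (⟨i, k, j, l⟩ | ⟨k, l⟩)
    · simpa only [map_sum, map_smul, map_mul, FreeAlgebra.lift_ι_apply] using h1 i k j l
    · simpa only [map_sum, map_smul, map_mul, FreeAlgebra.lift_ι_apply, AlgHom.commutes]
        using h2 k l
  refine ⟨RingQuot.liftAlgHom ℂ ⟨FreeAlgebra.lift ℂ _, h⟩, fun i j => ?_⟩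
  rw [A, RingQuot.liftAlgHom_mkAlgHom_apply, FreeAlgebra.lift_ι_apply]

/-- The matrix `A^i_j A^k_l`. -/
def AA (N : ℕ) (q : ℝ) : Matrix (Fin N × Fin N) (Fin N × Fin N) (Oq N q) :=
  Matrix.of fun p r => A N q p.1 r.1 * A N q p.2 r.2

/-- Scalar matrices as matrices over `O_q(N)`. -/
def scalar (N : ℕ) (q : ℝ) : Matrix (Fin N × Fin N) (Fin N × Fin N) ℂ →ₐ[ℂ]
    Matrix (Fin N × Fin N) (Fin N × Fin N) (Oq N q) := (Algebra.ofId ℂ (Oq N q)).mapMatrix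

lemma scalar_apply (X : Matrix (Fin N × Fin N) (Fin N × Fin N) ℂ) (p r : Fin N × Fin N) :
    scalar N q X p r = algebraMap ℂ (Oq N q) (X p r) := rfl

lemma scalar_mul_AA (X : Matrix (Fin N × Fin N) (Fin N × Fin N) ℂ) (i k j l : Fin N) :
    (scalar N q X * AA N q) (i, k) (j, l) = ∑ m, ∑ n, X (i, k) (m, n) • (A N q m j * A N q n l) := by
  simp only [Matrix.mul_apply, Fintype.sum_prod_type, scalar_apply, AA, Matrix.of_apply,
    Algebra.smul_def]

lemma AA_mul_scalar (X : Matrix (Fin N × Fin N) (Fin N × Fin N) ℂ) (i k j l : Fin N) :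
    (AA N q * scalar N q X) (i, k) (j, l) = ∑ n, ∑ m, X (n, m) (j, l) • (A N q i n * A N q k m) := by
  simp only [Matrix.mul_apply, Fintype.sum_prod_type, scalar_apply, AA, Matrix.of_apply,
    Algebra.smul_def, Algebra.commutes]

lemma commute_braid : Commute (scalar N q (braid N q)) (AA N q) := by
  refine Matrix.ext fun ⟨i, k⟩ ⟨j, l⟩ => ?_
  rw [scalar_mul_AA, AA_mul_scalar, A_rtt]

lemma commute_braidInv (hq : 0 < q) : Commute (scalar N q (braidInv N q)) (AA N q) := by
  have h1 : scalar N q (braid N q) * scalar N q (braidInv N q) = 1 := by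
    rw [← map_mul, braid_mul_braidInv hq, map_one]
  have h2 : scalar N q (braidInv N q) * scalar N q (braid N q) = 1 := by
    rw [← map_mul, braidInv_mul_braid hq, map_one]
  have h := congrArg (fun t => scalar N q (braidInv N q) * t * scalar N q (braidInv N q))
    (commute_braid (N := N) (q := q)).eq
  simp only [← mul_assoc, h2, one_mul] at h
  rw [mul_assoc _ _ (scalar N q (braidInv N q)), h1, mul_one] at h
  exact h.symm

lemma rankOne_mul_AA : scalar N q (rankOne (metric N q)) * AA N q
    = scalar N q (rankOne (metric N q)) := by
  refine Matrix.ext fun ⟨i, k⟩ ⟨j, l⟩ => ?_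
  rw [scalar_mul_AA, scalar_apply]
  simp only [rankOne, Matrix.of_apply, mul_smul, ← Finset.smul_sum, A_metric, map_mul]
  rw [Algebra.smul_def]

/-- At q = 1 the braid matrix is the flip, and the first defining relation says that the generators
commute. -/
lemma mul_comm_of_one (a b : Oq N 1) : a * b = b * a := by
  have hA : ∀ i k j l, A N 1 k j * A N 1 i l = A N 1 i l * A N 1 k j := by
    intro i k j l
    have h := A_rtt (q := 1) i k j l
    simpa [braid, rMatrix, Finset.sum_ite_eq, ite_and] using h
  have hind : ∀ {p : Oq N 1 → Prop}, p 1 → (∀ (j : Fin N × Fin N) f, p f → p (A N 1 j.1 j.2 * f)) →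
      (∀ f g, p f → p g → p (f + g)) → (∀ (c : ℂ) f, p f → p (c • f)) → ∀ f, p f :=
    fun h1 h2 h3 h4 f => freeAlgebra_quotient_induction (RingQuot.mkAlgHom ℂ (OqRel N 1))
      (RingQuot.mkAlgHom_surjective ℂ _) h1 h2 h3 h4 f
  refine hind (p := fun a => a * b = b * a) (by simp) (fun i f hf => ?_) (fun f g hf hg => ?_)
    (fun c f hf => ?_) a
  · have hb : A N 1 i.1 i.2 * b = b * A N 1 i.1 i.2 := by
      refine hind (p := fun b => A N 1 i.1 i.2 * b = b * A N 1 i.1 i.2) (by simp) (fun j f hf => ?_)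
        (fun f g hf hg => ?_) (fun c f hf => ?_) b
      · rw [← mul_assoc, hA j.1 i.1 i.2 j.2, mul_assoc, hf, mul_assoc]
      · rw [mul_add, hf, hg, add_mul]
      · rw [mul_smul_comm, hf, smul_mul_assoc]
    rw [mul_assoc, hf, ← mul_assoc, hb, mul_assoc]
  · rw [add_mul, hf, hg, mul_add]
  · rw [smul_mul_assoc, hf, mul_smul_comm]

/-- The metric relation with upper indices is not among the defining relations. For q ≠ 1 the rank
one matrix is a combination of 1, R̂ and R̂⁻¹, hence commutes with AA. At q = 1 this fails, but the
algebra is commutative, and the left inverse of the matrix A supplied by the metric is also a right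
inverse. -/
lemma A_cup (hN : 1 ≤ N) (hq : 0 < q) (i j : Fin N) :
    ∑ k, ∑ l, metric N q k l • (A N q i k * A N q j l)
      = algebraMap ℂ (Oq N q) (metric N q i j) := by
  by_cases h1 : q = 1
  · subst h1
    set g : Matrix (Fin N) (Fin N) (Oq N 1) := (metric N 1).map (algebraMap ℂ (Oq N 1))
    set a : Matrix (Fin N) (Fin N) (Oq N 1) := Matrix.of (A N 1)
    have hgg : g * g = 1 := by
      rw [← Matrix.map_mul, metric_mul_self N hq]
      exact Matrix.map_one _ (map_zero _) (map_one _)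
    have e1 : a.transpose * (g * a) = g := by
      refine Matrix.ext fun k l => ?_
      have h := A_metric (q := 1) k l
      simp only [Matrix.mul_apply, Matrix.transpose_apply, Finset.mul_sum, g, a, Matrix.of_apply,
        Matrix.map_apply]
      rw [← h]
      refine Finset.sum_congr rfl fun x _ => Finset.sum_congr rfl fun y _ => ?_
      rw [← Algebra.smul_def, mul_smul_comm]
    have e2 : (g * a.transpose * g) * a = 1 := by
      rw [mul_assoc, mul_assoc, e1, hgg]
    have e3 := matrix_mul_eq_one_of_commute mul_comm_of_one e2
    have e4 : a * g * a.transpose = g := by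
      calc a * g * a.transpose = a * (g * a.transpose * g) * g := by
            simp only [mul_assoc, hgg, mul_one]
        _ = g := by rw [e3, one_mul]
    have h := congrFun (congrFun e4 i) j
    simp only [Matrix.mul_apply, Matrix.transpose_apply, Finset.sum_mul, g, a, Matrix.of_apply,
        Matrix.map_apply] at h
    rw [← h, Finset.sum_comm]
    refine Finset.sum_congr rfl fun x _ => Finset.sum_congr rfl fun y _ => ?_
    rw [← Algebra.commutes, ← Algebra.smul_def, smul_mul_assoc]
  · have hs : qgap q ≠ 0 := by
      have hq' := ofReal_ne_zero_of_pos hq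
      intro h0
      rw [qgap, sub_eq_zero, eq_comm, inv_eq_iff_eq_inv, eq_comm] at h0
      have h2 : (q : ℂ) * q = 1 := by
        nth_rewrite 1 [← h0]; exact inv_mul_cancel₀ hq'
      have h3 : q * q = 1 := by exact_mod_cast h2
      nlinarith [mul_self_eq_one_iff.1 h3 |>.resolve_left h1]
    have hK : Commute (scalar N q (rankOne (metric N q))) (AA N q) := by
      have e : rankOne (metric N q) = (qgap q)⁻¹ • (braidInv N q - braid N q + qgap q • 1) := by
        rw [braidInv, ← cupCap_eq_rankOne]
        rw [eq_inv_smul_iff₀ hs]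
        abel
      rw [e, map_smul, map_add, map_sub, map_smul, map_one]
      exact Commute.smul_left ((((commute_braidInv hq).sub_left commute_braid)).add_left
        ((Commute.one_left _).smul_left _)) _
    have h := rankOne_mul_AA (N := N) (q := q)
    rw [hK.eq] at h
    have h2 : ∀ m n, metric N q m n • (∑ k, ∑ l, metric N q k l • (A N q i k * A N q j l))
        = metric N q m n • algebraMap ℂ (Oq N q) (metric N q i j) := by
      intro m n
      have h3 := congrFun (congrFun h (i, j)) (m, n)
      rw [AA_mul_scalar, scalar_apply] at h3
      simp only [rankOne, Matrix.of_apply, map_mul] at h3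
      rw [Algebra.smul_def (metric N q m n) (algebraMap ℂ (Oq N q) _), ← map_mul, mul_comm, map_mul,
        ← h3]
      simp only [Finset.smul_sum, smul_smul, mul_comm (metric N q m n)]
    -- A nonzero entry of the metric, which can be cancelled.
    have h3 := h2 ⟨0, hN⟩ (Fin.rev ⟨0, hN⟩)
    refine smul_right_injective _ ?_ h3
    rw [metric_rev' hq]
    exact inv_ne_zero (rhoPow_ne_zero hq _)

lemma commute_proj (hN : 1 ≤ N) (hq : 0 < q) :
    Commute (scalar N q (projMinus N q)) (AA N q) := by
  have hK : Commute (scalar N q (rankOne (metric N q))) (AA N q) := by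
    refine Eq.trans rankOne_mul_AA ?_
    refine Matrix.ext fun ⟨i, k⟩ ⟨j, l⟩ => ?_
    rw [AA_mul_scalar, scalar_apply]
    simp only [rankOne, Matrix.of_apply, mul_comm _ (metric N q j l), mul_smul, ← Finset.smul_sum,
      A_cup hN hq, map_mul]
    rw [Algebra.smul_def]
  rw [← inv_smul_smul₀ (braidData hN hq).two_ne (projMinus N q), (braidData hN hq).proj]
  simp only [map_smul, map_add, map_sub, map_one]
  exact ((((Commute.one_left _).smul_left _).sub_left commute_braid).add_left
    (hK.smul_left _)).smul_left _

end Oq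

/-! ### Covariance of the calculus under O_q(N). -/

section Coaction

open scoped TensorProduct

lemma word_sum_tmul {B C : Type*} [Ring B] [Algebra ℂ B] [Ring C] [Algebra ℂ C] {V : Type*}
    [Fintype V] (a : V → V → B) (x : V → C) {n : ℕ} (i : Fin n → V) :
    word (fun i => ∑ j, a i j ⊗ₜ[ℂ] x j) i
      = ∑ j : Fin n → V, (List.ofFn fun k => a (i k) (j k)).prod ⊗ₜ[ℂ] word x j := by
  induction n with
  | zero => simp [word, Algebra.TensorProduct.one_def]
  | succ n ih =>
    rw [word_succ, ih, sum_fun_fin_succ, Finset.sum_mul_sum]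
    refine Finset.sum_congr rfl fun b _ => Finset.sum_congr rfl fun j _ => ?_
    rw [Algebra.TensorProduct.tmul_mul_tmul, word_succ x, List.ofFn_succ, List.prod_cons]
    simp [Fin.tail]

/-- Since P⁻ commutes with AA, it can be moved from the A's onto the x's, where it gives zero. -/
lemma exists_coaction (hN : 1 ≤ N) (hq : 0 < q) :
    ∃ δ : Eucl N q →ₐ[ℂ] Oq N q ⊗[ℂ] Eucl N q,
      ∀ i, δ (Eucl.x N q i) = ∑ j, Oq.A N q i j ⊗ₜ[ℂ] Eucl.x N q j := by
  refine Eucl.exists_lift _ fun i k => ?_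
  have h : ∀ j l, ∑ m, ∑ n, projMinus N q (i, k) (m, n) • (Oq.A N q m j * Oq.A N q n l)
      = ∑ n, ∑ m, projMinus N q (n, m) (j, l) • (Oq.A N q i n * Oq.A N q k m) := fun j l => by
    rw [← Oq.scalar_mul_AA, (Oq.commute_proj hN hq).eq, Oq.AA_mul_scalar]
  calc _ = ∑ j, ∑ l, (∑ m, ∑ n, projMinus N q (i, k) (m, n) • (Oq.A N q m j * Oq.A N q n l)) ⊗ₜ[ℂ]
          (Eucl.x N q j * Eucl.x N q l) := by
        simp only [Finset.sum_mul_sum, Algebra.TensorProduct.tmul_mul_tmul, Finset.smul_sum,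
          TensorProduct.sum_tmul, TensorProduct.smul_tmul']
        rw [sum_four_comm]
    _ = ∑ n, ∑ m, (Oq.A N q i n * Oq.A N q k m) ⊗ₜ[ℂ] (∑ j, ∑ l,
          projMinus N q (n, m) (j, l) • (Eucl.x N q j * Eucl.x N q l)) := by
        simp only [h, TensorProduct.sum_tmul, TensorProduct.tmul_sum, TensorProduct.smul_tmul]
        rw [sum_four_comm]
    _ = 0 := by simp [Eucl.x_relation]

variable {B : Matrix (Fin N × Fin N) (Fin N × Fin N) ℂ}
  {d : Fin N → (Eucl N q →ₗ[ℂ] Eucl N q)} (hd : IsCalculus N q B d)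
include hd

lemma lTensor_d_mul (a : Oq N q) (b m : Fin N) (t : Oq N q ⊗[ℂ] Eucl N q) :
    (d b).lTensor (Oq N q) (a ⊗ₜ[ℂ] Eucl.x N q m * t)
      = (a ⊗ₜ[ℂ] 1) * (metric N q b m • t + ∑ k, ∑ l, B (b, m) (k, l) •
          ((1 ⊗ₜ[ℂ] Eucl.x N q k) * (d l).lTensor (Oq N q) t)) := by
  induction t using TensorProduct.induction_on with
  | zero => simp
  | tmul c f =>
    simp only [Algebra.TensorProduct.tmul_mul_tmul, LinearMap.lTensor_tmul, hd.leibniz, mul_add,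
      TensorProduct.tmul_add, TensorProduct.tmul_sum, TensorProduct.tmul_smul, Finset.mul_sum,
      mul_smul_comm, one_mul]
  | add s t hs ht =>
    rw [mul_add, map_add, hs, ht, ← mul_add]
    simp only [map_add, mul_add, smul_add, Finset.sum_add_distrib]
    abel

omit hd in
lemma lTensor_mul_left (D : Eucl N q →ₗ[ℂ] Eucl N q) (a : Oq N q) (t : Oq N q ⊗[ℂ] Eucl N q) :
    D.lTensor (Oq N q) ((a ⊗ₜ[ℂ] 1) * t) = (a ⊗ₜ[ℂ] 1) * D.lTensor (Oq N q) t := by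
  induction t using TensorProduct.induction_on with
  | zero => simp
  | tmul c f => simp
  | add s t hs ht => rw [mul_add, map_add, hs, ht, ← mul_add, ← map_add]

/-- The derivatives transform like the coordinates. By induction along the Leibniz rule, the metric
term is matched by `Oq.A_cup` and the braiding term by commutation of B with AA. -/
lemma coaction_d (hN : 1 ≤ N) (hq : 0 < q) (hB : Commute (Oq.scalar N q B) (Oq.AA N q))
    {δ : Eucl N q →ₐ[ℂ] Oq N q ⊗[ℂ] Eucl N q}
    (hδ : ∀ i, δ (Eucl.x N q i) = ∑ j, Oq.A N q i j ⊗ₜ[ℂ] Eucl.x N q j) (a : Fin N) (f : Eucl N q) :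
    δ (d a f) = ∑ b, (Oq.A N q a b ⊗ₜ[ℂ] 1) * (d b).lTensor (Oq N q) (δ f) := by
  induction f using Eucl.induction generalizing a with
  | h1 => simp [hd.map_one, Algebra.TensorProduct.one_def]
  | hx j f hf =>
    have h : ∀ k l, ∑ m, ∑ n, B (a, j) (m, n) • (Oq.A N q m k * Oq.A N q n l)
        = ∑ n, ∑ m, B (n, m) (k, l) • (Oq.A N q a n * Oq.A N q j m) := fun k l => by
      rw [← Oq.scalar_mul_AA, hB.eq, Oq.AA_mul_scalar]
    have e1 : δ (d a (Eucl.x N q j * f)) = metric N q a j • δ f + ∑ k, ∑ l,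
        (∑ m, ∑ n, B (a, j) (m, n) • (Oq.A N q m k * Oq.A N q n l)) ⊗ₜ[ℂ] Eucl.x N q k *
          (d l).lTensor (Oq N q) (δ f) := by
      rw [hd.leibniz]
      simp only [map_add, map_sum, map_smul, map_mul, hδ, hf]
      congr 1
      simp only [TensorProduct.sum_tmul, ← TensorProduct.smul_tmul', Finset.smul_sum, Finset.sum_mul, Finset.mul_sum, smul_mul_assoc, ← mul_assoc,
        Algebra.TensorProduct.tmul_mul_tmul, mul_one]
      rw [sum_four_comm]
      exact Finset.sum_comm
    have e2 : ∑ b, (Oq.A N q a b ⊗ₜ[ℂ] 1) * (d b).lTensor (Oq N q) (δ (Eucl.x N q j * f))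
        = (∑ b, ∑ m, metric N q b m • (Oq.A N q a b * Oq.A N q j m)) ⊗ₜ[ℂ] 1 * δ f + ∑ k, ∑ l,
          (∑ n, ∑ m, B (n, m) (k, l) • (Oq.A N q a n * Oq.A N q j m)) ⊗ₜ[ℂ] Eucl.x N q k *
          (d l).lTensor (Oq N q) (δ f) := by
      simp only [map_mul, hδ, Finset.sum_mul, map_sum, lTensor_d_mul hd, Finset.mul_sum, mul_add,
        Finset.sum_add_distrib, ← mul_assoc, Algebra.TensorProduct.tmul_mul_tmul, mul_one, one_mul,
        TensorProduct.sum_tmul, ← TensorProduct.smul_tmul', mul_smul_comm, smul_mul_assoc]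
      congr 1
      rw [sum_four_comm]
    rw [e1, e2, Oq.A_cup hN hq]
    simp only [h]
    rw [Algebra.algebraMap_eq_smul_one, ← TensorProduct.smul_tmul', smul_mul_assoc,
      ← Algebra.TensorProduct.one_def, one_mul]
  | hadd f g hf hg =>
    simp only [map_add, hf, hg, mul_add, Finset.sum_add_distrib]
  | hsmul c f hf =>
    simp only [map_smul, hf, mul_smul_comm, Finset.smul_sum]

lemma coaction_laplacian (hN : 1 ≤ N) (hq : 0 < q) (hB : Commute (Oq.scalar N q B) (Oq.AA N q))
    {δ : Eucl N q →ₐ[ℂ] Oq N q ⊗[ℂ] Eucl N q}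
    (hδ : ∀ i, δ (Eucl.x N q i) = ∑ j, Oq.A N q i j ⊗ₜ[ℂ] Eucl.x N q j) (f : Eucl N q) :
    δ (laplacian d f) = (laplacian d).lTensor (Oq N q) (δ f) := by
  have e1 : (laplacian d).lTensor (Oq N q) (δ f) = ∑ a, ∑ b, metric N q a b •
      (d a).lTensor (Oq N q) ((d b).lTensor (Oq N q) (δ f)) := by
    have h : ∀ t : Oq N q ⊗[ℂ] Eucl N q, (laplacian d).lTensor (Oq N q) t = ∑ a, ∑ b,
        metric N q a b • (d a).lTensor (Oq N q) ((d b).lTensor (Oq N q) t) := by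
      intro t
      induction t using TensorProduct.induction_on with
      | zero => simp
      | tmul c f => simp [laplacian_apply, TensorProduct.tmul_sum]
      | add s t hs ht => simp only [map_add, hs, ht, smul_add, Finset.sum_add_distrib]
    exact h _
  have e2 : δ (laplacian d f) = ∑ k, ∑ l,
      (∑ a, ∑ b, metric N q a b • (Oq.A N q a k * Oq.A N q b l)) ⊗ₜ[ℂ] 1 *
        (d k).lTensor (Oq N q) ((d l).lTensor (Oq N q) (δ f)) := by
    rw [laplacian_apply]
    simp only [map_sum, map_smul, coaction_d hd hN hq hB hδ, lTensor_mul_left, Finset.mul_sum,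
      ← mul_assoc, Algebra.TensorProduct.tmul_mul_tmul, mul_one, Finset.smul_sum,
      TensorProduct.sum_tmul, ← TensorProduct.smul_tmul', Finset.sum_mul, smul_mul_assoc]
    rw [sum_four_comm]
  rw [e1, e2]
  refine Finset.sum_congr rfl fun k _ => Finset.sum_congr rfl fun l _ => ?_
  rw [Oq.A_metric, Algebra.algebraMap_eq_smul_one, ← TensorProduct.smul_tmul', smul_mul_assoc,
    ← Algebra.TensorProduct.one_def, one_mul]

/-- Apply the coaction to Δ^m(x⋯x) = c·1: on the scalar it is trivial, and on the left it commutes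
with Δ^m and produces the A's. The augmentation then removes the factor in quantum Euclidean space.
-/
lemma isInvariant_of_laplacian_pow (hN : 1 ≤ N) (hq : 0 < q)
    (hB : Commute (Oq.scalar N q B) (Oq.AA N q)) (m : ℕ) {n : ℕ} (c : QTensor N n)
    (hc : ∀ i, (laplacian d ^ m) (word (Eucl.x N q) i) = c i • 1) : IsInvariant q c := by
  obtain ⟨δ, hδ⟩ := exists_coaction (N := N) hN hq
  have hpow : ∀ m f, δ ((laplacian d ^ m) f) = (laplacian d ^ m).lTensor (Oq N q) (δ f) := by
    intro m
    induction m with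
    | zero => intro f; simp [Module.End.one_eq_id]
    | succ m ih =>
      intro f
      rw [pow_succ, Module.End.mul_apply, ih, coaction_laplacian hd hN hq hB hδ,
        LinearMap.lTensor_mul, Module.End.mul_apply]
  intro i
  have hw : δ (word (Eucl.x N q) i) = ∑ j : Fin n → Fin N,
      (List.ofFn fun k => Oq.A N q (i k) (j k)).prod ⊗ₜ[ℂ] word (Eucl.x N q) j := by
    rw [← word_sum_tmul, word, map_list_prod, List.map_ofFn, word]
    simp only [Function.comp_def, hδ]
  have h := hpow m (word (Eucl.x N q) i)
  rw [hc, hw, map_smul, map_one, map_sum] at h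
  simp only [LinearMap.lTensor_tmul, hc] at h
  have h2 := congrArg (fun t => TensorProduct.rid ℂ (Oq N q)
    ((Eucl.aug N q).toLinearMap.lTensor (Oq N q) t)) h
  simp only [map_smul, map_sum, LinearMap.lTensor_tmul, TensorProduct.tmul_smul,
    Algebra.TensorProduct.one_def, AlgHom.toLinearMap_apply, map_one, TensorProduct.rid_tmul,
    one_smul] at h2
  rw [← h2, Algebra.algebraMap_eq_smul_one]

end Coaction

lemma IsInvariant.smul {n : ℕ} {J : QTensor N n} (hJ : IsInvariant q J) (c : ℂ) :
    IsInvariant q (c • J) := by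
  intro i
  simp only [Pi.smul_apply, smul_eq_mul, mul_smul, ← Finset.smul_sum, hJ i, map_mul]
  rw [Algebra.smul_def]

lemma CalcFamily.isInvariant_lapTensor {R S : ℝ → Matrix (Fin N × Fin N) (Fin N × Fin N) ℂ}
    {z l : ℝ → ℂ} {d : (q : ℝ) → Fin N → (Eucl N q →ₗ[ℂ] Eucl N q)} (C : CalcFamily N R S z l d)
    (hR : ∀ q, 0 < q → Commute (Oq.scalar N q (R q)) (Oq.AA N q))
    (hN : 1 ≤ N) (hq : 0 < q) {n : ℕ} (hn : Even n) : IsInvariant q (lapTensor z l d n q) := by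
  have hB : Commute (Oq.scalar N q ((z q)⁻¹ • R q)) (Oq.AA N q) := by
    rw [map_smul]; exact (hR q hq).smul_left _
  have h := isInvariant_of_laplacian_pow (C.isCalculus q hq) hN hq hB (n / 2) _
    (C.laplacian_word_eq hN hq hn)
  have h2 := IsInvariant.smul h (lapNorm (z q) (l q) (metricSq N q) (n / 2))⁻¹
  convert h2 using 1
  funext i
  exact (inv_mul_cancel_left₀ (C.lapNorm_ne_zero hN hq _) _).symm

end QSphere

namespace QSphere

/-! ### The twisted trace of the braid matrix. -/

section Entries

variable {V κ : Type*} [Fintype V] [DecidableEq V]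

lemma amp1_mul_apply (X : Matrix (V × V) (V × V) ℂ) (Y : Matrix (V × V × V) κ ℂ) (i j k : V)
    (t : κ) : (amp1 X * Y) (i, j, k) t = ∑ a, ∑ b, X (i, j) (a, b) * Y (a, b, k) t := by
  simp [Matrix.mul_apply, amp1, Fintype.sum_prod_type, ite_mul]

lemma amp2_mul_apply (X : Matrix (V × V) (V × V) ℂ) (Y : Matrix (V × V × V) κ ℂ) (i j k : V)
    (t : κ) : (amp2 X * Y) (i, j, k) t = ∑ a, ∑ b, X (j, k) (a, b) * Y (i, a, b) t := by
  simp [Matrix.mul_apply, amp2, Fintype.sum_prod_type, ite_mul]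

lemma cap12_mul_apply (g : Matrix V V ℂ) (Y : Matrix (V × V × V) κ ℂ) (i : V)
    (t : κ) : (cap12 g * Y) i t = ∑ a, ∑ b, g a b * Y (a, b, i) t := by
  simp [Matrix.mul_apply, cap12, cup12, Fintype.sum_prod_type, ite_mul]

lemma entry_amp1_amp2_amp1 (X Y Z : Matrix (V × V) (V × V) ℂ) (i k d b j l : V) :
    (amp1 X * (amp2 Y * amp1 Z)) (i, k, d) (b, j, l)
      = ∑ m, ∑ n, X (i, k) (m, n) * ∑ c, Z (m, c) (b, j) * Y (n, d) (c, l) := by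
  rw [amp1_mul_apply]
  simp only [amp2_mul_apply]
  simp [amp1, mul_comm]

lemma entry_amp2_amp1_amp2 (X Y Z : Matrix (V × V) (V × V) ℂ) (i k d b j l : V) :
    (amp2 X * amp1 Y * amp2 Z) (i, k, d) (b, j, l)
      = ∑ n, ∑ m, Z (n, m) (j, l) * ∑ c, Y (i, c) (b, n) * X (k, d) (c, m) := by
  rw [Matrix.mul_assoc, amp2_mul_apply]
  simp only [amp1_mul_apply, amp2, Matrix.of_apply, mul_ite, mul_zero, Finset.sum_ite_irrel,
    Finset.sum_const_zero, Finset.sum_ite_eq', Finset.mem_univ, if_true, Finset.mul_sum]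
  rw [Finset.sum_comm_cycle]
  refine Finset.sum_congr rfl fun n _ => ?_
  rw [Finset.sum_comm]
  refine Finset.sum_congr rfl fun m _ => Finset.sum_congr rfl fun c _ => ?_
  ring

lemma entry_cap12_amp2_amp1 (g : Matrix V V ℂ) (X : Matrix (V × V) (V × V) ℂ) (d b k l : V) :
    (cap12 g * amp2 X * amp1 X) d (b, k, l)
      = ∑ i, ∑ j, g i j * ∑ c, X (i, c) (b, k) * X (j, d) (c, l) := by
  rw [Matrix.mul_assoc, cap12_mul_apply]
  simp only [amp2_mul_apply]
  simp [amp1, mul_comm]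

/-- The kink relation `cap12_amp2_cup12` in entries: closing one strand of a crossing with the
metric leaves a twist. -/
lemma BraidData.twisted_trace {g : Matrix V V ℂ} {P R S : Matrix (V × V) (V × V) ℂ} {q l E : ℂ}
    (D : BraidData g P R S q l E) (c j : V) :
    ∑ i, ∑ b, (∑ m, g m i * g m b) * R (i, c) (b, j) = if c = j then l⁻¹ else 0 := by
  have h := congrFun (congrFun D.cap12_amp2_cup12 c) j
  rw [cap12_mul_apply] at h
  simp only [amp2_mul_apply, cup12, Matrix.of_apply, mul_ite, mul_zero, Finset.sum_ite_eq',
    Finset.mem_univ, if_true, Matrix.smul_apply, Matrix.one_apply, smul_eq_mul, mul_one] at h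
  rw [← h, Finset.sum_comm]
  simp only [Finset.sum_mul, Finset.mul_sum]
  rw [Finset.sum_comm]
  rw [Finset.sum_comm_cycle]
  refine Finset.sum_congr rfl fun m _ => Finset.sum_congr rfl fun n _ =>
    Finset.sum_congr rfl fun c _ => ?_
  ring

end Entries

/-! ### Moving a strand through a tensor. -/

section Sweep

variable {V : Type*} [Fintype V] [DecidableEq V]

/-- The component of `R_n ⋯ R_1 (e_b ⊗ J)`, in which a vector is moved through a tensor. -/
def sweep (R : Matrix (V × V) (V × V) ℂ) : List V → (List V → ℂ) → V → V → ℂ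
  | [], J, b, c => if b = c then J [] else 0
  | i :: L, J, b, c => ∑ j, ∑ e, R (i, e) (b, j) * sweep R L (fun K => J (j :: K)) e c

lemma sweep_smul (R : Matrix (V × V) (V × V) ℂ) (L : List V) (J : List V → ℂ) (a : ℂ) (b c : V) :
    sweep R L (fun K => a * J K) b c = a * sweep R L J b c := by
  induction L generalizing J b with
  | nil => simp [sweep]
  | cons i L ih =>
    simp only [sweep, ih, Finset.mul_sum]
    refine Finset.sum_congr rfl fun _ _ => Finset.sum_congr rfl fun _ _ => ?_
    ring

lemma sweep_sum {κ : Type*} (s : Finset κ) (R : Matrix (V × V) (V × V) ℂ) (L : List V)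
    (J : κ → List V → ℂ) (b c : V) :
    sweep R L (fun K => ∑ t ∈ s, J t K) b c = ∑ t ∈ s, sweep R L (J t) b c := by
  induction L generalizing J b with
  | nil => by_cases h : b = c <;> simp [sweep, h]
  | cons i L ih =>
    simp only [sweep, ih, Finset.mul_sum]
    rw [Finset.sum_comm_cycle]

/-- A tensor, as a function on words, that is an eigenvector of `R` at all neighbouring
positions. -/
def IsEigenTensor (R : Matrix (V × V) (V × V) ℂ) (q : ℂ) (J : List V → ℂ) : Prop :=
  ∀ u v a b, ∑ k, ∑ l, R (a, b) (k, l) * J (u ++ k :: l :: v) = q * J (u ++ a :: b :: v)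

lemma IsEigenTensor.cons {R : Matrix (V × V) (V × V) ℂ} {q : ℂ} {J : List V → ℂ}
    (hJ : IsEigenTensor R q J) (i : V) : IsEigenTensor R q fun L => J (i :: L) :=
  fun u v a b => hJ (i :: u) v a b

/-- If the moving strand is the first index of the tensor itself, each crossing acts on neighbouring
indices of J and contributes a factor q, and the strand arrives at the last place. -/
lemma IsEigenTensor.sum_sweep {R : Matrix (V × V) (V × V) ℂ} {q : ℂ} (L : List V) {J : List V → ℂ}
    (hJ : IsEigenTensor R q J) (c : V) :
    ∑ b, sweep R L (fun K => J (b :: K)) b c = q ^ L.length * J (L ++ [c]) := by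
  induction L generalizing J with
  | nil => simp [sweep]
  | cons i L ih =>
    have e : ∀ e, ∑ b, ∑ j, R (i, e) (b, j) * sweep R L (fun K => J (b :: j :: K)) e c
        = q * sweep R L (fun K => J (i :: e :: K)) e c := by
      intro e
      have h : (fun K => ∑ b, ∑ j, R (i, e) (b, j) * J (b :: j :: K))
          = fun K => q * J (i :: e :: K) := funext fun K => hJ [] K i e
      rw [← sweep_smul, ← h, sweep_sum]
      simp only [sweep_sum, sweep_smul]
    have h2 := ih (hJ.cons i)
    simp only [sweep]
    calc _ = ∑ e, ∑ b, ∑ j, R (i, e) (b, j) * sweep R L (fun K => J (b :: j :: K)) e c := by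
          rw [Finset.sum_comm_cycle]
      _ = _ := by
        simp only [e, ← Finset.mul_sum, h2, List.length_cons, List.cons_append]
        ring

/-- Closing the strand with its first crossing gives l⁻¹ by `BraidData.twisted_trace`; the remaining
crossings are those of `IsEigenTensor.sum_sweep`. -/
lemma BraidData.sum_twisted_sweep {g : Matrix V V ℂ} {P R S : Matrix (V × V) (V × V) ℂ}
    {q l E : ℂ} (D : BraidData g P R S q l E) {J : List V → ℂ} (hJ : IsEigenTensor R q J)
    (L : List V) (c : V) :
    ∑ i, ∑ b, (∑ m, g m i * g m b) * sweep R (i :: L) J b c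
      = l⁻¹ * (q ^ L.length * J (L ++ [c])) := by
  rw [← hJ.sum_sweep L c]
  simp only [sweep]
  have hM : ∀ M : V → V → ℂ, ∑ i, ∑ b, M i b * (∑ j, ∑ e, R (i, e) (b, j) *
      sweep R L (fun K => J (j :: K)) e c) = ∑ j, ∑ e, (∑ i, ∑ b, M i b * R (i, e) (b, j)) *
        sweep R L (fun K => J (j :: K)) e c := by
    intro M
    simp only [Finset.mul_sum, Finset.sum_mul]
    rw [sum_four_comm]
    simp only [mul_assoc]
  calc _ = ∑ j, ∑ e, (∑ i, ∑ b, (∑ m, g m i * g m b) * R (i, e) (b, j)) *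
          sweep R L (fun K => J (j :: K)) e c := by
        exact hM fun i b => ∑ m, g m i * g m b
    _ = _ := by
      simp only [D.twisted_trace, ite_mul, zero_mul, Finset.sum_ite_eq', Finset.mem_univ, if_true,
        Finset.mul_sum]

/-- The matrices of the vector representation defined by `R`. -/
def repMatrix (R : Matrix (V × V) (V × V) ℂ) (i j : V) : Matrix V V ℂ :=
  Matrix.of fun b c => R (i, c) (b, j)

/-- Connects the sweep with the image of A⋯A·J in the vector representation. -/
lemma sum_word_eq_sweep {n : ℕ} (R : Matrix (V × V) (V × V) ℂ) (J : List V → ℂ) (i : Fin n → V)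
    (b c : V) : ∑ j : Fin n → V, J (List.ofFn j) *
      (List.ofFn fun k => repMatrix R (i k) (j k)).prod b c
      = sweep R (List.ofFn i) J b c := by
  induction n generalizing J b with
  | zero => simp [sweep, Matrix.one_apply]
  | succ n ih =>
    rw [sum_fun_fin_succ, List.ofFn_succ, sweep]
    refine Finset.sum_congr rfl fun j _ => ?_
    simp only [← ih, Finset.mul_sum]
    rw [Finset.sum_comm]
    refine Finset.sum_congr rfl fun j' _ => ?_
    rw [List.ofFn_cons, List.ofFn_succ, List.prod_cons, Matrix.mul_apply, Finset.mul_sum]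
    refine Finset.sum_congr rfl fun e _ => ?_
    simp only [Fin.cons_zero, Fin.cons_succ, repMatrix, Matrix.of_apply]
    ring

end Sweep

end QSphere

namespace QSphere

/-! ### Functionals from functions on words; traces and representations. -/

section Functionals

variable {V : Type*}

/-- The translation `c(L) ↦ c(L k)` of functions on words. -/
def wordShift (k : V) : (List V → ℂ) →ₗ[ℂ] (List V → ℂ) := LinearMap.funLeft ℂ ℂ fun L => L ++ [k]

lemma wordShift_apply (k : V) (c : List V → ℂ) (L : List V) : wordShift k c L = c (L ++ [k]) := rfl

/-- An algebra acting on a space of functions on words by translations has linear functionals with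
these functions as values on monomials. -/
lemma exists_functional_of_hom {A : Type*} [Ring A] [Algebra ℂ A] (x : V → A)
    (M : Submodule ℂ (List V → ℂ)) (hM : ∀ k, ∀ c ∈ M, wordShift k c ∈ M)
    (φ : A →ₐ[ℂ] Module.End ℂ M) (hφ : ∀ k, φ (x k) = (wordShift k).restrict (hM k))
    {c : List V → ℂ} (hc : c ∈ M) : ∃ f : A →ₗ[ℂ] ℂ, ∀ L, f (L.map x).prod = c L := by
  refine ⟨LinearMap.proj [] ∘ₗ M.subtype ∘ₗ LinearMap.applyₗ ⟨c, hc⟩ ∘ₗ φ.toLinearMap, fun L => ?_⟩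
  have h : ∀ L K, ((φ (L.map x).prod) ⟨c, hc⟩ : List V → ℂ) K = c (K ++ L) := by
    intro L
    induction L with
    | nil => intro K; simp
    | cons k L ih =>
      intro K
      rw [List.map_cons, List.prod_cons, map_mul, hφ, Module.End.mul_apply,
        LinearMap.coe_restrict_apply, wordShift_apply, ih]
      simp
  simpa using h L []

/-- A tensor as a function on words. -/
def ofTensor {n : ℕ} (J : (Fin n → V) → ℂ) (L : List V) : ℂ :=
  if h : L.length = n then J fun k => L[k]'(by omega) else 0

lemma ofTensor_ofFn {n : ℕ} (J : (Fin n → V) → ℂ) (i : Fin n → V) : ofTensor J (List.ofFn i) = J i := by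
  simp [ofTensor]

lemma ofTensor_of_length_ne {n : ℕ} (J : (Fin n → V) → ℂ) {L : List V} (h : L.length ≠ n) :
    ofTensor J L = 0 := dif_neg h

lemma exists_ofFn {n : ℕ} {L : List V} (h : L.length = n) : ∃ i : Fin n → V, L = List.ofFn i := by
  subst h
  exact ⟨L.get, (List.ofFn_get L).symm⟩

end Functionals

variable {N : ℕ} {q : ℝ}

/-- Symmetry of a function on words. -/
def IsWordSymmetric (q : ℝ) (c : List (Fin N) → ℂ) : Prop :=
  ∀ u v i j, ∑ k, ∑ l, projMinus N q (i, j) (k, l) * c (u ++ k :: l :: v) = 0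

lemma IsSymmetric.isWordSymmetric {n : ℕ} {J : QTensor N n} (hJ : IsSymmetric q J) :
    IsWordSymmetric q (ofTensor J) := by
  intro u v i j
  by_cases h : (u ++ i :: j :: v).length = n
  · obtain ⟨f, hf⟩ := exists_ofFn h
    have hl : u.length + 1 < n := by
      rw [← h]; simp
    have h1 := ofFn_eq_take_cons_drop u.length hl f
    have h2 : (List.ofFn f).take u.length = u := by rw [← hf]; simp
    have h3 : (List.ofFn f).drop (u.length + 2) = v := by rw [← hf]; simp
    have h4 := hf.trans h1
    rw [h2, h3, List.append_cancel_left_eq, List.cons.injEq, List.cons.injEq] at h4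
    have h5 := hJ u.length hl f
    rw [← h4.1, ← h4.2.1] at h5
    rw [← h5]
    refine Finset.sum_congr rfl fun a _ => Finset.sum_congr rfl fun b _ => ?_
    rw [← ofTensor_ofFn J, ofFn_update_update, h2, h3]
  · have h' : ∀ a b, ofTensor J (u ++ a :: b :: v) = 0 := fun a b =>
      ofTensor_of_length_ne J fun h' => h (by rw [← h']; simp)
    simp [h']

/-- Functions on words with the symmetry of monomials of quantum Euclidean space. -/
def symWords (N : ℕ) (q : ℝ) : Submodule ℂ (List (Fin N) → ℂ) where
  carrier := {c | IsWordSymmetric q c}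
  zero_mem' := fun u v i j => by simp
  add_mem' {a b} ha hb := fun u v i j => by
    simp only [Pi.add_apply, mul_add, Finset.sum_add_distrib, ha u v i j, hb u v i j, add_zero]
  smul_mem' t a ha := fun u v i j => by
    have h := congrArg (t * ·) (ha u v i j)
    simp only [Finset.mul_sum, mul_zero] at h
    rw [← h]
    refine Finset.sum_congr rfl fun k _ => Finset.sum_congr rfl fun l _ => ?_
    simp only [Pi.smul_apply, smul_eq_mul]; ring

lemma wordShift_mem_symWords (k : Fin N) (c : List (Fin N) → ℂ) (hc : c ∈ symWords N q) :
    wordShift k c ∈ symWords N q := by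
  intro u v i j
  have h := hc u (v ++ [k]) i j
  simpa only [wordShift_apply, List.append_assoc, List.cons_append] using h

/-- Realizes symmetric tensors as functionals, so that identities in quantum Euclidean space, such
as centrality of r², yield identities between contractions. -/
lemma Eucl.exists_functional {c : List (Fin N) → ℂ} (hc : IsWordSymmetric q c) :
    ∃ f : Eucl N q →ₗ[ℂ] ℂ, ∀ L : List (Fin N), f (L.map (Eucl.x N q)).prod = c L := by
  obtain ⟨φ, hφ⟩ := Eucl.exists_lift (q := q) (fun k : Fin N => (wordShift k).restrict
    (wordShift_mem_symWords (q := q) k)) (by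
      intro i j
      refine LinearMap.ext fun c => Subtype.ext (funext fun L => ?_)
      have h := c.2 L [] i j
      simpa [LinearMap.sum_apply, Finset.sum_apply, wordShift_apply] using h)
  exact exists_functional_of_hom (Eucl.x N q) (symWords N q) wordShift_mem_symWords φ hφ hc

lemma contract_zero_apply {n : ℕ} (J : QTensor N (n + 2)) (i : Fin n → Fin N) :
    contract q 0 J i = ∑ a, ∑ b, metric N q a b *
      J (Fin.cons (α := fun _ => Fin N) a (Fin.cons (α := fun _ => Fin N) b i)) := by
  simp only [contract, Fin.castSucc_zero, Fin.insertNth_zero']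

lemma contract_zero_ofTensor {n : ℕ} (J : QTensor N (n + 2)) (i : Fin n → Fin N) :
    contract q 0 J i = ∑ a, ∑ b, metric N q a b * ofTensor J (a :: b :: List.ofFn i) := by
  rw [contract_zero_apply]
  simp only [← List.ofFn_cons, ofTensor_ofFn]

lemma IsSymmetric.contract_zero {n : ℕ} {J : QTensor N (n + 2)} (hJ : IsSymmetric q J) :
    IsSymmetric q (contract q 0 J) := by
  have e : contract q 0 J = fun i => (fun L => ∑ a, ∑ b, metric N q a b * ofTensor J (a :: b :: L))
      (List.ofFn i) := funext fun i => contract_zero_ofTensor J i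
  rw [e]
  refine isSymmetric_of_list (fun L => ∑ a, ∑ b, metric N q a b * ofTensor J (a :: b :: L))
    fun u v i j => ?_
  have h : ∀ a b, metric N q a b * ∑ k, ∑ l, projMinus N q (i, j) (k, l) *
      ofTensor J (a :: b :: (u ++ k :: l :: v)) = 0 := fun a b => by
    have := hJ.isWordSymmetric (a :: b :: u) v i j
    simp only [List.cons_append] at this
    rw [this, mul_zero]
  calc _ = ∑ a, ∑ b, metric N q a b * ∑ k, ∑ l, projMinus N q (i, j) (k, l) *
      ofTensor J (a :: b :: (u ++ k :: l :: v)) := by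
        simp only [Finset.mul_sum]
        rw [sum_four_comm]
        simp only [mul_left_comm]
    _ = 0 := by simp only [h, Finset.sum_const_zero]

lemma IsSymmetric.sub {n : ℕ} {J K : QTensor N n} (hJ : IsSymmetric q J) (hK : IsSymmetric q K) :
    IsSymmetric q (J - K) := by
  intro l hl i
  simp only [Pi.sub_apply, mul_sub, Finset.sum_sub_distrib, hJ l hl i, hK l hl i, sub_zero]

lemma IsSymmetric.smul {n : ℕ} {J : QTensor N n} (hJ : IsSymmetric q J) (c : ℂ) :
    IsSymmetric q (c • J) := by
  intro l hl i
  simp only [Pi.smul_apply, smul_eq_mul, mul_left_comm _ c, ← Finset.mul_sum, hJ l hl i, mul_zero]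

lemma IsInvariant.sub {n : ℕ} {J K : QTensor N n} (hJ : IsInvariant q J) (hK : IsInvariant q K) :
    IsInvariant q (J - K) := by
  intro i
  rw [Pi.sub_apply, map_sub, ← hJ i, ← hK i, ← Finset.sum_sub_distrib]
  exact Finset.sum_congr rfl fun j _ => by
    simp only [Algebra.smul_def, Pi.sub_apply, map_sub, sub_mul]

lemma contract_sub {n : ℕ} (l : Fin (n + 1)) (J K : QTensor N (n + 2)) :
    contract q l (J - K) = contract q l J - contract q l K := by
  funext i
  simp only [contract, Pi.sub_apply, mul_sub, Finset.sum_sub_distrib]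

lemma contract_smul {n : ℕ} (l : Fin (n + 1)) (c : ℂ) (J : QTensor N (n + 2)) :
    contract q l (c • J) = c • contract q l J := by
  funext i
  simp only [contract, Pi.smul_apply, smul_eq_mul, mul_left_comm _ c, ← Finset.mul_sum]

/-- Contract the invariance of J in its first two indices: the relation g AA = g removes the first
two factors A. -/
lemma IsInvariant.contract_zero {n : ℕ} {J : QTensor N (n + 2)} (hJ : IsInvariant q J) :
    IsInvariant q (contract q 0 J) := by
  intro i
  have h : ∀ k l, ∑ c, ∑ e, ∑ j : Fin n → Fin N,
      J (Fin.cons (α := fun _ => Fin N) c (Fin.cons (α := fun _ => Fin N) e j)) •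
        (Oq.A N q k c * (Oq.A N q l e * (List.ofFn fun t => Oq.A N q (i t) (j t)).prod))
      = algebraMap ℂ (Oq N q)
        (J (Fin.cons (α := fun _ => Fin N) k (Fin.cons (α := fun _ => Fin N) l i))) := by
    intro k l
    have h := hJ (Fin.cons (α := fun _ => Fin N) k (Fin.cons (α := fun _ => Fin N) l i))
    rw [sum_fun_fin_succ] at h
    simp only [sum_fun_fin_succ (n := n)] at h
    simpa only [List.ofFn_succ, List.prod_cons, Fin.cons_zero, Fin.cons_succ] using h
  have h2 : ∑ k, ∑ l, metric N q k l • ∑ c, ∑ e, ∑ j : Fin n → Fin N,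
      J (Fin.cons (α := fun _ => Fin N) c (Fin.cons (α := fun _ => Fin N) e j)) •
        (Oq.A N q k c * (Oq.A N q l e * (List.ofFn fun t => Oq.A N q (i t) (j t)).prod))
      = algebraMap ℂ (Oq N q) (contract q 0 J i) := by
    simp only [h, contract_zero_apply, map_sum, map_mul, ← Algebra.smul_def]
  rw [← h2]
  have h3 : ∀ c e, ∀ w : Oq N q, ∑ k, ∑ l, metric N q k l • (Oq.A N q k c * (Oq.A N q l e * w))
      = metric N q c e • w := by
    intro c e w
    have := congrArg (· * w) (Oq.A_metric (q := q) c e)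
    simpa only [Finset.sum_mul, smul_mul_assoc, mul_assoc, ← Algebra.smul_def] using this
  calc _ = ∑ c, ∑ e, ∑ j : Fin n → Fin N,
      J (Fin.cons (α := fun _ => Fin N) c (Fin.cons (α := fun _ => Fin N) e j)) •
      ∑ k, ∑ l, metric N q k l • (Oq.A N q k c * (Oq.A N q l e *
        (List.ofFn fun t => Oq.A N q (i t) (j t)).prod)) := by
        simp only [h3, contract_zero_apply, Finset.sum_smul, smul_smul]
        refine Eq.trans ?_ Finset.sum_comm_cycle.symm
        simp only [mul_comm]
    _ = _ := by
        simp only [Finset.smul_sum]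
        symm
        rw [sum_four_comm]
        refine Finset.sum_congr rfl fun c _ => Finset.sum_congr rfl fun e _ => ?_
        rw [Finset.sum_comm_cycle]
        refine Finset.sum_congr rfl fun j _ => Finset.sum_congr rfl fun k _ =>
          Finset.sum_congr rfl fun l _ => smul_comm _ _ _

/-- The two hypotheses are the defining relations of O_q(N) for the matrices of X; both R̂ and R̂⁻¹
satisfy them. -/
lemma Oq.exists_repMatrix {X : Matrix (Fin N × Fin N) (Fin N × Fin N) ℂ}
    (h1 : amp1 (braid N q) * (amp2 X * amp1 X) = amp2 X * amp1 X * amp2 (braid N q))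
    (h2 : cap12 (metric N q) * amp2 X * amp1 X = cap23 (metric N q)) :
    ∃ φ : Oq N q →ₐ[ℂ] Matrix (Fin N) (Fin N) ℂ, ∀ i j, φ (Oq.A N q i j) = repMatrix X i j := by
  refine Oq.exists_lift _ (fun i k j l => Matrix.ext fun b d => ?_)
    fun k l => Matrix.ext fun b d => ?_
  · have h := congrFun (congrFun h1 (i, k, d)) (b, j, l)
    rw [entry_amp1_amp2_amp1, entry_amp2_amp1_amp2] at h
    simpa only [Matrix.sum_apply, Matrix.smul_apply, Matrix.mul_apply, repMatrix, Matrix.of_apply,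
      smul_eq_mul] using h
  · have h := congrFun (congrFun h2 d) (b, k, l)
    rw [entry_cap12_amp2_amp1] at h
    simp only [Matrix.sum_apply, Matrix.smul_apply, Matrix.mul_apply, repMatrix, Matrix.of_apply,
      smul_eq_mul]
    rw [h, Matrix.algebraMap_matrix_apply]
    simp [cap23, cup23, eq_comm]

lemma IsInvariant.sweep_eq {X : Matrix (Fin N × Fin N) (Fin N × Fin N) ℂ} {n : ℕ} {J : QTensor N n}
    (hJ : IsInvariant q J)
    (h1 : amp1 (braid N q) * (amp2 X * amp1 X) = amp2 X * amp1 X * amp2 (braid N q))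
    (h2 : cap12 (metric N q) * amp2 X * amp1 X = cap23 (metric N q)) (i : Fin n → Fin N)
    (b c : Fin N) : sweep X (List.ofFn i) (ofTensor J) b c = if b = c then J i else 0 := by
  obtain ⟨φ, hφ⟩ := Oq.exists_repMatrix h1 h2
  have h := congrFun (congrFun (congrArg φ (hJ i)) b) c
  simp only [map_sum, map_smul, map_list_prod, List.map_ofFn, Function.comp_def, hφ,
    AlgHom.commutes, Matrix.sum_apply, Matrix.smul_apply, smul_eq_mul,
    Matrix.algebraMap_matrix_apply] at h
  rw [← sum_word_eq_sweep]
  simpa only [ofTensor_ofFn, Algebra.algebraMap_self, RingHom.id_apply] using h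

/-- The eigenvalue equations for a tensor without contractions. -/
lemma BraidData.isEigenTensor {R S : Matrix (Fin N × Fin N) (Fin N × Fin N) ℂ} {z l E : ℂ}
    (D : BraidData (metric N q) (projMinus N q) R S z l E) {c : List (Fin N) → ℂ}
    (hs : IsWordSymmetric q c)
    (hc : ∀ u v, ∑ a, ∑ b, metric N q a b * c (u ++ a :: b :: v) = 0) : IsEigenTensor R z c := by
  intro u v a b
  have hR : ∀ k l', R (a, b) (k, l') = (if (a, b) = (k, l') then z else 0)
      - (z + z⁻¹) * projMinus N q (a, b) (k, l')
      + (l - z) / E * metric N q a b * metric N q k l' := by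
    intro k l'
    have h := congrFun (congrFun D.proj (a, b)) (k, l')
    simp only [Matrix.smul_apply, Matrix.add_apply, Matrix.sub_apply, smul_eq_mul, Matrix.one_apply,
      rankOne, Matrix.of_apply, mul_ite, mul_one, mul_zero] at h
    rw [h]; ring
  have e1 : ∑ k, ∑ l, (if (a, b) = (k, l) then z else 0) * c (u ++ k :: l :: v)
      = z * c (u ++ a :: b :: v) := by
    simp only [Prod.mk.injEq, ite_and, ite_mul, zero_mul, Finset.sum_ite_irrel,
      Finset.sum_const_zero, Finset.sum_ite_eq, Finset.mem_univ, if_true]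
  have e2 := congrArg ((z + z⁻¹) * ·) (hs u v a b)
  have e3 := congrArg ((l - z) / E * metric N q a b * ·) (hc u v)
  simp only [Finset.mul_sum, ← mul_assoc, mul_zero] at e2 e3
  have e4 : ∀ x y t w : ℂ, (x - y + t) * w = x * w - y * w + t * w := fun _ _ _ _ => by ring
  simp only [hR, e4, Finset.sum_add_distrib, Finset.sum_sub_distrib, e1]
  rw [e2, e3]; ring

/-- A contraction in the middle is a value of a functional on a product containing r², which can be
moved to the front. -/
lemma IsWordSymmetric.contract_eq_zero (hN : 1 ≤ N) (hq : 0 < q) {c : List (Fin N) → ℂ}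
    (hs : IsWordSymmetric q c) (hc : ∀ v, ∑ a, ∑ b, metric N q a b * c (a :: b :: v) = 0)
    (u v : List (Fin N)) : ∑ a, ∑ b, metric N q a b * c (u ++ a :: b :: v) = 0 := by
  obtain ⟨f, hf⟩ := Eucl.exists_functional hs
  have e : ∀ u v, ∑ a, ∑ b, metric N q a b * c (u ++ a :: b :: v)
      = f ((u.map (Eucl.x N q)).prod * Eucl.radius N q * (v.map (Eucl.x N q)).prod) := by
    intro u v
    simp only [← hf, Eucl.radius, Finset.mul_sum, Finset.sum_mul, map_sum, mul_smul_comm,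
      smul_mul_assoc, map_smul, smul_eq_mul, List.map_append, List.map_cons, List.prod_append,
      List.prod_cons, mul_assoc]
  have hcomm : Commute (Eucl.radius N q) (u.map (Eucl.x N q)).prod :=
    Commute.list_prod_right _ _ (by
      intro t ht
      obtain ⟨k, -, rfl⟩ := List.mem_map.1 ht
      exact Eucl.radius_comm hN hq k)
  have h := e [] (u ++ v)
  simp only [List.nil_append, hc, List.map_nil, List.prod_nil, one_mul] at h
  rw [e, ← hcomm.eq, mul_assoc, ← List.prod_append, ← List.map_append, ← h]

end QSphere

/-! ### Vanishing of invariant symmetric tensors without contractions for q ≠ 1. -/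

namespace QSphere

variable {N : ℕ} {q : ℝ}

lemma braid_representation (hN : 1 ≤ N) (hq : 0 < q) :
    amp1 (braid N q) * (amp2 (braid N q) * amp1 (braid N q))
      = amp2 (braid N q) * amp1 (braid N q) * amp2 (braid N q) := by
  rw [← Matrix.mul_assoc]
  exact (braidData hN hq).yangBaxter

lemma braidInv_representation (hN : 1 ≤ N) (hq : 0 < q) :
    amp1 (braid N q) * (amp2 (braidInv N q) * amp1 (braidInv N q))
      = amp2 (braidInv N q) * amp1 (braidInv N q) * amp2 (braid N q) := by
  have D := braidData hN hq
  have h := congrArg (fun t => amp2 (braidInv N q) * amp1 (braidInv N q) * t *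
    (amp2 (braidInv N q) * amp1 (braidInv N q))) D.yangBaxter
  have e1 : amp2 (braidInv N q) * amp1 (braidInv N q) *
      (amp1 (braid N q) * amp2 (braid N q) * amp1 (braid N q)) *
      (amp2 (braidInv N q) * amp1 (braidInv N q))
      = (amp2 (braidInv N q) * ((amp1 (braidInv N q) *
      amp1 (braid N q)) * amp2 (braid N q))) * (amp1 (braid N q) *
      (amp2 (braidInv N q) * amp1 (braidInv N q))) := by
    simp only [Matrix.mul_assoc]
  have e2 : amp2 (braidInv N q) * amp1 (braidInv N q) *
      (amp2 (braid N q) * amp1 (braid N q) * amp2 (braid N q)) *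
      (amp2 (braidInv N q) * amp1 (braidInv N q))
      = amp2 (braidInv N q) * amp1 (braidInv N q) * amp2 (braid N q) * (amp1 (braid N q) *
      ((amp2 (braid N q) * amp2 (braidInv N q)) * amp1 (braidInv N q))) := by
    simp only [Matrix.mul_assoc]
  simp only [e1, e2] at h
  rw [D.amp1_inv_mul, Matrix.one_mul, D.amp2_inv_mul, Matrix.one_mul, D.amp2_mul_inv,
    Matrix.one_mul, D.amp1_mul_inv, Matrix.mul_one] at h
  exact h

/-- By invariance the sweep of a strand through J is the same for R̂ and for R̂⁻¹. The twisted trace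
evaluates it to l⁻¹q^{n+1}J in one case and to lq^{-(n+1)}J in the other, where l = q^{1-N}; for q ≠
1 these agree only if J = 0. -/
lemma eq_zero_of_contract_eq_zero (hN : 1 ≤ N) (hq : 0 < q) (hq1 : q ≠ 1) {n : ℕ}
    {J : QTensor N (n + 2)} (hi : IsInvariant q J) (hs : IsSymmetric q J)
    (hc : contract q 0 J = 0) : J = 0 := by
  have D := braidData hN hq
  have hw := hs.isWordSymmetric
  have hc0 : ∀ v, ∑ a, ∑ b, metric N q a b * ofTensor J (a :: b :: v) = 0 := by
    intro v
    by_cases hv : v.length = n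
    · obtain ⟨i, rfl⟩ := exists_ofFn hv
      rw [← contract_zero_ofTensor, hc, Pi.zero_apply]
    · have h : ∀ a b, ofTensor J (a :: b :: v) = 0 := fun a b =>
        ofTensor_of_length_ne J fun h' => hv (by simpa using h')
      simp [h]
  have hcc := hw.contract_eq_zero hN hq hc0
  have key : ∀ (i' : Fin (n + 1) → Fin N) (c : Fin N),
      (qpow q (1 - N))⁻¹ * ((q : ℂ) ^ (n + 1) * ofTensor J (List.ofFn i' ++ [c]))
        = qpow q (1 - N) * ((q : ℂ)⁻¹ ^ (n + 1) * ofTensor J (List.ofFn i' ++ [c])) := by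
    intro i' c
    have h1 := D.sum_twisted_sweep (D.isEigenTensor hw hcc) (List.ofFn i') c
    have h2 := D.symm.sum_twisted_sweep (D.symm.isEigenTensor hw hcc) (List.ofFn i') c
    have e1 : ∀ i b, sweep (braid N q) (i :: List.ofFn i') (ofTensor J) b c
        = sweep (braidInv N q) (i :: List.ofFn i') (ofTensor J) b c := by
      intro i b
      rw [← List.ofFn_cons, hi.sweep_eq (braid_representation hN hq) D.cap12_amp2_amp1,
        hi.sweep_eq (braidInv_representation hN hq) D.symm.cap12_amp2_amp1]
    simp only [e1] at h1
    rw [h1, inv_inv, List.length_ofFn] at h2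
    exact h2
  have hy : qpow q (1 - N) = (((q : ℝ) ^ (N - 1) : ℝ) : ℂ)⁻¹ := by
    rw [show (1 - N : ℝ) = -(((N - 1 : ℕ) : ℝ)) by push_cast [hN]; ring, qpow_neg hq, qpow,
      Real.rpow_natCast]
  funext i
  obtain ⟨L, c, hL⟩ : ∃ L c, List.ofFn i = L ++ [c] := by
    rcases List.eq_nil_or_concat (List.ofFn i) with h | ⟨L, c, h⟩
    · simp at h
    · exact ⟨L, c, by simpa using h⟩
  obtain ⟨i', rfl⟩ := exists_ofFn (n := n + 1) (L := L) (by
    have := congrArg List.length hL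
    simpa using this.symm)
  have h := key i' c
  rw [← hL, ofTensor_ofFn, hy, inv_inv] at h
  by_contra hJ
  have hJ' : J i ≠ 0 := hJ
  have hp : (0 : ℝ) < q ^ (N - 1) * q ^ (n + 1) := by positivity
  have h1 : ((q ^ (N - 1) * q ^ (n + 1) : ℝ) : ℂ) = ((q ^ (N - 1) * q ^ (n + 1) : ℝ) : ℂ)⁻¹ := by
    refine mul_right_cancel₀ hJ' ?_
    push_cast at h ⊢
    rw [mul_assoc, h, mul_inv, inv_pow, mul_assoc]
  have h2 : (q ^ (N - 1) * q ^ (n + 1)) = (q ^ (N - 1) * q ^ (n + 1))⁻¹ := by exact_mod_cast h1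
  -- A positive number equal to its inverse is 1; the total exponent N + n is positive, so q would
  -- be 1.
  have h3 : (q ^ (N - 1) * q ^ (n + 1)) = 1 := by
    have h4 : (q ^ (N - 1) * q ^ (n + 1)) * (q ^ (N - 1) * q ^ (n + 1)) = 1 := by
      nth_rewrite 1 [h2]
      exact inv_mul_cancel₀ hp.ne'
    rcases mul_self_eq_one_iff.1 h4 with h5 | h5
    · exact h5
    · linarith
  rw [← pow_add] at h3
  exact hq1 ((pow_eq_one_iff_of_nonneg hq.le (by omega)).1 h3)

/-- Every defining relation is even in the generators, so A ↦ -1 is a character; it forces J = -J in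
odd rank. -/
lemma IsInvariant.eq_zero_of_odd {n : ℕ} (hn : Odd n) {J : QTensor N n} (hJ : IsInvariant q J) :
    J = 0 := by
  obtain ⟨φ, hφ⟩ := Oq.exists_lift (q := q) (B := ℂ) (fun i j : Fin N => if i = j then -1 else 0)
    (by intro i k j l; simp) (by intro k l; simp)
  funext i
  have h := congrArg φ (hJ i)
  simp only [map_sum, map_smul, map_list_prod, List.map_ofFn, Function.comp_def, hφ,
    AlgHom.commutes, List.prod_ofFn, smul_eq_mul] at h
  rw [Finset.sum_eq_single i] at h
  · simp only [if_true, Finset.prod_const, Finset.card_univ, Fintype.card_fin, hn.neg_one_pow,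
      Algebra.algebraMap_self, RingHom.id_apply] at h
    have : (2 : ℂ) * J i = 0 := by linear_combination -h
    simpa using this
  · intro j _ hj
    obtain ⟨k, hk⟩ := Function.ne_iff.1 hj.symm
    rw [Finset.prod_eq_zero (Finset.mem_univ k) (if_neg hk), mul_zero]
  · simp

/-- For `q ≠ 1` a symmetric invariant tensor is determined by its contraction. -/
lemma eq_smul_of_contract (hN : 1 ≤ N) (hq : 0 < q) (hq1 : q ≠ 1) {n : ℕ} {I : QTensor N n}
    {I' J : QTensor N (n + 2)} (hI : IsInvariant q I') (hIs : IsSymmetric q I')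
    (hIc : contract q 0 I' = I) (hi : IsInvariant q J) (hs : IsSymmetric q J) {c : ℂ}
    (hc : contract q 0 J = c • I) : J = c • I' := by
  refine sub_eq_zero.1 (eq_zero_of_contract_eq_zero hN hq hq1 (hi.sub (hI.smul c))
    (hs.sub (hIs.smul c)) ?_)
  rw [contract_sub, contract_smul, hIc, hc, sub_self]

end QSphere

/-! ### Analytic families of invariant tensors and their uniqueness. -/

namespace QSphere

variable {N : ℕ} {q : ℝ}

/-- Symmetric invariant tensors of even rank, normalized and analytic in `q`. -/
structure IsInvariantFamily (N : ℕ) (I : (n : ℕ) → ℝ → QTensor N n) : Prop where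
  analytic : ∀ n, Even n → AnalyticOnNhd ℝ (I n) (Set.Ioi 0)
  invariant : ∀ n, Even n → ∀ q, 0 < q → IsInvariant q (I n q)
  symmetric : ∀ n, Even n → ∀ q, 0 < q → IsSymmetric q (I n q)
  contract : ∀ n, Even n → ∀ q, 0 < q → ∀ l, contract q l (I (n + 2) q) = I n q
  zero : ∀ q, 0 < q → I 0 q = 1

lemma CalcFamily.isInvariantFamily {R S : ℝ → Matrix (Fin N × Fin N) (Fin N × Fin N) ℂ}
    {z l : ℝ → ℂ} {d : (q : ℝ) → Fin N → (Eucl N q →ₗ[ℂ] Eucl N q)} (C : CalcFamily N R S z l d)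
    (hR : ∀ q, 0 < q → Commute (Oq.scalar N q (R q)) (Oq.AA N q)) (hN : 1 ≤ N) :
    IsInvariantFamily N (lapTensor z l d) where
  analytic _ hn := C.analytic_lapTensor hN hn
  invariant _ hn _ hq := C.isInvariant_lapTensor hR hN hq hn
  symmetric n _ _ _ := CalcFamily.isSymmetric_lapTensor n
  contract _ hn _ hq l := C.contract_lapTensor hN hq hn l
  zero _ _ := CalcFamily.lapTensor_zero

lemma exists_calcFamily_braid (hN : 1 ≤ N) : ∃ d, CalcFamily N (braid N) (braidInv N)
    (fun q => (q : ℂ)) (fun q => qpow q (1 - N)) d := by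
  -- The family is indexed by all real q; for q ≤ 0 the operators are set to zero.
  have h : ∀ q : ℝ, ∃ d, 0 < q → IsCalculus N q ((q : ℂ)⁻¹ • braid N q) d := fun q => by
    by_cases hq : 0 < q
    · obtain ⟨d, hd⟩ := exists_isCalculus (braidData hN hq)
      exact ⟨d, fun _ => hd⟩
    · exact ⟨0, fun h => absurd h hq⟩
  choose d hd using h
  exact ⟨d, fun q hq => braidData hN hq, hd, fun q hq => ⟨q, q ^ (1 - N : ℝ), hq,
    Real.rpow_pos_of_pos hq _, rfl, rfl⟩, analyticOnNhd_braid, analyticOnNhd_ofReal,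
    analyticOnNhd_qpow _⟩

lemma exists_calcFamily_braidInv (hN : 1 ≤ N) : ∃ d, CalcFamily N (braidInv N) (braid N)
    (fun q => (q : ℂ)⁻¹) (fun q => (qpow q (1 - N))⁻¹) d := by
  have h : ∀ q : ℝ, ∃ d, 0 < q → IsCalculus N q (((q : ℂ)⁻¹)⁻¹ • braidInv N q) d := fun q => by
    by_cases hq : 0 < q
    · obtain ⟨d, hd⟩ := exists_isCalculus (braidData hN hq).symm
      exact ⟨d, fun _ => hd⟩
    · exact ⟨0, fun h => absurd h hq⟩
  choose d hd using h
  exact ⟨d, fun q hq => (braidData hN hq).symm, hd, fun q hq => ⟨q⁻¹, (q ^ (1 - N : ℝ))⁻¹,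
    inv_pos.2 hq, inv_pos.2 (Real.rpow_pos_of_pos hq _), by simp, by simp [qpow]⟩,
    analyticOnNhd_braidInv, analyticOnNhd_ofReal_inv,
    (analyticOnNhd_qpow _).inv fun q hq => qpow_ne_zero hq _⟩

lemma AnalyticOnNhd.contract_zero {U : Set ℝ} (hU : U ⊆ Set.Ioi 0) {n : ℕ}
    {J : ℝ → QTensor N (n + 2)} (hJ : AnalyticOnNhd ℝ J U) :
    AnalyticOnNhd ℝ (fun q => contract q 0 (J q)) U := by
  refine AnalyticOnNhd.pi fun i => ?_
  simp only [contract_zero_apply]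
  exact analyticOnNhd_finset_sum _ fun a _ => analyticOnNhd_finset_sum _ fun b _ =>
    ((analyticOnNhd_metric a b).mono hU).mul (analyticOnNhd_pi_iff.1 hJ _)

namespace IsInvariantFamily

variable {I : (n : ℕ) → ℝ → QTensor N n} (hI : IsInvariantFamily N I)
include hI

lemma ne_zero (hq : 0 < q) {n : ℕ} (hn : Even n) : I n q ≠ 0 := by
  obtain ⟨m, hm⟩ := hn
  obtain rfl : n = 2 * m := by omega
  induction m with
  | zero =>
    intro h
    have h2 := congrFun (h.symm.trans (hI.zero q hq)) Fin.elim0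
    simp at h2
  | succ m ih =>
    intro h
    refine ih (by omega) ?_
    rw [← hI.contract (2 * m) (even_two_mul m) q hq 0]
    funext i
    have h' : I (2 * m + 2) q = 0 := h
    simp [QSphere.contract, h']

/-- Analytic families of symmetric invariant tensors are determined by their contraction. -/
lemma eq_smul_of_contract (hN : 1 ≤ N) {U : Set ℝ} (hU : IsOpen U) (hU0 : U ⊆ Set.Ioi 0)
    {n : ℕ} (hn : Even n) {J : ℝ → QTensor N (n + 2)} (hJ : AnalyticOnNhd ℝ J U)
    (hJi : ∀ q ∈ U, IsInvariant q (J q) ∧ IsSymmetric q (J q)) {f : ℝ → ℂ}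
    (hf : AnalyticOnNhd ℝ f U) (hc : ∀ q ∈ U, QSphere.contract q 0 (J q) = f q • I n q) :
    ∀ q ∈ U, J q = f q • I (n + 2) q := by
  have hn2 : Even (n + 2) := hn.add even_two
  have h : ∀ q ∈ U, q ≠ 1 → J q = f q • I (n + 2) q := fun q hq hq1 =>
    QSphere.eq_smul_of_contract hN (hU0 hq) hq1 (hI.invariant _ hn2 q (hU0 hq))
      (hI.symmetric _ hn2 q (hU0 hq)) (hI.contract n hn q (hU0 hq) 0) (hJi q hq).1 (hJi q hq).2
      (hc q hq)
  intro q hq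
  by_cases hq1 : q = 1
  · subst hq1
    -- At q = 1 the rigidity argument is empty; both sides are continuous there and agree at all
    -- other points of U.
    have h1 : Filter.Tendsto J (nhdsWithin 1 {1}ᶜ) (nhds (J 1)) :=
      (hJ 1 hq).continuousAt.tendsto.mono_left nhdsWithin_le_nhds
    have h2 : Filter.Tendsto (fun q => f q • I (n + 2) q) (nhdsWithin 1 {1}ᶜ)
        (nhds (f 1 • I (n + 2) 1)) :=
      ((hf 1 hq).continuousAt.smul
        (hI.analytic _ hn2 1 (hU0 hq)).continuousAt).tendsto.mono_left nhdsWithin_le_nhds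
    refine tendsto_nhds_unique h1 (h2.congr' ?_)
    filter_upwards [nhdsWithin_le_nhds (hU.mem_nhds hq), self_mem_nhdsWithin] with t ht ht1
    exact (h t ht ht1).symm
  · exact h q hq hq1

/-- The function f is the full contraction of J, analytic because the metric is. Connectedness of U
plays no role, as the argument is pointwise away from q = 1. -/
lemma exists_eq_smul (hN : 1 ≤ N) {U : Set ℝ} (hU : IsOpen U) (hU0 : U ⊆ Set.Ioi 0)
    {n : ℕ} (hn : Even n) {J : ℝ → QTensor N n} (hJ : AnalyticOnNhd ℝ J U)
    (hJi : ∀ q ∈ U, IsInvariant q (J q) ∧ IsSymmetric q (J q)) :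
    ∃ f : ℝ → ℂ, AnalyticOnNhd ℝ f U ∧ ∀ q ∈ U, J q = f q • I n q := by
  obtain ⟨m, hm⟩ := hn
  obtain rfl : n = 2 * m := by omega
  clear hm
  induction m with
  | zero =>
    refine ⟨fun q => J q Fin.elim0, analyticOnNhd_pi_iff.1 hJ _, fun q hq => funext fun i => ?_⟩
    have h0 : I (2 * 0) q = 1 := hI.zero q (hU0 hq)
    rw [h0, show i = Fin.elim0 from funext fun k => k.elim0]
    simp
  | succ m ih =>
    have hJ' : AnalyticOnNhd ℝ (fun q => QSphere.contract q 0 (n := 2 * m) (J q)) U :=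
      AnalyticOnNhd.contract_zero hU0 (n := 2 * m) hJ
    obtain ⟨f, hf, h⟩ := ih hJ' fun q hq =>
      ⟨IsInvariant.contract_zero (n := 2 * m) (hJi q hq).1,
        IsSymmetric.contract_zero (n := 2 * m) (hJi q hq).2⟩
    exact ⟨f, hf, hI.eq_smul_of_contract hN hU hU0 (n := 2 * m) (even_two_mul m) hJ hJi hf h⟩

/-- Used to identify the tensors obtained from the two calculi. -/
lemma unique (hN : 1 ≤ N) {I' : (n : ℕ) → ℝ → QTensor N n} (hI' : IsInvariantFamily N I') {n : ℕ}
    (hn : Even n) (hq : 0 < q) : I n q = I' n q := by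
  obtain ⟨m, hm⟩ := hn
  obtain rfl : n = 2 * m := by omega
  clear hm
  induction m generalizing q with
  | zero => exact (hI.zero q hq).trans (hI'.zero q hq).symm
  | succ m ih =>
    have h := hI.eq_smul_of_contract hN isOpen_Ioi subset_rfl (even_two_mul m)
      (hI'.analytic (2 * m + 2) (by simp [Nat.even_add]))
      (fun q hq => ⟨hI'.invariant _ (by simp [Nat.even_add]) q hq,
        hI'.symmetric _ (by simp [Nat.even_add]) q hq⟩) (f := fun _ => 1) analyticOnNhd_const
      (fun q hq => by rw [one_smul, hI'.contract _ (even_two_mul m) q hq, ih hq]) q hq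
    rw [one_smul] at h
    exact h.symm

end IsInvariantFamily

lemma CalcFamily.lapTensor_two {R S : ℝ → Matrix (Fin N × Fin N) (Fin N × Fin N) ℂ}
    {z l : ℝ → ℂ} {d : (q : ℝ) → Fin N → (Eucl N q →ₗ[ℂ] Eucl N q)} (C : CalcFamily N R S z l d)
    (hN : 1 ≤ N) (hq : 0 < q) : ∃ c : ℂ, c ≠ 0 ∧ ∀ i : Fin 2 → Fin N,
      lapTensor z l d 2 q i = c * metric N q (i 0) (i 1) := by
  -- The constant comes from Δ(x^i x^j) = μ g^{ij} with μ = 1 + z⁻¹l⁻¹, which is positive.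
  refine ⟨(lapNorm (z q) (l q) (metricSq N q) 1)⁻¹ * calcMu (z q) (l q),
    mul_ne_zero (inv_ne_zero (C.lapNorm_ne_zero hN hq 1)) ?_, fun i => ?_⟩
  · obtain ⟨x, y, hx, hy, h1, h2⟩ := C.pos q hq
    rw [calcMu, h1, h2]
    have : (0 : ℝ) < 1 + x⁻¹ * y⁻¹ := by positivity
    exact_mod_cast this.ne'
  · have hd := C.isCalculus q hq
    have e : word (Eucl.x N q) i = Eucl.x N q (i 0) * (Eucl.x N q (i 1) * 1) := by
      simp [word_eq_prod_map]
    rw [lapTensor, show 2 / 2 = 1 from rfl, pow_one, e, laplacian_x (C.data q hq) hd, hd.leibniz,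
      laplacian_x (C.data q hq) hd, laplacian_one hd]
    simp [hd.map_one, mul_assoc]

/-- The factor λ_n is the inverse of `lapNorm`. The calculus is unique and so are normalized
families, hence any family `I` and any system of derivatives may be compared with those used in the
construction. -/
lemma CalcFamily.laplacian_pow_word {R S : ℝ → Matrix (Fin N × Fin N) (Fin N × Fin N) ℂ}
    {z l : ℝ → ℂ} {d : (q : ℝ) → Fin N → (Eucl N q →ₗ[ℂ] Eucl N q)} (C : CalcFamily N R S z l d)
    (hR : ∀ q, 0 < q → Commute (Oq.scalar N q (R q)) (Oq.AA N q)) (hN : 1 ≤ N)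
    {I : (n : ℕ) → ℝ → QTensor N n} (hI : IsInvariantFamily N I)
    {B : ℝ → Matrix (Fin N × Fin N) (Fin N × Fin N) ℂ}
    (hB : ∀ q, 0 < q → B q = (z q)⁻¹ • R q) :
    (∀ q : ℝ, 0 < q → ∃! d, IsCalculus N q (B q) d) ∧
      ∀ n, Even n → ∃ lam : ℝ → ℂ, AnalyticOnNhd ℝ lam (Set.Ioi 0) ∧
        ∀ q : ℝ, 0 < q → ∀ d, IsCalculus N q (B q) d → ∀ i : Fin n → Fin N,
          lam q • (laplacian d ^ (n / 2)) (word (Eucl.x N q) i)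
            = algebraMap ℂ (Eucl N q) (I n q i) := by
  refine ⟨fun q hq => hB q hq ▸ existsUnique_isCalculus (C.data q hq), fun n hn =>
    ⟨_, C.analytic_lapNorm_inv hN (n / 2), fun q hq d' hd i => ?_⟩⟩
  rw [hB q hq] at hd
  obtain rfl := hd.unique (C.isCalculus q hq)
  rw [C.laplacian_word_eq hN hq hn, hI.unique hN (C.isInvariantFamily hR hN) hn hq, smul_smul,
    inv_mul_cancel_left₀ (C.lapNorm_ne_zero hN hq _), Algebra.algebraMap_eq_smul_one]

end QSphere

/-! ### Functionals on the quantum sphere and the invariant integral. -/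

namespace QSphere

variable {N : ℕ} {q : ℝ}

namespace Sphere

lemma induction {p : Sphere N q → Prop} (h1 : p 1) (hx : ∀ j f, p f → p (Sphere.t N q j * f))
    (hadd : ∀ f g, p f → p g → p (f + g)) (hsmul : ∀ (c : ℂ) f, p f → p (c • f))
    (f : Sphere N q) : p f :=
  freeAlgebra_quotient_induction (RingQuot.mkAlgHom ℂ (SphereRel N q))
    (RingQuot.mkAlgHom_surjective ℂ _) h1 hx hadd hsmul f

lemma t_relation (i j : Fin N) :
    ∑ k, ∑ l, projMinus N q (i, j) (k, l) • (Sphere.t N q k * Sphere.t N q l) = 0 := by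
  have h := RingQuot.mkAlgHom_rel ℂ (SphereRel.comm (N := N) (q := q) i j)
  simp only [map_sum, map_smul, map_mul, map_zero] at h
  exact h

lemma t_radius : ∑ i, ∑ j, metric N q i j • (Sphere.t N q i * Sphere.t N q j) = 1 := by
  have h := RingQuot.mkAlgHom_rel ℂ (SphereRel.radius (N := N) (q := q))
  simp only [map_sum, map_smul, map_mul, map_one] at h
  exact h

lemma exists_lift {A : Type*} [Semiring A] [Algebra ℂ A] (y : Fin N → A)
    (hy : ∀ i j, ∑ k, ∑ l, projMinus N q (i, j) (k, l) • (y k * y l) = 0)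
    (hr : ∑ i, ∑ j, metric N q i j • (y i * y j) = 1) :
    ∃ φ : Sphere N q →ₐ[ℂ] A, ∀ j, φ (Sphere.t N q j) = y j := by
  have h : ∀ ⦃a b⦄, SphereRel N q a b → FreeAlgebra.lift ℂ y a = FreeAlgebra.lift ℂ y b := by
    rintro _ _ (⟨i, j⟩ | _)
    · simpa only [map_sum, map_smul, map_mul, map_zero, FreeAlgebra.lift_ι_apply] using hy i j
    · simpa only [map_sum, map_smul, map_mul, map_one, FreeAlgebra.lift_ι_apply] using hr
  refine ⟨RingQuot.liftAlgHom ℂ ⟨FreeAlgebra.lift ℂ y, h⟩, fun j => ?_⟩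
  rw [Sphere.t, RingQuot.liftAlgHom_mkAlgHom_apply, FreeAlgebra.lift_ι_apply]

lemma functional_ext {φ ψ : Sphere N q →ₗ[ℂ] ℂ} (h : ∀ n, moments φ n = moments ψ n) : φ = ψ := by
  have key : ∀ f : Sphere N q, ∀ L : List (Fin N),
      φ ((L.map (Sphere.t N q)).prod * f) = ψ ((L.map (Sphere.t N q)).prod * f) := by
    intro f
    induction f using Sphere.induction with
    | h1 =>
      intro L
      obtain ⟨i, hi⟩ := exists_ofFn (L := L) rfl
      have h1 := congrFun (h L.length) i
      simp only [moments] at h1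
      rw [mul_one, hi, ← word_eq_prod_map]
      exact h1
    | hx j f hf =>
      intro L
      have h1 := hf (L ++ [j])
      simpa only [List.map_append, List.map_cons, List.map_nil, List.prod_append, List.prod_singleton,
        mul_assoc] using h1
    | hadd f g hf hg => intro L; rw [mul_add, map_add, map_add, hf, hg]
    | hsmul c f hf => intro L; rw [mul_smul_comm, map_smul, map_smul, hf]
  refine LinearMap.ext fun f => ?_
  simpa using key f []

end Sphere

/-- Functions on words with the symmetry and the contractions of monomials on the quantum
sphere. -/
def sphereWords (N : ℕ) (q : ℝ) : Submodule ℂ (List (Fin N) → ℂ) where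
  carrier := {c | IsWordSymmetric q c ∧
    ∀ u v, ∑ a, ∑ b, metric N q a b * c (u ++ a :: b :: v) = c (u ++ v)}
  zero_mem' := ⟨(symWords N q).zero_mem, fun u v => by simp⟩
  add_mem' {a b} ha hb := ⟨(symWords N q).add_mem ha.1 hb.1, fun u v => by
    simp only [Pi.add_apply, mul_add, Finset.sum_add_distrib, ha.2 u v, hb.2 u v]⟩
  smul_mem' t a ha := ⟨(symWords N q).smul_mem t ha.1, fun u v => by
    simp only [Pi.smul_apply, smul_eq_mul, mul_left_comm _ t, ← Finset.mul_sum, ha.2 u v]⟩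

lemma wordShift_mem_sphereWords (k : Fin N) (c : List (Fin N) → ℂ) (hc : c ∈ sphereWords N q) :
    wordShift k c ∈ sphereWords N q := by
  refine ⟨wordShift_mem_symWords k c hc.1, fun u v => ?_⟩
  have h := hc.2 u (v ++ [k])
  simpa only [wordShift_apply, List.append_assoc, List.cons_append] using h

lemma Sphere.exists_functional {c : List (Fin N) → ℂ} (hc : c ∈ sphereWords N q) :
    ∃ f : Sphere N q →ₗ[ℂ] ℂ, ∀ L : List (Fin N), f (L.map (Sphere.t N q)).prod = c L := by
  obtain ⟨φ, hφ⟩ := Sphere.exists_lift (q := q) (fun k : Fin N => (wordShift k).restrict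
    (wordShift_mem_sphereWords (q := q) k)) (by
      intro i j
      refine LinearMap.ext fun c => Subtype.ext (funext fun L => ?_)
      have h := c.2.1 L [] i j
      simpa [LinearMap.sum_apply, Finset.sum_apply, wordShift_apply] using h) (by
      refine LinearMap.ext fun c => Subtype.ext (funext fun L => ?_)
      have h := c.2.2 L []
      simpa [LinearMap.sum_apply, Finset.sum_apply, wordShift_apply] using h)
  exact exists_functional_of_hom (Sphere.t N q) (sphereWords N q) wordShift_mem_sphereWords φ hφ hc

lemma isSymmetric_moments (φ : Sphere N q →ₗ[ℂ] ℂ) (n : ℕ) : IsSymmetric q (moments φ n) :=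
  isSymmetric_functional Sphere.t_relation φ

lemma contract_moments (φ : Sphere N q →ₗ[ℂ] ℂ) (n : ℕ) (l : Fin (n + 1)) :
    contract q l (moments φ (n + 2)) = moments φ n := by
  funext i
  refine (contract_functional (y := Sphere.t N q) φ (fun k => ?_) l i).trans ?_
  · rw [Sphere.t_radius]; exact Commute.one_left _
  · rw [Sphere.t_radius, one_mul]; rfl

lemma moments_zero (φ : Sphere N q →ₗ[ℂ] ℂ) (i : Fin 0 → Fin N) : moments φ 0 i = φ 1 := by
  simp [moments]

namespace IsInvariantFamily

variable {I : (n : ℕ) → ℝ → QTensor N n} (hI : IsInvariantFamily N I)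
include hI

/-- Symmetry and the contractions at all positions are exactly what makes the even tensors, extended
by zero to odd words, a function compatible with the relations of the sphere. -/
lemma exists_sphere_functional (hq : 0 < q) : ∃ φ : Sphere N q →ₗ[ℂ] ℂ,
    (∀ n, Even n → moments φ n = I n q) ∧ ∀ n, Odd n → moments φ n = 0 := by
  classical
  obtain ⟨c, hval⟩ : ∃ c : List (Fin N) → ℂ, ∀ n L, L.length = n →
      c L = if Even n then ofTensor (I n q) L else 0 :=
    ⟨fun L => if Even L.length then ofTensor (I L.length q) L else 0, by rintro n L rfl; rfl⟩
  have hc : c ∈ sphereWords N q := by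
    have hlen : ∀ (u v : List (Fin N)) (a b : Fin N), c (u ++ a :: b :: v)
        = if Even (u ++ v).length then ofTensor (I ((u ++ v).length + 2) q) (u ++ a :: b :: v)
          else 0 := fun u v a b => by
      rw [hval ((u ++ v).length + 2) _ (by
        simp only [List.length_append, List.length_cons]; omega)]
      exact if_congr (by simp [Nat.even_add]) rfl rfl
    refine ⟨fun u v i j => ?_, fun u v => ?_⟩
    · simp only [hlen]
      split_ifs with h
      · exact (hI.symmetric _ (h.add even_two) q hq).isWordSymmetric u v i j
      · simp
    · rw [hval (u ++ v).length _ rfl]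
      simp only [hlen]
      split_ifs with h
      · have hl : u.length < (u ++ v).length + 1 := by
          rw [List.length_append]; omega
        obtain ⟨i, hi⟩ := exists_ofFn (L := u ++ v) rfl
        have h1 := congrFun (hI.contract _ h q hq ⟨u.length, hl⟩) i
        have h2 := contract_list (q := q) (ofTensor (I ((u ++ v).length + 2) q)) ⟨u.length, hl⟩ i
        simp only [ofTensor_ofFn] at h2
        have h3 := h2.symm.trans h1
        simp only [← hi, List.take_left, List.drop_left] at h3
        rw [h3, ← ofTensor_ofFn (I _ q) i, ← hi]
      · simp
  obtain ⟨φ, hφ⟩ := Sphere.exists_functional hc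
  have hm : ∀ n (i : Fin n → Fin N), moments φ n i = if Even n then I n q i else 0 := by
    intro n i
    have h : moments φ n i = φ ((List.ofFn i).map (Sphere.t N q)).prod := by
      rw [← word_eq_prod_map]; rfl
    rw [h, hφ, hval n _ (List.length_ofFn), ofTensor_ofFn]
  exact ⟨φ, fun n hn => funext fun i => by rw [hm, if_pos hn],
    fun n hn => funext fun i => by rw [hm, if_neg (Nat.not_even_iff_odd.2 hn)]; rfl⟩

/-- The relation r² = 1 makes the moments contract to one another, so the factor relating them to
the family is the same in every rank, namely its value in rank zero. -/
lemma moments_eq (hN : 1 ≤ N) {U : Set ℝ} (hU : IsOpen U) (hU0 : U ⊆ Set.Ioi 0)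
    {Ψ : (q : ℝ) → (Sphere N q →ₗ[ℂ] ℂ)} (hΨ : IsInvariantIntegral N U Ψ) {n : ℕ} (hn : Even n) :
    ∀ q ∈ U, moments (Ψ q) n = Ψ q 1 • I n q := by
  obtain ⟨m, hm⟩ := hn
  obtain rfl : n = 2 * m := by omega
  clear hm
  have hf : AnalyticOnNhd ℝ (fun q => Ψ q 1) U := by
    have h := analyticOnNhd_pi_iff.1 (hΨ 0).1 Fin.elim0
    simpa only [moments_zero] using h
  induction m with
  | zero =>
    intro q hq
    funext i
    have h0 : I (2 * 0) q = 1 := hI.zero q (hU0 hq)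
    rw [h0, Pi.smul_apply, Pi.one_apply, smul_eq_mul, mul_one]
    exact moments_zero (Ψ q) i
  | succ m ih =>
    refine hI.eq_smul_of_contract hN hU hU0 (n := 2 * m) (even_two_mul m) (hΨ (2 * m + 2)).1
      (fun q hq => ⟨(hΨ (2 * m + 2)).2 q hq, isSymmetric_moments _ _⟩) hf fun q hq => ?_
    rw [contract_moments, ih q hq]

/-- The invariant integral on the quantum sphere. -/
lemma exists_integral (hN : 1 ≤ N) : ∃ Φ : (q : ℝ) → (Sphere N q →ₗ[ℂ] ℂ),
    IsInvariantIntegral N (Set.Ioi 0) Φ ∧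
    (∀ q : ℝ, 0 < q → Φ q 1 = 1 ∧ (∀ n, Even n → moments (Φ q) n = I n q) ∧
      ∀ n, Odd n → moments (Φ q) n = 0) ∧
    ∀ U : Set ℝ, IsOpen U → U ⊆ Set.Ioi 0 → ∀ Ψ : (q : ℝ) → (Sphere N q →ₗ[ℂ] ℂ),
      IsInvariantIntegral N U Ψ → ∀ q ∈ U, Ψ q = Ψ q 1 • Φ q := by
  have h : ∀ q : ℝ, ∃ φ : Sphere N q →ₗ[ℂ] ℂ, 0 < q →
      (∀ n, Even n → moments φ n = I n q) ∧ ∀ n, Odd n → moments φ n = 0 := fun q => by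
    by_cases hq : 0 < q
    · obtain ⟨φ, hφ⟩ := hI.exists_sphere_functional hq
      exact ⟨φ, fun _ => hφ⟩
    · exact ⟨0, fun h => absurd h hq⟩
  choose Φ hΦ using h
  refine ⟨Φ, fun n => ?_, fun q hq => ⟨?_, hΦ q hq⟩, fun U hU hU0 Ψ hΨ q hq => ?_⟩
  · rcases Nat.even_or_odd n with hn | hn
    · refine ⟨(hI.analytic n hn).congr isOpen_Ioi fun q hq => ((hΦ q hq).1 n hn).symm,
        fun q hq => ?_⟩
      rw [(hΦ q hq).1 n hn]
      exact hI.invariant n hn q hq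
    · refine ⟨(analyticOnNhd_const (v := (0 : QTensor N n))).congr isOpen_Ioi
        fun q hq => ((hΦ q hq).2 n hn).symm, fun q hq => ?_⟩
      rw [(hΦ q hq).2 n hn]
      intro i
      simp
  · rw [← moments_zero (Φ q) Fin.elim0, (hΦ q hq).1 0 (Even.zero), hI.zero q hq]
    rfl
  · refine Sphere.functional_ext fun n => ?_
    have h1 : moments (Ψ q 1 • Φ q) n = Ψ q 1 • moments (Φ q) n := rfl
    rw [h1]
    rcases Nat.even_or_odd n with hn | hn
    · rw [(hΦ q (hU0 hq)).1 n hn, hI.moments_eq hN hU hU0 hΨ hn q hq]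
    · rw [(hΦ q (hU0 hq)).2 n hn, smul_zero, ((hΨ n).2 q hq).eq_zero_of_odd hn]

end IsInvariantFamily

end QSphere

namespace QSphere

/-! ### The classical limit. -/

section Permutations

/-- The permutation with value `j` at `0` that is otherwise given by the permutation `t` of the
remaining elements. -/
def consPerm {n : ℕ} (j : Fin (n + 1)) (t : Equiv.Perm (Fin n)) : Equiv.Perm (Fin (n + 1)) :=
  j.cycleRange.symm * Equiv.Perm.decomposeFin.symm (0, t)

lemma consPerm_zero {n : ℕ} (j : Fin (n + 1)) (t : Equiv.Perm (Fin n)) : consPerm j t 0 = j := by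
  simp [consPerm]

lemma consPerm_succ {n : ℕ} (j : Fin (n + 1)) (t : Equiv.Perm (Fin n)) (k : Fin n) :
    consPerm j t k.succ = j.succAbove (t k) := by
  simp [consPerm]

lemma bijective_consPerm (n : ℕ) : Function.Bijective
    fun p : Fin (n + 1) × Equiv.Perm (Fin n) => consPerm p.1 p.2 := by
  refine (Fintype.bijective_iff_injective_and_card _).2 ⟨fun p r h => ?_, ?_⟩
  · have h1 : ∀ k, consPerm p.1 p.2 k = consPerm r.1 r.2 k := fun k => by
      exact congrArg (fun s : Equiv.Perm (Fin (n + 1)) => s k) h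
    have h2 : p.1 = r.1 := by simpa only [consPerm_zero] using h1 0
    refine Prod.ext h2 (Equiv.ext fun k => ?_)
    have h3 := h1 k.succ
    rw [consPerm_succ, consPerm_succ, h2] at h3
    exact Fin.succAbove_right_injective h3
  · rw [Fintype.card_prod, Fintype.card_fin, Fintype.card_perm, Fintype.card_perm,
      Fintype.card_fin, Fintype.card_fin, Nat.factorial_succ]

lemma sum_perm_succ {n : ℕ} (F : Equiv.Perm (Fin (n + 1)) → ℂ) :
    ∑ s, F s = ∑ j, ∑ t, F (consPerm j t) := by
  rw [← Fintype.sum_prod_type' (f := fun j t => F (consPerm j t))]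
  exact (Fintype.sum_bijective _ (bijective_consPerm n) _ _ fun _ => rfl).symm

end Permutations

variable {N : ℕ}

/-- The product of the entries of the classical metric over consecutive pairs of indices. -/
def pairProd (N m : ℕ) (v : Fin (2 * m) → Fin N) : ℂ :=
  ∏ k : Fin m, metric N 1 (v ⟨2 * k, by omega⟩) (v ⟨2 * k + 1, by omega⟩)

lemma pairProd_succ (m : ℕ) (v : Fin (2 * m + 1 + 1) → Fin N) :
    pairProd N (m + 1) v = metric N 1 (v 0) (v 1) * pairProd N m fun t => v t.succ.succ := by
  rw [pairProd, Fin.prod_univ_succ]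
  rfl

/-- Splits a permutation into its first two values and a permutation of the rest, in the same shape
as a Laplacian that removes two letters from a monomial. -/
lemma sum_pairProd_succ (m : ℕ) (i : Fin (2 * m + 1 + 1) → Fin N) :
    ∑ s : Equiv.Perm (Fin (2 * m + 1 + 1)), pairProd N (m + 1) (fun k => i (s k))
      = ∑ j, ∑ j', metric N 1 (i j) (i (j.succAbove j')) * ∑ t : Equiv.Perm (Fin (2 * m)),
        pairProd N m fun k => i (j.succAbove (j'.succAbove (t k))) := by
  rw [sum_perm_succ]
  refine Finset.sum_congr rfl fun j _ => ?_
  rw [sum_perm_succ]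
  refine Finset.sum_congr rfl fun j' _ => ?_
  rw [Finset.mul_sum]
  refine Finset.sum_congr rfl fun t _ => ?_
  rw [pairProd_succ]
  simp only [consPerm_zero, consPerm_succ, show (1 : Fin (2 * m + 1 + 1)) = Fin.succ 0 from rfl]

section ClassicalLimit

variable {d : Fin N → (Eucl N 1 →ₗ[ℂ] Eucl N 1)} (hd : IsCalculus N 1 (braid N 1) d)
include hd

/-- At q = 1 the braid matrix is the flip, so the Leibniz rule is that of a derivation. -/
lemma classical_leibniz (i j : Fin N) (f : Eucl N 1) :
    d i (Eucl.x N 1 j * f) = metric N 1 i j • f + Eucl.x N 1 j * d i f := by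
  rw [hd.leibniz]
  simp [braid, rMatrix, ite_and]

lemma classical_d_word (a : Fin N) {n : ℕ} (i : Fin (n + 1) → Fin N) :
    d a (word (Eucl.x N 1) i)
      = ∑ j, metric N 1 a (i j) • word (Eucl.x N 1) fun k => i (j.succAbove k) := by
  induction n with
  | zero =>
    rw [word_succ, classical_leibniz hd, word_zero, hd.map_one, mul_zero, add_zero]
    simp [word_zero]
  | succ n ih =>
    rw [word_succ, classical_leibniz hd, ih, Finset.mul_sum]
    conv_rhs => rw [Fin.sum_univ_succ]
    congr 1
    refine Finset.sum_congr rfl fun j _ => ?_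
    rw [mul_smul_comm, word_succ _ (fun k => i (j.succ.succAbove k))]
    unfold Fin.tail
    simp

lemma classical_laplacian_word {n : ℕ} (i : Fin (n + 1 + 1) → Fin N) :
    laplacian d (word (Eucl.x N 1) i) = ∑ j, ∑ j', metric N 1 (i j) (i (j.succAbove j')) •
      word (Eucl.x N 1) fun k => i (j.succAbove (j'.succAbove k)) := by
  -- Two derivatives remove two letters with one metric each; contracted with the metric of Δ, these
  -- reduce to a single metric.
  have hg : ∀ u w, ∑ a, ∑ b, metric N 1 a b * (metric N 1 b u * metric N 1 a w)
      = metric N 1 u w := by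
    intro u w
    have h : ∀ a, ∑ b, metric N 1 a b * metric N 1 b u = if a = u then 1 else 0 := fun a => by
      rw [← Matrix.mul_apply, metric_mul_self N one_pos, Matrix.one_apply]
    simp only [← mul_assoc, ← Finset.sum_mul, h]
    simp
  rw [laplacian_apply]
  simp only [classical_d_word hd, map_sum, map_smul, Finset.smul_sum, smul_smul]
  calc _ = ∑ j, ∑ j', (∑ a, ∑ b, metric N 1 a b * (metric N 1 b (i j) *
        metric N 1 a (i (j.succAbove j')))) •
      word (Eucl.x N 1) (fun k => i (j.succAbove (j'.succAbove k))) := by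
        simp only [Finset.sum_smul]
        rw [Finset.sum_comm_cycle]
        refine Finset.sum_congr rfl fun j _ => ?_
        rw [Finset.sum_comm_cycle]
    _ = _ := by simp only [hg]

lemma classical_laplacian_pow_word (m : ℕ) (i : Fin (2 * m) → Fin N) :
    (laplacian d ^ m) (word (Eucl.x N 1) i)
      = (∑ s : Equiv.Perm (Fin (2 * m)), pairProd N m fun k => i (s k)) • 1 := by
  induction m with
  | zero => simp [pairProd, word]
  | succ m ih =>
    have h := classical_laplacian_word hd (n := 2 * m) i
    rw [laplacian_pow_succ_apply', h]
    simp only [map_sum, map_smul, ih]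
    rw [show (∑ s : Equiv.Perm (Fin (2 * (m + 1))), pairProd N (m + 1) fun k => i (s k)) = _ from
      sum_pairProd_succ m i]
    simp only [Finset.sum_smul, mul_smul]

end ClassicalLimit

/-- The classical constant in Δ^m(r² f) for f of degree 2m - 2, with E in the role of the dimension;
the product over m gives the denominator of the classical tensor. -/
lemma lapConst_one (E : ℂ) (m : ℕ) : lapConst 1 1 E m = 2 * m * (E + 2 * m - 2) := by
  induction m with
  | zero => simp [lapConst]
  | succ m ih =>
    rw [lapConst, ih]
    simp [calcMu, qnum]
    ring

lemma lapNorm_one (E : ℂ) (m : ℕ) :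
    lapNorm 1 1 E m = 2 ^ m * (m.factorial : ℂ) * ∏ k ∈ Finset.range m, (E + 2 * k) := by
  induction m with
  | zero => simp [lapNorm]
  | succ m ih =>
    rw [lapNorm, Finset.prod_range_succ, ← lapNorm, ih, lapConst_one, Finset.prod_range_succ,
      Nat.factorial_succ]
    push_cast
    ring

lemma CalcFamily.lapTensor_one {S : ℝ → Matrix (Fin N × Fin N) (Fin N × Fin N) ℂ}
    {d : (q : ℝ) → Fin N → (Eucl N q →ₗ[ℂ] Eucl N q)}
    (C : CalcFamily N (braid N) S (fun q => (q : ℂ)) (fun q => qpow q (1 - N)) d) (m : ℕ) :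
    lapTensor (fun q => (q : ℂ)) (fun q => qpow q (1 - N)) d (2 * m) 1 = classicalTensor N m := by
  have hd : IsCalculus N 1 (braid N 1) (d 1) := by
    simpa using C.isCalculus 1 one_pos
  have hE : metricSq N 1 = N := by
    rw [metricSq_eq_sum one_pos]
    simp [rhoPow, qpow]
  funext i
  rw [lapTensor, Nat.mul_div_cancel_left m two_pos, classical_laplacian_pow_word hd, map_smul,
    map_one, smul_eq_mul, mul_one, classicalTensor, div_eq_inv_mul, hE,
    show qpow 1 (1 - N) = 1 by simp [qpow], Complex.ofReal_one, lapNorm_one]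
  rfl

end QSphere

end

theorem proposition1 (N : ℕ) (hN : 1 ≤ N) :
    ∃ I : (n : ℕ) → ℝ → QSphere.QTensor N n,
      -- existence, for every even rank
      (∀ n, Even n →
        AnalyticOnNhd ℝ (I n) (Set.Ioi 0) ∧
        ∀ q : ℝ, 0 < q →
          I n q ≠ 0 ∧ QSphere.IsInvariant q (I n q) ∧ QSphere.IsSymmetric q (I n q)) ∧
      -- uniqueness up to normalization, on any interval around `q = 1`
      (∀ n, Even n → ∀ U : Set ℝ, IsOpen U → IsPreconnected U → 1 ∈ U → U ⊆ Set.Ioi 0 →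
        ∀ J : ℝ → QSphere.QTensor N n, AnalyticOnNhd ℝ J U →
          (∀ q ∈ U, QSphere.IsInvariant q (J q) ∧ QSphere.IsSymmetric q (J q)) →
          ∃ f : ℝ → ℂ, AnalyticOnNhd ℝ f U ∧ ∀ q ∈ U, J q = f q • I n q) ∧
      -- normalization
      (∀ q : ℝ, 0 < q → I 0 q = 1) ∧
      (∀ n, Even n → ∀ (q : ℝ), 0 < q → ∀ l : Fin (n + 1),
        QSphere.contract q l (I (n + 2) q) = I n q) ∧
      -- rank two
      (∀ q : ℝ, 0 < q → ∃ c : ℂ, c ≠ 0 ∧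
        ∀ i : Fin 2 → Fin N, I 2 q i = c * QSphere.metric N q (i 0) (i 1)) ∧
      -- explicit form through the Laplacian, in either of the two calculi
      (∀ B ∈ ({QSphere.calcFirst N, QSphere.calcSecond N} :
            Set (ℝ → Matrix (Fin N × Fin N) (Fin N × Fin N) ℂ)),
        (∀ q : ℝ, 0 < q → ∃! d, QSphere.IsCalculus N q (B q) d) ∧
        ∀ n, Even n → ∃ lam : ℝ → ℂ, AnalyticOnNhd ℝ lam (Set.Ioi 0) ∧
          ∀ q : ℝ, 0 < q → ∀ d, QSphere.IsCalculus N q (B q) d → ∀ i : Fin n → Fin N,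
            lam q • (QSphere.laplacian d ^ (n / 2))
                (List.ofFn fun k => QSphere.Eucl.x N q (i k)).prod
              = algebraMap ℂ (QSphere.Eucl N q) (I n q i)) ∧
      -- classical limit
      (∀ m : ℕ, I (2 * m) 1 = QSphere.classicalTensor N m) ∧
      -- the invariant integral over the quantum sphere and its uniqueness
      ∃ Φ : (q : ℝ) → (QSphere.Sphere N q →ₗ[ℂ] ℂ),
        QSphere.IsInvariantIntegral N (Set.Ioi 0) Φ ∧
        (∀ q : ℝ, 0 < q → Φ q 1 = 1 ∧
          (∀ n, Even n → QSphere.moments (Φ q) n = I n q) ∧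
          (∀ n, Odd n → QSphere.moments (Φ q) n = 0)) ∧
        ∀ U : Set ℝ, IsOpen U → IsPreconnected U → 1 ∈ U → U ⊆ Set.Ioi 0 →
          ∀ Ψ : (q : ℝ) → (QSphere.Sphere N q →ₗ[ℂ] ℂ), QSphere.IsInvariantIntegral N U Ψ →
            ∀ q ∈ U, Ψ q = Ψ q 1 • Φ q := by
  obtain ⟨d, C⟩ := QSphere.exists_calcFamily_braid hN
  obtain ⟨d', C'⟩ := QSphere.exists_calcFamily_braidInv hN
  have hR : ∀ q, 0 < q → Commute (QSphere.Oq.scalar N q (QSphere.braid N q)) (QSphere.Oq.AA N q) :=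
    fun q _ => QSphere.Oq.commute_braid
  have hI := C.isInvariantFamily hR hN
  obtain ⟨Φ, h1, h2, h3⟩ := hI.exists_integral hN
  refine ⟨_, fun n hn => ⟨hI.analytic n hn, fun q hq => ⟨hI.ne_zero hq hn, hI.invariant n hn q hq,
    hI.symmetric n hn q hq⟩⟩, fun n hn U hU _ _ hU0 J hJ hJi => hI.exists_eq_smul hN hU hU0 hn hJ hJi,
    hI.zero, hI.contract, fun q hq => C.lapTensor_two hN hq, ?_, C.lapTensor_one, Φ, h1, h2,
    fun U hU _ _ hU0 => h3 U hU hU0⟩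
  -- The tensors were built from the calculus with R̂, which is the second one; the calculus with
  -- R̂⁻¹ gives the same tensors by uniqueness.
  rintro B (rfl | rfl)
  · exact C'.laplacian_pow_word (fun q hq => QSphere.Oq.commute_braidInv hq) hN hI
      fun q hq => QSphere.calcFirst_eq hq
  · exact C.laplacian_pow_word hR hN hI fun q _ => rfl
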